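/- Let $D\ge 3$. For a metric $g_{ab}$ (mostly-plus signature) with Riemann tensor $R_{abcd}$, let an invariant of curvature order $n\ge 0$ be a real linear combination of complete contractions of $n$ Riemann tensors with inverse metrics (for $n=0$: a constant). A theory is a Lagrangian $\mathcal L(g^{ab},R_{abcd})$ that is a sum of such invariants of orders $0,1,2,\dots$; the sum is either finite or a formal expansion in the curvature order. With $P^{abcd}=\partial\mathcal L/\partial R_{abcd}$ its equations of motion are $$\mathcal E_{ab}=P_{acde}R_b{}^{cde}-\tfrac12\mathcal L\,g_{ab}+2\nabla^c\nabla^dP_{acbd}=0$$ (for a formal expansion: the formal series of the contributions of all orders). Consider the FLRW configurations $$ds^2=-F(t)\,dt^2+a(t)^2\Big(\frac{dr^2}{1-kr^2}+r^2d\Omega_{D-2}^2\Big),\qquad k\in\{-1,0,1\},\quad a,F>0\ \text{smooth}.$$ A theory is a *Cosmological Gravity* if $\mathcal E_{ab}$ on FLRW configurations involves $a$, $F$ and their time derivatives only up to second order. It is *trivial* if $\mathcal E_{ab}$ vanishes on all FLRW configurations. Two Cosmological Gravities are *equivalent* if both are trivial, or if neither is trivial and their $\mathcal E_{ab}$ on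 FLRW configurations are linearly dependent over $\mathbb R$. Let $R$ be the Ricci scalar, $Z_{ab}=R_{ab}-\frac1D g_{ab}R$ the traceless Ricci tensor, $$\mathcal K_2=\frac{Z_{ab}Z^{ab}}{D(D-1)},\qquad \mathcal K_3=-\frac{Z_{ab}Z^{bc}Z_c{}^a}{D(D-1)(D-2)},$$ and $$\mathcal C^{(n)}=R^n-\sum_{p=1}^{\lfloor n/2\rfloor}(2p-1)\binom n{2p}\Big(\frac{D(D-1)}{D-2}\Big)^{2p}R^{n-2p}(4\mathcal K_2)^p-\sum_{p=1}^{\lfloor (n-1)/2\rfloor}16p\binom n{2p+1}\Big(\frac{D(D-1)}{D-2}\Big)^{2p+1}R^{n-2p-1}(4\mathcal K_2)^{p-1}\mathcal K_3 ,$$ where empty sums are zero, so that $\mathcal C^{(0)}=1$ and $\mathcal C^{(1)}=R$. **Theorem.** (1) For every $n\ge 0$, $\mathcal C^{(n)}$ is an invariant of curvature order $n$ and a Cosmological Gravity, and it is trivial if and only if $D=2n$. Every non-trivial Cosmological Gravity that is an invariant of curvature order $n$ is equivalent to $\mathcal C^{(n)}$. Hence at order $n$ there is exactly one non-trivial equivalence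 class if $D\neq 2n$, and there is none if $D=2n$. (2) Let $\ell>0$. For all real $\Lambda,\mu_1,\mu_2,\dots$ the theory $$\mathcal L_{\rm cosmo}=-2\Lambda+\sum_{p\ge 1}\mu_p\,\ell^{2p-2}\,\mathcal C^{(p)}$$ is a Cosmological Gravity, and every Cosmological Gravity is equivalent to one of this form. This holds for formal infinite expansions, and also for theories of order at most $N$, with the sum in $\mathcal L_{\rm cosmo}$ running over $1\le p\le N$, for every $N\ge 0$. -/

import Mathlib

open Finset

noncomputable section

namespace CosmoGravity

/-! ### Lagrangians built from contractions of the Riemann tensor -/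

/-- Components of a tensor with four indices in dimension `D`. -/
abbrev Tensor4 (D : ℕ) := Fin D → Fin D → Fin D → Fin D → ℝ

/-- Lagrangians `L(g^{ab}, R_{abcd})`: the arguments are the components of the inverse metric and
of the Riemann tensor with all indices down. -/
abbrev Lagrangian (D : ℕ) := Matrix (Fin D) (Fin D) ℝ → Tensor4 D → ℝ

/-- A complete contraction of `n` Riemann tensors with `2 n` inverse metrics.  The bijection `σ`
says which index slot of the Riemann tensors is attached to which slot of the inverse metrics. -/
def contraction (D n : ℕ) (σ : Fin n × Fin 4 ≃ Fin (2 * n) × Fin 2) : Lagrangian D :=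
  fun ginv Rm => ∑ i : Fin n × Fin 4 → Fin D,
    (∏ v : Fin n, Rm (i (v, 0)) (i (v, 1)) (i (v, 2)) (i (v, 3))) *
      ∏ e : Fin (2 * n), ginv (i (σ.symm (e, 0))) (i (σ.symm (e, 1)))

/-- The linear combinations of curvature invariants of order `n` in the curvature. -/
def curvatureInvariants (D n : ℕ) : Submodule ℝ (Lagrangian D) :=
  Submodule.span ℝ (Set.range (contraction D n))

/-- The Ricci tensor `R_{ab} = R_{adb}{}^d = g^{de} R_{adbe}`. -/
def ricci {D : ℕ} (ginv : Matrix (Fin D) (Fin D) ℝ) (Rm : Tensor4 D) :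
    Matrix (Fin D) (Fin D) ℝ :=
  Matrix.of fun a b => ∑ d, ∑ e, ginv d e * Rm a d b e

/-- The Ricci scalar. -/
def ricciScalar (D : ℕ) : Lagrangian D :=
  fun ginv Rm => (ricci ginv Rm * ginv).trace

/-- The traceless Ricci tensor with one index raised, `Z_a{}^b = R_a{}^b - (R / D) δ_a^b`. -/
def tracelessRicci {D : ℕ} (ginv : Matrix (Fin D) (Fin D) ℝ) (Rm : Tensor4 D) :
    Matrix (Fin D) (Fin D) ℝ :=
  ricci ginv Rm * ginv - (ricciScalar D ginv Rm / (D : ℝ)) • (1 : Matrix (Fin D) (Fin D) ℝ)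

/-- `K₂ = Z_{ab} Z^{ab} / (D (D - 1))`. -/
def K2 (D : ℕ) : Lagrangian D := fun ginv Rm =>
  1 / ((D : ℝ) * ((D : ℝ) - 1)) * (tracelessRicci ginv Rm ^ 2).trace

/-- `K₃ = - Z_{ab} Z^{bc} Z_c{}^a / (D (D - 1) (D - 2))`. -/
def K3 (D : ℕ) : Lagrangian D := fun ginv Rm =>
  -(1 / ((D : ℝ) * ((D : ℝ) - 1) * ((D : ℝ) - 2))) * (tracelessRicci ginv Rm ^ 3).trace

/-- The representative `C^{(n)}`. -/
def cosmo (D n : ℕ) : Lagrangian D := fun ginv Rm =>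
  ricciScalar D ginv Rm ^ n
    - ∑ p ∈ Icc 1 (n / 2), (2 * (p : ℝ) - 1) * (n.choose (2 * p) : ℝ)
        * ((D : ℝ) * ((D : ℝ) - 1) / ((D : ℝ) - 2)) ^ (2 * p)
        * ricciScalar D ginv Rm ^ (n - 2 * p) * (4 * K2 D ginv Rm) ^ p
    - ∑ p ∈ Icc 1 ((n - 1) / 2), 16 * (p : ℝ) * (n.choose (2 * p + 1) : ℝ)
        * ((D : ℝ) * ((D : ℝ) - 1) / ((D : ℝ) - 2)) ^ (2 * p + 1)
        * ricciScalar D ginv Rm ^ (n - 2 * p - 1) * (4 * K2 D ginv Rm) ^ (p - 1)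
        * K3 D ginv Rm

/-! ### Curvature of a metric in coordinates -/

/-- A metric in a coordinate patch: the component matrix as a function of the coordinates. -/
abbrev MetricField (D : ℕ) := (Fin D → ℝ) → Matrix (Fin D) (Fin D) ℝ

/-- The partial derivative `∂_a f` at `y`. -/
def pderiv {D : ℕ} (a : Fin D) (f : (Fin D → ℝ) → ℝ) (y : Fin D → ℝ) : ℝ :=
  fderiv ℝ f y (Pi.single a 1)

/-- The Christoffel symbols; `christoffel g y c a b` is `Γ^c_{ab}`. -/
def christoffel {D : ℕ} (g : MetricField D) (y : Fin D → ℝ) (c a b : Fin D) : ℝ :=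
  1 / 2 * ∑ d, (g y)⁻¹ c d *
    (pderiv a (fun z => g z b d) y + pderiv b (fun z => g z a d) y - pderiv d (fun z => g z a b) y)

/-- The Riemann tensor `R_{abc}{}^d = ∂_b Γ^d_{ac} - ∂_a Γ^d_{bc} + Γ^e_{ac} Γ^d_{be}
- Γ^e_{bc} Γ^d_{ae}` (for which round spheres have positive Ricci tensor). -/
def riemannUp {D : ℕ} (g : MetricField D) (y : Fin D → ℝ) : Tensor4 D := fun a b c d =>
  pderiv b (fun z => christoffel g z d a c) y - pderiv a (fun z => christoffel g z d b c) y
    + ∑ e, (christoffel g y e a c * christoffel g y d b e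
      - christoffel g y e b c * christoffel g y d a e)

/-- The Riemann tensor with all indices down, `R_{abcd}`. -/
def riemann {D : ℕ} (g : MetricField D) (y : Fin D → ℝ) : Tensor4 D := fun a b c d =>
  ∑ e, riemannUp g y a b c e * g y e d

/-- `∇_d T^{acbd}` for a tensor field `T` with four upper indices. -/
def div4 {D : ℕ} (g : MetricField D) (T : (Fin D → ℝ) → Tensor4 D) (y : Fin D → ℝ)
    (a c b : Fin D) : ℝ :=
  ∑ d, (pderiv d (fun z => T z a c b d) y
    + ∑ f, (christoffel g y a d f * T y f c b d + christoffel g y c d f * T y a f b d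
      + christoffel g y b d f * T y a c f d + christoffel g y d d f * T y a c b f))

/-- `∇_c V^{acb}` for a tensor field `V` with three upper indices. -/
def div3 {D : ℕ} (g : MetricField D) (V : (Fin D → ℝ) → Fin D → Fin D → Fin D → ℝ)
    (y : Fin D → ℝ) (a b : Fin D) : ℝ :=
  ∑ c, (pderiv c (fun z => V z a c b) y
    + ∑ f, (christoffel g y a c f * V y f c b + christoffel g y c c f * V y a f b
      + christoffel g y b c f * V y a c f))

/-! ### The gravitational field equations -/

/-- Antisymmetrization in each of the two index pairs and symmetrization under their exchange. -/
def pairSymm {D : ℕ} (Q : Tensor4 D) : Tensor4 D := fun a b c d =>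
  1 / 8 * (Q a b c d - Q b a c d - Q a b d c + Q b a d c
    + Q c d a b - Q d c a b - Q c d b a + Q d c b a)

/-- The projection of a four-index tensor onto the tensors with the algebraic symmetries of the
Riemann tensor. -/
def riemannProj {D : ℕ} (Q : Tensor4 D) : Tensor4 D := fun a b c d =>
  pairSymm Q a b c d
    - 1 / 3 * (pairSymm Q a b c d + pairSymm Q a c d b + pairSymm Q a d b c)

/-- `P^{abcd} = ∂L / ∂R_{abcd}`, with the algebraic symmetries of the Riemann tensor. -/
def curvatureMomentum {D : ℕ} (L : Lagrangian D) (ginv : Matrix (Fin D) (Fin D) ℝ)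
    (Rm : Tensor4 D) : Tensor4 D :=
  riemannProj fun a b c d =>
    fderiv ℝ (L ginv) Rm (Pi.single a (Pi.single b (Pi.single c (Pi.single d 1))))

/-- The gravitational field equations of `L(g^{ab}, R_{abcd})` at the metric `g`, with raised
indices: `E^{ab} = P^{acde} R^b{}_{cde} - (1/2) L g^{ab} + 2 ∇_c ∇_d P^{acbd}`. -/
def fieldEq {D : ℕ} (L : Lagrangian D) (g : MetricField D) (y : Fin D → ℝ) :
    Matrix (Fin D) (Fin D) ℝ :=
  let P : (Fin D → ℝ) → Tensor4 D := fun z => curvatureMomentum L (g z)⁻¹ (riemann g z)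
  Matrix.of fun a b =>
    (∑ c, ∑ d, ∑ e, P y a c d e * ∑ h, (g y)⁻¹ b h * riemann g y h c d e)
      - 1 / 2 * L (g y)⁻¹ (riemann g y) * (g y)⁻¹ a b
      + 2 * div3 g (div4 g P) y a b

/-! ### FLRW configurations -/

/-- The FLRW metric `- F(t) dt² + a(t)² (dr² / (1 - k r²) + r² dΩ²)` in spacetime dimension
`d + 1`, in the coordinates `y = (t, x)` with `x = r n` and `n` in the unit sphere: the spatial
part is `a² (δ_ij + k x_i x_j / (1 - k |x|²))`. -/
def flrwMetric (d : ℕ) (k : ℝ) (a F : ℝ → ℝ) : MetricField (d + 1) := fun y =>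
  Matrix.of fun μ ν =>
    Fin.cases
      (Fin.cases (-F (y 0)) (fun _ => 0) ν)
      (fun i => Fin.cases 0
        (fun j => a (y 0) ^ 2 * ((if i = j then 1 else 0)
          + k * y i.succ * y j.succ / (1 - k * ∑ l : Fin d, y l.succ ^ 2))) ν)
      μ

/-- An FLRW configuration in spacetime dimension `d + 1`, together with a point `y = (t, x)` of
its coordinate patch. -/
structure FLRWEvent (d : ℕ) where
  k : ℝ
  a : ℝ → ℝ
  F : ℝ → ℝ
  y : Fin (d + 1) → ℝ
  k_mem : k = -1 ∨ k = 0 ∨ k = 1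
  a_smooth : ContDiff ℝ (⊤ : ℕ∞) a
  F_smooth : ContDiff ℝ (⊤ : ℕ∞) F
  a_pos : ∀ t, 0 < a t
  F_pos : ∀ t, 0 < F t
  patch : 0 < 1 - k * ∑ i : Fin d, y i.succ ^ 2

/-- Equality of two functions of time and of their first two derivatives at the time `t`. -/
def SameTwoJet (f h : ℝ → ℝ) (t : ℝ) : Prop :=
  f t = h t ∧ deriv f t = deriv h t ∧ iteratedDeriv 2 f t = iteratedDeriv 2 h t

/-- Equations on FLRW configurations are of second order in time derivatives if at every point
they involve `a`, `F` and their time derivatives only up to the second order. -/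
def SecondOrder {d : ℕ} {V : Type*} (E : FLRWEvent d → V) : Prop :=
  ∀ p q : FLRWEvent d, p.k = q.k → p.y = q.y →
    SameTwoJet p.a q.a (p.y 0) → SameTwoJet p.F q.F (p.y 0) → E p = E q

/-- Equivalence of equations on FLRW configurations: they are linearly dependent, where the zero
equations are equivalent only to themselves. -/
def EquivEq {d : ℕ} {V : Type*} [AddCommGroup V] [Module ℝ V] (E₁ E₂ : FLRWEvent d → V) : Prop :=
  (E₁ = 0 ↔ E₂ = 0) ∧ ¬ LinearIndependent ℝ ![E₁, E₂]

/-! ### Cosmological Gravities -/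

/-- The equations of motion of `L` on FLRW configurations. -/
def flrwEq {d : ℕ} (L : Lagrangian (d + 1)) (p : FLRWEvent d) :
    Matrix (Fin (d + 1)) (Fin (d + 1)) ℝ :=
  fieldEq L (flrwMetric d p.k p.a p.F) p.y

/-- The Lagrangian `L` defines a Cosmological Gravity. -/
def IsCosmological {d : ℕ} (L : Lagrangian (d + 1)) : Prop := SecondOrder (flrwEq L)

/-- `L` has identically vanishing equations of motion on FLRW configurations. -/
def IsTrivial {d : ℕ} (L : Lagrangian (d + 1)) : Prop := flrwEq L = 0

/-- Equivalence of (Cosmological) Gravities. -/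
def Equivalent {d : ℕ} (L₁ L₂ : Lagrangian (d + 1)) : Prop := EquivEq (flrwEq L₁) (flrwEq L₂)

/-- A higher-curvature expansion `∑ n, L n` with `L n` of order `n` in the curvature (and the
coupling constants absorbed in `L n`). -/
def IsExpansion {D : ℕ} (L : ℕ → Lagrangian D) : Prop := ∀ n, L n ∈ curvatureInvariants D n

/-- The equations of motion of an expansion on FLRW configurations, as a formal series graded by
the curvature order: the sequence of the contributions of all orders. -/
def flrwEqSeries {d : ℕ} (L : ℕ → Lagrangian (d + 1)) (p : FLRWEvent d) :
    ℕ → Matrix (Fin (d + 1)) (Fin (d + 1)) ℝ :=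
  fun n => flrwEq (L n) p

/-- The expansion `- 2 Λ + ∑_{p ≥ 1} μ_p ℓ^{2 p - 2} C^{(p)}`. -/
def cosmoExpansion (D : ℕ) (lam ell : ℝ) (mu : ℕ → ℝ) : ℕ → Lagrangian D
  | 0 => fun _ _ => -2 * lam
  | p + 1 => (mu (p + 1) * ell ^ (2 * p)) • cosmo D (p + 1)

end CosmoGravity

end

open CosmoGravity

/-!
In an orthonormal frame the Riemann tensor of an FLRW metric has only two independent components,
the time-space curvature `A` and the spatial curvature `B`, so on these configurations a covariant
Lagrangian and its curvature momentum are determined by the reduced function `f(A, B)` and its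
gradient. The third time derivatives in the field equations have coefficient `∂²f/∂A²`, so
second-order equations force `f(A, B) = u(B) + A v(B)`. At the maximally symmetric points `A = B`
the curvature momentum is Lorentz invariant, which ties `v` to `u`, and the field equations become
a generalized Friedmann equation in `u` alone. At curvature order `n` homogeneity gives
`u = α Bⁿ` and `v = β Bⁿ⁻¹` with `(D - 2n) β = 2n α`, so `α` determines the field equations and
vanishes for `D = 2n`. The invariant `C⁽ⁿ⁾` is affine in `A` because the sums defining it are the
even and the odd part of one binomial expansion.
-/

noncomputable section

namespace CosmoGravity

open scoped Matrix ContDiff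

/-! ### Sums over index assignments -/

section IndexSums

variable {X : Type*} [Fintype X]

lemma prod_sum_arrow {V S 𝕜 : Type*} [Fintype V] [DecidableEq V] [Fintype S] [DecidableEq S]
    [CommSemiring 𝕜] (f : V → (S → X) → 𝕜) :
    ∏ v, ∑ w : S → X, f v w = ∑ j : V × S → X, ∏ v, f v (fun s => j (v, s)) := by
  rw [Finset.prod_univ_sum, Fintype.piFinset_univ]
  exact (Fintype.sum_equiv (Equiv.curry V S X) _ _ fun _ => rfl).symm

variable {M : Type*} [AddCommMonoid M]

lemma sum_arrow_fin_succ {n : ℕ} (f : (Fin (n + 1) → X) → M) :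
    ∑ w, f w = ∑ x, ∑ w, f (Fin.cons x w) := by
  rw [← Fintype.sum_prod_type']
  exact (Fintype.sum_equiv (Fin.consEquiv fun _ => X) _ _ fun _ => rfl).symm

lemma sum_arrow_fin_two (f : (Fin 2 → X) → M) : ∑ w, f w = ∑ a, ∑ b, f ![a, b] := by
  simp only [sum_arrow_fin_succ, Fintype.sum_unique]
  rfl

lemma sum_arrow_fin_three (f : (Fin 3 → X) → M) :
    ∑ w, f w = ∑ a, ∑ b, ∑ c, f ![a, b, c] := by
  simp only [sum_arrow_fin_succ, Fintype.sum_unique]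
  rfl

lemma sum_arrow_fin_four (f : (Fin 4 → X) → M) :
    ∑ w, f w = ∑ a, ∑ b, ∑ c, ∑ d, f ![a, b, c, d] := by
  simp only [sum_arrow_fin_succ, Fintype.sum_unique]
  rfl

end IndexSums

section MatrixPowers

variable {ι 𝕜 : Type*} [Fintype ι] [DecidableEq ι] [CommSemiring 𝕜]

lemma matrix_pow_succ_apply_eq_sum_prod (M : Matrix ι ι 𝕜) (k : ℕ) (x y : ι) :
    (M ^ (k + 1)) x y = ∑ a : Fin k → ι, ∏ v : Fin (k + 1),
      M (Fin.cons (α := fun _ => ι) x a v) (Fin.snoc (α := fun _ => ι) a y v) := by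
  induction k generalizing x with
  | zero => simp [Fin.snoc]
  | succ k ih =>
    rw [pow_succ', Matrix.mul_apply, sum_arrow_fin_succ]
    refine Finset.sum_congr rfl fun z _ => ?_
    rw [ih, Finset.mul_sum]
    refine Finset.sum_congr rfl fun a _ => ?_
    simp only [Fin.prod_univ_succ (n := k + 1), Fin.cons_zero, Fin.cons_succ,
      ← Fin.cons_snoc_eq_snoc_cons]

lemma trace_pow_succ_eq_sum_prod (M : Matrix ι ι 𝕜) (k : ℕ) :
    (M ^ (k + 1)).trace =
      ∑ a : Fin (k + 1) → ι, ∏ v, M (a v) (a (finRotate (k + 1) v)) := by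
  simp only [Matrix.trace, Matrix.diag_apply, matrix_pow_succ_apply_eq_sum_prod,
    Fin.snoc_eq_cons_rotate, sum_arrow_fin_succ (n := k)]

end MatrixPowers

/-! ### Curvature invariants -/

section Act

variable {D : ℕ}

/-- The action of a matrix on all four indices of a tensor, by which the Riemann tensor changes
under a linear change of frame. -/
def act (M : Matrix (Fin D) (Fin D) ℝ) (R : Tensor4 D) : Tensor4 D := fun a b c d =>
  ∑ a', ∑ b', ∑ c', ∑ d', M a a' * M b b' * M c c' * M d d' * R a' b' c' d'

lemma act_eq_sum_arrow (M : Matrix (Fin D) (Fin D) ℝ) (R : Tensor4 D) (i : Fin 4 → Fin D) :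
    act M R (i 0) (i 1) (i 2) (i 3) =
      ∑ w : Fin 4 → Fin D, (∏ s, M (i s) (w s)) * R (w 0) (w 1) (w 2) (w 3) := by
  rw [sum_arrow_fin_four]
  simp [act, Fin.prod_univ_four]

lemma conj_eq_sum_arrow (M G : Matrix (Fin D) (Fin D) ℝ) (j : Fin 2 → Fin D) :
    (Mᵀ * G * M) (j 0) (j 1) =
      ∑ w : Fin 2 → Fin D, (∏ s, M (w s) (j s)) * G (w 0) (w 1) := by
  rw [sum_arrow_fin_two, Finset.sum_comm]
  simp only [Matrix.mul_apply, Matrix.transpose_apply, Finset.sum_mul, Fin.prod_univ_two,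
    Matrix.cons_val_zero, Matrix.cons_val_one, mul_right_comm]

lemma prod_act {V : Type*} [Fintype V] [DecidableEq V] (M : Matrix (Fin D) (Fin D) ℝ)
    (R : Tensor4 D) (i : V × Fin 4 → Fin D) :
    ∏ v, act M R (i (v, 0)) (i (v, 1)) (i (v, 2)) (i (v, 3)) =
      ∑ j : V × Fin 4 → Fin D, (∏ x, M (i x) (j x)) *
        ∏ v, R (j (v, 0)) (j (v, 1)) (j (v, 2)) (j (v, 3)) := by
  simp only [fun v => act_eq_sum_arrow M R fun s => i (v, s), prod_sum_arrow,
    Finset.prod_mul_distrib, Fintype.prod_prod_type]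

lemma prod_conj {X E : Type*} [Fintype X] [DecidableEq X] [Fintype E]
    (σ : X ≃ E × Fin 2) (M G : Matrix (Fin D) (Fin D) ℝ) (j : X → Fin D) :
    ∏ e, (Mᵀ * G * M) (j (σ.symm (e, 0))) (j (σ.symm (e, 1))) =
      ∑ i : X → Fin D, (∏ x, M (i x) (j x)) * ∏ e, G (i (σ.symm (e, 0))) (i (σ.symm (e, 1))) := by
  classical
  simp only [fun e => conj_eq_sum_arrow M G fun s => j (σ.symm (e, s)), prod_sum_arrow,
    Finset.prod_mul_distrib, ← Fintype.prod_prod_type fun x : E × Fin 2 => M _ (j (σ.symm x))]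
  refine (Fintype.sum_equiv (σ.arrowCongr (Equiv.refl (Fin D))) _ _ fun i => ?_).symm
  congr 1
  exact Fintype.prod_equiv σ _ _ fun x => by simp [Equiv.arrowCongr]

variable {n : ℕ} (σ : Fin n × Fin 4 ≃ Fin (2 * n) × Fin 2) (G : Matrix (Fin D) (Fin D) ℝ)

lemma contraction_act (M : Matrix (Fin D) (Fin D) ℝ) (R : Tensor4 D) :
    contraction D n σ G (act M R) = contraction D n σ (Mᵀ * G * M) R := by
  simp only [contraction, prod_act, prod_conj, Finset.sum_mul, Finset.mul_sum]
  rw [Finset.sum_comm]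
  exact Finset.sum_congr rfl fun j _ => Finset.sum_congr rfl fun i _ => by ring

lemma contDiff_contraction : ContDiff ℝ ∞ (contraction D n σ G) := by
  have h_entry (i : Fin n × Fin 4 → Fin D) (v : Fin n) : ContDiff ℝ ∞ fun R : Tensor4 D =>
      R (i (v, 0)) (i (v, 1)) (i (v, 2)) (i (v, 3)) := by fun_prop
  exact ContDiff.sum fun i _ => (contDiff_prod fun v _ => h_entry i v).mul contDiff_const

lemma contraction_smul (R : Tensor4 D) (c : ℝ) :
    contraction D n σ G (c • R) = c ^ n * contraction D n σ G R := by
  simp only [contraction, Pi.smul_apply, smul_eq_mul, Finset.prod_mul_distrib, Finset.mul_sum,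
    Finset.prod_const, Finset.card_univ, Fintype.card_fin, mul_assoc]

end Act

/-- Smooth Lagrangians that are covariant under linear changes of the frame. This is all that the
reduction to FLRW configurations uses of a curvature invariant. -/
structure IsInvariant {D : ℕ} (L : Lagrangian D) : Prop where
  contDiff : ∀ G, ContDiff ℝ ∞ (L G)
  apply_act : ∀ G M R, L G (act M R) = L (Mᵀ * G * M) R

namespace IsInvariant

variable {D : ℕ} {L L' : Lagrangian D}

lemma zero : IsInvariant (0 : Lagrangian D) :=
  ⟨fun _ => contDiff_const, fun _ _ _ => rfl⟩

lemma add (h : IsInvariant L) (h' : IsInvariant L') : IsInvariant (L + L') :=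
  ⟨fun G => (h.contDiff G).add (h'.contDiff G), fun G M R => by
    simp only [Pi.add_apply, h.apply_act, h'.apply_act]⟩

lemma smul (h : IsInvariant L) (c : ℝ) : IsInvariant (c • L) :=
  ⟨fun G => (h.contDiff G).const_smul c, fun G M R => by
    simp only [Pi.smul_apply, h.apply_act]⟩

lemma sum {ι : Type*} {L : ι → Lagrangian D} {s : Finset ι} (h : ∀ i ∈ s, IsInvariant (L i)) :
    IsInvariant (∑ i ∈ s, L i) :=
  Finset.sum_induction _ _ (fun _ _ => add) zero h

lemma of_mem {n : ℕ} (h : L ∈ curvatureInvariants D n) : IsInvariant L := by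
  induction h using Submodule.span_induction with
  | mem L hL =>
    obtain ⟨σ, rfl⟩ := hL
    exact ⟨contDiff_contraction σ, contraction_act σ⟩
  | zero => exact zero
  | add L L' _ _ h h' => exact h.add h'
  | smul c L _ h => exact h.smul c

end IsInvariant

lemma map_smul_of_mem_curvatureInvariants {D n : ℕ} {L : Lagrangian D}
    (h : L ∈ curvatureInvariants D n) (G : Matrix (Fin D) (Fin D) ℝ) (R : Tensor4 D) (c : ℝ) :
    L G (c • R) = c ^ n * L G R := by
  induction h using Submodule.span_induction with
  | mem L hL =>
    obtain ⟨σ, rfl⟩ := hL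
    exact contraction_smul σ G R c
  | zero => exact (mul_zero _).symm
  | add L L' _ _ h h' => simp only [Pi.add_apply, h, h', mul_add]
  | smul a L _ h => simp only [Pi.smul_apply, h, smul_eq_mul, mul_left_comm]

section Graphs

/-- A complete contraction with the Riemann tensors labelled by `V` and the inverse metrics by `E`,
instead of by initial segments of `ℕ`. -/
def graphContraction (D : ℕ) {V E : Type*} [Fintype V] [Fintype E] [DecidableEq V]
    (σ : V × Fin 4 ≃ E × Fin 2) : Lagrangian D :=
  fun ginv Rm => ∑ i : V × Fin 4 → Fin D,
    (∏ v, Rm (i (v, 0)) (i (v, 1)) (i (v, 2)) (i (v, 3))) *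
      ∏ e, ginv (i (σ.symm (e, 0))) (i (σ.symm (e, 1)))

variable {V E : Type*} [Fintype V] [Fintype E] [DecidableEq V] (D : ℕ)

lemma graphContraction_congr {V' E' : Type*} [Fintype V'] [Fintype E'] [DecidableEq V']
    (σ : V × Fin 4 ≃ E × Fin 2) (eV : V ≃ V') (eE : E ≃ E') :
    graphContraction D (((eV.prodCongr (Equiv.refl _)).symm.trans σ).trans
      (eE.prodCongr (Equiv.refl _))) = graphContraction D σ := by
  funext G R
  refine (Fintype.sum_equiv ((eV.prodCongr (Equiv.refl (Fin 4))).arrowCongr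
    (Equiv.refl (Fin D))) _ _ fun i => ?_).symm
  congr 1
  · exact Fintype.prod_equiv eV _ _ fun v => by simp [Equiv.arrowCongr]
  · exact Fintype.prod_equiv eE _ _ fun e => by simp [Equiv.arrowCongr, Prod.map]

lemma graphContraction_mem_curvatureInvariants (σ : V × Fin 4 ≃ E × Fin 2) {n : ℕ}
    (hV : Fintype.card V = n) : graphContraction D σ ∈ curvatureInvariants D n := by
  have hE : Fintype.card E = 2 * n := by
    have := Fintype.card_congr σ
    simp only [Fintype.card_prod, Fintype.card_fin] at this
    omega
  rw [← graphContraction_congr D σ (Fintype.equivFinOfCardEq hV) (Fintype.equivFinOfCardEq hE)]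
  exact Submodule.subset_span ⟨_, rfl⟩

lemma contraction_mul_contraction {n m : ℕ} (σ : Fin n × Fin 4 ≃ Fin (2 * n) × Fin 2)
    (τ : Fin m × Fin 4 ≃ Fin (2 * m) × Fin 2) :
    contraction D n σ * contraction D m τ = graphContraction D
      (((Equiv.sumProdDistrib _ _ _).trans (Equiv.sumCongr σ τ)).trans
        (Equiv.sumProdDistrib _ _ _).symm) := by
  funext G R
  simp only [Pi.mul_apply, contraction, graphContraction]
  rw [Fintype.sum_mul_sum, ← Fintype.sum_prod_type']
  refine Fintype.sum_equiv (((Equiv.sumArrowEquivProdArrow _ _ _).symm).trans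
    (Equiv.arrowCongr (Equiv.sumProdDistrib _ _ _).symm (Equiv.refl (Fin D)))) _ _ ?_
  rintro ⟨i, j⟩
  simp only [Fintype.prod_sum_type, Equiv.arrowCongr, Equiv.trans_apply, Equiv.coe_fn_mk,
    Function.comp_apply, Equiv.refl_apply, Equiv.symm_symm, Equiv.symm_trans_apply,
    Equiv.sumProdDistrib_apply_left, Equiv.sumProdDistrib_apply_right, Equiv.sumCongr_symm,
    Equiv.sumCongr_apply, Sum.map_inl, Sum.map_inr, Equiv.apply_symm_apply,
    Equiv.sumArrowEquivProdArrow_symm_apply_inl, Equiv.sumArrowEquivProdArrow_symm_apply_inr]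
  ring

instance : SetLike.GradedMonoid (curvatureInvariants D) where
  one_mem := by
    convert graphContraction_mem_curvatureInvariants D
      (Equiv.equivOfIsEmpty (Empty × Fin 4) (Empty × Fin 2)) Fintype.card_eq_zero using 1
    funext G R
    simp [graphContraction]
  mul_mem n m L L' hL hL' := by
    have h_span : curvatureInvariants D n * curvatureInvariants D m ≤
        curvatureInvariants D (n + m) := by
      rw [curvatureInvariants, curvatureInvariants, Submodule.span_mul_span, Submodule.span_le]
      rintro _ ⟨_, ⟨σ, rfl⟩, _, ⟨τ, rfl⟩, rfl⟩
      beta_reduce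
      rw [contraction_mul_contraction]
      exact graphContraction_mem_curvatureInvariants D _ (by simp)
    exact h_span (Submodule.mul_mem_mul hL hL')

end Graphs

section RicciTraces

/-- The index pattern of a product of traces of powers of the Ricci tensor, one factor for each
cycle of `ν`: the edges of the first kind contract each Riemann tensor to a Ricci tensor, those of
the second kind join it to the next Ricci tensor along its cycle. -/
def ricciPattern {V : Type*} (ν : Equiv.Perm V) : V × Fin 4 ≃ (V ⊕ V) × Fin 2 where
  toFun x := ![(Sum.inr (ν.symm x.1), 1), (Sum.inl x.1, 0), (Sum.inr x.1, 0), (Sum.inl x.1, 1)] x.2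
  invFun y := Sum.elim (fun v => ![(v, 1), (v, 3)] y.2) (fun v => ![(v, 2), (ν v, 0)] y.2) y.1
  left_inv := by
    rintro ⟨v, s⟩
    fin_cases s <;> simp
  right_inv := by
    rintro ⟨v | v, s⟩ <;> fin_cases s <;> simp

variable {D : ℕ}

lemma ricci_mul_apply_eq_sum_arrow (G : Matrix (Fin D) (Fin D) ℝ) (R : Tensor4 D) (a c : Fin D) :
    (ricci G R * G) a c =
      ∑ w : Fin 3 → Fin D, R a (w 0) (w 1) (w 2) * G (w 0) (w 2) * G (w 1) c := by
  rw [sum_arrow_fin_three, Finset.sum_comm]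
  simp only [ricci, Matrix.mul_apply, Matrix.of_apply, Finset.sum_mul, Matrix.cons_val_zero,
    Matrix.cons_val_one, Matrix.cons_val, mul_comm (G _ _) (R _ _ _ _)]

lemma graphContraction_ricciPattern {V : Type*} [Fintype V] [DecidableEq V] (ν : Equiv.Perm V)
    (G : Matrix (Fin D) (Fin D) ℝ) (R : Tensor4 D) :
    graphContraction D (ricciPattern ν) G R =
      ∑ a : V → Fin D, ∏ v, (ricci G R * G) (a v) (a (ν v)) := by
  simp only [ricci_mul_apply_eq_sum_arrow, Finset.prod_univ_sum, Fintype.piFinset_univ]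
  rw [← Fintype.sum_prod_type']
  let e : (V → Fin D) × (V → Fin 3 → Fin D) ≃ (V × Fin 4 → Fin D) :=
    ((Equiv.arrowProdEquivProdArrow V (fun _ => Fin D) (fun _ => Fin 3 → Fin D)).symm.trans
      (Equiv.arrowCongr (Equiv.refl V) (Fin.consEquiv (fun _ : Fin 4 => Fin D)))).trans
      (Equiv.curry V (Fin 4) (Fin D)).symm
  have e_zero x v : e x (v, 0) = x.1 v := rfl
  have e_one x v : e x (v, 1) = x.2 v 0 := rfl
  have e_two x v : e x (v, 2) = x.2 v 1 := rfl
  have e_three x v : e x (v, 3) = x.2 v 2 := rfl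
  refine (Fintype.sum_equiv e _ _ fun x => ?_).symm
  simp [Fintype.prod_sum_type, ricciPattern, e_zero, e_one, e_two, e_three,
    Finset.prod_mul_distrib, mul_assoc]

variable (D)

lemma trace_ricci_pow_mem_curvatureInvariants (k : ℕ) :
    (fun G R => ((ricci G R * G) ^ k).trace : Lagrangian D) ∈ curvatureInvariants D k := by
  cases k with
  | zero =>
    convert Submodule.smul_mem _ (D : ℝ) (SetLike.one_mem_graded (curvatureInvariants D)) using 1
    funext G R
    simp
  | succ k =>
    convert graphContraction_mem_curvatureInvariants D (ricciPattern (finRotate (k + 1)))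
      (Fintype.card_fin _) using 1
    funext G R
    rw [graphContraction_ricciPattern, trace_pow_succ_eq_sum_prod]

lemma ricciScalar_mem_curvatureInvariants : ricciScalar D ∈ curvatureInvariants D 1 := by
  convert trace_ricci_pow_mem_curvatureInvariants D 1 using 1
  funext G R
  rw [pow_one, ricciScalar]

lemma trace_tracelessRicci_pow (G : Matrix (Fin D) (Fin D) ℝ) (R : Tensor4 D) (k : ℕ) :
    (tracelessRicci G R ^ k).trace = ∑ j ∈ range (k + 1),
      ((-1 / D) ^ (k - j) * k.choose j) *
        (((ricci G R * G) ^ j).trace * ricciScalar D G R ^ (k - j)) := by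
  have h_comm : Commute (ricci G R * G)
      ((-1 / D * ricciScalar D G R) • (1 : Matrix (Fin D) (Fin D) ℝ)) :=
    (Commute.one_right _).smul_right _
  have h_eq : tracelessRicci G R =
      ricci G R * G + (-1 / D * ricciScalar D G R) • (1 : Matrix (Fin D) (Fin D) ℝ) := by
    rw [tracelessRicci, sub_eq_add_neg, ← neg_smul]
    ring_nf
  rw [h_eq, h_comm.add_pow, Matrix.trace_sum]
  refine Finset.sum_congr rfl fun j _ => ?_
  rw [smul_pow, one_pow, mul_smul_comm, mul_one, ← nsmul_eq_mul', Matrix.trace_smul,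
    Matrix.trace_smul, nsmul_eq_mul, smul_eq_mul, mul_pow]
  ring

lemma trace_tracelessRicci_pow_mem_curvatureInvariants (k : ℕ) :
    (fun G R => (tracelessRicci G R ^ k).trace : Lagrangian D) ∈ curvatureInvariants D k := by
  have h_eq : (fun G R => (tracelessRicci G R ^ k).trace : Lagrangian D) =
      ∑ j ∈ range (k + 1), ((-1 / D) ^ (k - j) * k.choose j : ℝ) •
        ((fun G R => ((ricci G R * G) ^ j).trace) * ricciScalar D ^ (k - j)) := by
    funext G R
    simp only [trace_tracelessRicci_pow, Finset.sum_apply, Pi.smul_apply, Pi.mul_apply,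
      Pi.pow_apply, smul_eq_mul]
  rw [h_eq]
  refine Submodule.sum_mem _ fun j hj => Submodule.smul_mem _ _ ?_
  have h_mul := SetLike.mul_mem_graded (trace_ricci_pow_mem_curvatureInvariants D j)
    (SetLike.pow_mem_graded (k - j) (ricciScalar_mem_curvatureInvariants D))
  have h_degree : j + (k - j) • 1 = k := by
    rw [smul_eq_mul, mul_one, Nat.add_sub_cancel' (Finset.mem_range_succ_iff.mp hj)]
  rwa [h_degree] at h_mul

lemma K2_mem_curvatureInvariants : K2 D ∈ curvatureInvariants D 2 :=
  Submodule.smul_mem _ (1 / ((D : ℝ) * ((D : ℝ) - 1)))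
    (trace_tracelessRicci_pow_mem_curvatureInvariants D 2)

lemma K3_mem_curvatureInvariants : K3 D ∈ curvatureInvariants D 3 :=
  Submodule.smul_mem _ (-(1 / ((D : ℝ) * ((D : ℝ) - 1) * ((D : ℝ) - 2))))
    (trace_tracelessRicci_pow_mem_curvatureInvariants D 3)

lemma cosmo_eq_sum_smul (n : ℕ) : cosmo D n = ricciScalar D ^ n
    - ∑ p ∈ Icc 1 (n / 2), ((2 * (p : ℝ) - 1) * (n.choose (2 * p) : ℝ)
        * ((D : ℝ) * ((D : ℝ) - 1) / ((D : ℝ) - 2)) ^ (2 * p)) •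
          (ricciScalar D ^ (n - 2 * p) * ((4 : ℝ) • K2 D) ^ p)
    - ∑ p ∈ Icc 1 ((n - 1) / 2), (16 * (p : ℝ) * (n.choose (2 * p + 1) : ℝ)
        * ((D : ℝ) * ((D : ℝ) - 1) / ((D : ℝ) - 2)) ^ (2 * p + 1)) •
          (ricciScalar D ^ (n - 2 * p - 1) * ((4 : ℝ) • K2 D) ^ (p - 1) * K3 D) := by
  funext G R
  simp only [cosmo, Pi.sub_apply, Finset.sum_apply, Pi.smul_apply, Pi.mul_apply, Pi.pow_apply,
    smul_eq_mul, mul_assoc]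

lemma cosmo_mem_curvatureInvariants (n : ℕ) : cosmo D n ∈ curvatureInvariants D n := by
  have h_scalar (j : ℕ) : ricciScalar D ^ j ∈ curvatureInvariants D j := by
    simpa using SetLike.pow_mem_graded j (ricciScalar_mem_curvatureInvariants D)
  have h_K2 (j : ℕ) : ((4 : ℝ) • K2 D) ^ j ∈ curvatureInvariants D (j * 2) :=
    SetLike.pow_mem_graded j (Submodule.smul_mem _ _ (K2_mem_curvatureInvariants D))
  rw [cosmo_eq_sum_smul]
  refine Submodule.sub_mem _ (Submodule.sub_mem _ (h_scalar n) (Submodule.sum_mem _ fun p hp => ?_))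
    (Submodule.sum_mem _ fun p hp => ?_) <;>
    refine Submodule.smul_mem _ _ ?_ <;> rw [Finset.mem_Icc] at hp
  · have h_mul := SetLike.mul_mem_graded (h_scalar (n - 2 * p)) (h_K2 p)
    rwa [show n - 2 * p + p * 2 = n by omega] at h_mul
  · have h_mul := SetLike.mul_mem_graded (SetLike.mul_mem_graded (h_scalar (n - 2 * p - 1))
      (h_K2 (p - 1))) (K3_mem_curvatureInvariants D)
    rwa [show n - 2 * p - 1 + (p - 1) * 2 + 3 = n by omega] at h_mul

end RicciTraces

/-! ### Algebra of four-index tensors -/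

section FourIndexTensors

variable {D : ℕ} (M N : Matrix (Fin D) (Fin D) ℝ) (Q Q' : Tensor4 D)

lemma act_add : act M (Q + Q') = act M Q + act M Q' := by
  funext a b c d
  simp only [act, Pi.add_apply, mul_add, Finset.sum_add_distrib]

lemma act_smul (r : ℝ) : act M (r • Q) = r • act M Q := by
  funext a b c d
  simp only [act, Pi.smul_apply, smul_eq_mul, Finset.mul_sum, mul_left_comm]

/-- The action of a matrix on four-index tensors as a continuous linear map. -/
def actL : Tensor4 D →L[ℝ] Tensor4 D :=
  LinearMap.toContinuousLinearMap
    { toFun := act M, map_add' := act_add M, map_smul' := fun r Q => act_smul M Q r }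

lemma actL_apply : actL M Q = act M Q := rfl

lemma act_sub : act M (Q - Q') = act M Q - act M Q' :=
  (actL M).map_sub Q Q'

variable {Q Q'} in
lemma tensor4_ext (h : ∀ i : Fin 4 → Fin D,
    Q (i 0) (i 1) (i 2) (i 3) = Q' (i 0) (i 1) (i 2) (i 3)) : Q = Q' := by
  funext a b c d
  exact h ![a, b, c, d]

lemma act_act : act M (act N Q) = act (M * N) Q := by
  refine tensor4_ext fun i => ?_
  simp only [act_eq_sum_arrow M, act_eq_sum_arrow (M * N), act_eq_sum_arrow N, Matrix.mul_apply,
    Finset.prod_univ_sum, Fintype.piFinset_univ, Finset.mul_sum, Finset.sum_mul,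
    Finset.prod_mul_distrib]
  rw [Finset.sum_comm]
  exact Finset.sum_congr rfl fun _ _ => Finset.sum_congr rfl fun _ _ => by ring

lemma act_one : act 1 Q = Q := by
  funext a b c d
  simp [act, Matrix.one_apply]

lemma act_diagonal (s : Fin D → ℝ) (a b c d : Fin D) :
    act (Matrix.diagonal s) Q a b c d = s a * s b * s c * s d * Q a b c d := by
  simp [act, Matrix.diagonal_apply]

/-- Rearrangement of the indices of a tensor: the index in slot `s` of `Q` is read from
slot `τ s`. -/
def reindex (τ : Fin 4 → Fin 4) (Q : Tensor4 D) : Tensor4 D := fun a b c d =>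
  Q (![a, b, c, d] (τ 0)) (![a, b, c, d] (τ 1)) (![a, b, c, d] (τ 2)) (![a, b, c, d] (τ 3))

lemma reindex_eq (τ : Fin 4 → Fin 4) (i : Fin 4 → Fin D) :
    reindex τ Q (i 0) (i 1) (i 2) (i 3) = Q (i (τ 0)) (i (τ 1)) (i (τ 2)) (i (τ 3)) := by
  have h_vec : ![i 0, i 1, i 2, i 3] = i := by
    ext s
    fin_cases s <;> rfl
  simp only [reindex, h_vec]

variable {τ : Fin 4 → Fin 4} (hτ : τ.Bijective)

include hτ in
lemma act_reindex : act M (reindex τ Q) = reindex τ (act M Q) := by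
  refine tensor4_ext fun i => ?_
  rw [reindex_eq, act_eq_sum_arrow, act_eq_sum_arrow M Q fun s => i (τ s)]
  refine Fintype.sum_equiv ((Equiv.ofBijective τ hτ).symm.arrowCongr (Equiv.refl _)) _ _
    fun w => ?_
  rw [reindex_eq]
  congr 1
  exact (Fintype.prod_bijective τ hτ _ _ fun s => rfl).symm

lemma pairSymm_act : pairSymm (act M Q) = act M (pairSymm Q) := by
  have h_pairSymm (Q : Tensor4 D) : pairSymm Q = (1 / 8 : ℝ) • (Q - reindex ![1, 0, 2, 3] Q
      - reindex ![0, 1, 3, 2] Q + reindex ![1, 0, 3, 2] Q + reindex ![2, 3, 0, 1] Q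
      - reindex ![3, 2, 0, 1] Q - reindex ![2, 3, 1, 0] Q + reindex ![3, 2, 1, 0] Q) := rfl
  have h_perm (τ : Fin 4 → Fin 4) (hτ : τ.Bijective := by decide) :
      act M (reindex τ Q) = reindex τ (act M Q) := act_reindex M Q hτ
  rw [h_pairSymm, h_pairSymm]
  simp only [act_smul, act_add, act_sub]
  rw [h_perm ![1, 0, 2, 3], h_perm ![0, 1, 3, 2], h_perm ![1, 0, 3, 2], h_perm ![2, 3, 0, 1],
    h_perm ![3, 2, 0, 1], h_perm ![2, 3, 1, 0], h_perm ![3, 2, 1, 0]]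

lemma riemannProj_act : riemannProj (act M Q) = act M (riemannProj Q) := by
  have h_proj (Q : Tensor4 D) : riemannProj Q = pairSymm Q - (1 / 3 : ℝ) • (pairSymm Q
      + reindex ![0, 2, 3, 1] (pairSymm Q) + reindex ![0, 3, 1, 2] (pairSymm Q)) := rfl
  rw [h_proj, h_proj, pairSymm_act]
  simp only [act_smul, act_add, act_sub]
  rw [act_reindex (τ := ![0, 2, 3, 1]) M _ (by decide),
    act_reindex (τ := ![0, 3, 1, 2]) M _ (by decide)]

variable (a b c d : Fin D)

lemma riemannProj_swap₁₂ : riemannProj Q b a c d = -riemannProj Q a b c d := by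
  simp only [riemannProj, pairSymm]
  ring

lemma riemannProj_swap₃₄ : riemannProj Q a b d c = -riemannProj Q a b c d := by
  simp only [riemannProj, pairSymm]
  ring

lemma riemannProj_diag :
    riemannProj Q a b a b = 1 / 4 * (Q a b a b - Q b a a b - Q a b b a + Q b a b a) := by
  simp only [riemannProj, pairSymm]
  ring

/-- The tensor `X^{ac} Y^{bd} - X^{ad} Y^{bc}`, antisymmetric in its last two indices. -/
def kn (X Y : Matrix (Fin D) (Fin D) ℝ) : Tensor4 D := fun a b c d =>
  X a c * Y b d - X a d * Y b c

lemma act_kn (X Y : Matrix (Fin D) (Fin D) ℝ) :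
    act M (kn X Y) = kn (M * X * Mᵀ) (M * Y * Mᵀ) := by
  have h_conj (Z : Matrix (Fin D) (Fin D) ℝ) (a c : Fin D) :
      (M * Z * Mᵀ) a c = ∑ p, ∑ q, M a p * M c q * Z p q := by
    simp only [Matrix.mul_apply, Matrix.transpose_apply, Finset.sum_mul]
    rw [Finset.sum_comm]
    simp only [mul_right_comm]
  have h_tensor : act M (fun a b c d => X a c * Y b d) =
      fun a b c d => (M * X * Mᵀ) a c * (M * Y * Mᵀ) b d := by
    funext a b c d
    simp only [act, h_conj, Finset.sum_mul_sum]
    exact Finset.sum_congr rfl fun p _ => Finset.sum_congr rfl fun q _ =>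
      Finset.sum_congr rfl fun _ _ => Finset.sum_congr rfl fun _ _ => by ring
  have h_kn (X Y : Matrix (Fin D) (Fin D) ℝ) : kn X Y = (fun a b c d => X a c * Y b d)
      - reindex ![0, 1, 3, 2] fun a b c d => X a c * Y b d := rfl
  rw [h_kn, h_kn, act_sub, act_reindex M _ (by decide), h_tensor]

end FourIndexTensors

/-! ### Covariance of the curvature momentum -/

section Momentum

variable {D : ℕ}

/-- The coordinate tensors, the basis in which the components of `curvatureMomentum` are taken. -/
def basisTensor (a b c d : Fin D) : Tensor4 D :=
  Pi.single a (Pi.single b (Pi.single c (Pi.single d 1)))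

lemma basisTensor_apply (a b c d a' b' c' d' : Fin D) :
    basisTensor a b c d a' b' c' d' =
      (if a' = a then 1 else 0) * (if b' = b then 1 else 0) * (if c' = c then 1 else 0) *
        (if d' = d then 1 else 0) := by
  simp only [basisTensor, Pi.single_apply]
  split_ifs <;> simp_all only [Pi.single_apply, Pi.zero_apply, if_true, if_false, mul_one,
    mul_zero]

lemma eq_sum_basisTensor (Q : Tensor4 D) :
    Q = ∑ a, ∑ b, ∑ c, ∑ d, Q a b c d • basisTensor a b c d := by
  funext a b c d
  simp [Finset.sum_apply, basisTensor_apply]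

lemma clm_apply_eq_sum (φ : Tensor4 D →L[ℝ] ℝ) (Q : Tensor4 D) :
    φ Q = ∑ a, ∑ b, ∑ c, ∑ d, Q a b c d * φ (basisTensor a b c d) := by
  conv_lhs => rw [eq_sum_basisTensor Q]
  simp only [map_sum, map_smul, smul_eq_mul]

lemma act_basisTensor (M : Matrix (Fin D) (Fin D) ℝ) (a b c d a' b' c' d' : Fin D) :
    act M (basisTensor a b c d) a' b' c' d' = M a' a * M b' b * M c' c * M d' d := by
  simp [act, basisTensor_apply]

variable {L : Lagrangian D} (hL : IsInvariant L) (G M : Matrix (Fin D) (Fin D) ℝ)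
  (R Q : Tensor4 D)

include hL

lemma IsInvariant.differentiableAt : DifferentiableAt ℝ (L G) R :=
  (hL.contDiff G).differentiable (by simp) R

lemma IsInvariant.fderiv_act :
    fderiv ℝ (L G) (act M R) (act M Q) = fderiv ℝ (L (Mᵀ * G * M)) R Q := by
  have h_comp : L (Mᵀ * G * M) = L G ∘ actL M := by
    funext R
    rw [Function.comp_apply, actL_apply, hL.apply_act]
  rw [h_comp, fderiv_comp R (hL.differentiableAt G _) (actL M).differentiableAt,
    ContinuousLinearMap.fderiv]
  rfl

lemma IsInvariant.curvatureMomentum_act :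
    curvatureMomentum L (Mᵀ * G * M) R = act Mᵀ (curvatureMomentum L G (act M R)) := by
  rw [curvatureMomentum, curvatureMomentum, ← riemannProj_act]
  congr 1
  funext a b c d
  have h_sum := clm_apply_eq_sum (fderiv ℝ (L G) (act M R)) (act M (basisTensor a b c d))
  rw [hL.fderiv_act] at h_sum
  simp only [act_basisTensor] at h_sum
  exact h_sum

end Momentum

/-! ### Isotropic curvature in an orthonormal frame -/

section IsotropicTensors

variable {D : ℕ}

/-- The Riemann tensor with time-space sectional curvature `A` and spatial sectional curvature `B`,
where `T` and `S` are the projections of the metric on the time and space directions. -/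
def isoRiemann (T S : Matrix (Fin D) (Fin D) ℝ) (A B : ℝ) : Tensor4 D :=
  B • kn S S - A • (kn T S + kn S T)

/-- The tensors with the symmetries of the Riemann tensor that can be built from the metric and the
projection `T` on the time direction. -/
def isoMomentum (g T : Matrix (Fin D) (Fin D) ℝ) (σ θ : ℝ) : Tensor4 D :=
  σ • kn g g + θ • (kn g T + kn T g)

variable (M T S g : Matrix (Fin D) (Fin D) ℝ)

lemma act_isoRiemann (A B : ℝ) :
    act M (isoRiemann T S A B) = isoRiemann (M * T * Mᵀ) (M * S * Mᵀ) A B := by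
  simp only [isoRiemann, act_sub, act_smul, act_add, act_kn]

lemma act_isoMomentum (σ θ : ℝ) :
    act M (isoMomentum g T σ θ) = isoMomentum (M * g * Mᵀ) (M * T * Mᵀ) σ θ := by
  simp only [isoMomentum, act_smul, act_add, act_kn]

lemma kn_one_one_apply (a b c e : Fin D) : kn (1 : Matrix (Fin D) (Fin D) ℝ) 1 a b c e =
    (if a = c then 1 else 0) * (if b = e then 1 else 0)
      - (if a = e then 1 else 0) * (if b = c then 1 else 0) := rfl

lemma kn_one_one_self (a c e : Fin D) : kn (1 : Matrix (Fin D) (Fin D) ℝ) 1 a a c e = 0 := by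
  rw [kn_one_one_apply, mul_comm, sub_self]

lemma kn_diagonal_apply (x y : Fin D → ℝ) (a b c e : Fin D) :
    kn (Matrix.diagonal x) (Matrix.diagonal y) a b c e = x a * y b * kn 1 1 a b c e := by
  simp only [kn, Matrix.diagonal_apply, Matrix.one_apply]
  split_ifs <;> ring

variable {P : Tensor4 D}

lemma eq_diagonal_of_flip_invariant
    (h₁₂ : ∀ a b c e, P b a c e = -P a b c e) (h₃₄ : ∀ a b c e, P a b e c = -P a b c e)
    (h_flip : ∀ (m : Fin D) a b c e, (if a = m then -1 else 1) * (if b = m then -1 else 1) *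
      (if c = m then -1 else 1) * (if e = m then -1 else 1) * P a b c e = P a b c e)
    (a b c e : Fin D) : P a b c e = P a b a b * kn 1 1 a b c e := by
  rw [kn_one_one_apply]
  have h_flip_a := h_flip a a b c e
  have h_flip_b := h_flip b a b c e
  have h_flip_c := h_flip c a b c e
  grind

end IsotropicTensors

section Frame

variable (d : ℕ)

/-- The Minkowski metric, with signature `(-, +, …, +)`. -/
def minkowski : Matrix (Fin (d + 1)) (Fin (d + 1)) ℝ :=
  Matrix.diagonal (Fin.cons (-1) fun _ => 1)

/-- The projection on the time direction. -/
def timeProj : Matrix (Fin (d + 1)) (Fin (d + 1)) ℝ :=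
  Matrix.diagonal (Fin.cons 1 fun _ => 0)

/-- The projection on the spatial directions. -/
def spaceProj : Matrix (Fin (d + 1)) (Fin (d + 1)) ℝ :=
  Matrix.diagonal (Fin.cons 0 fun _ => 1)

/-- The Riemann tensor of an FLRW configuration in an orthonormal frame. -/
def frameRiemann (A B : ℝ) : Tensor4 (d + 1) :=
  isoRiemann (timeProj d) (spaceProj d) A B

lemma minkowski_eq : minkowski d = spaceProj d - timeProj d := by
  rw [minkowski, spaceProj, timeProj, Matrix.diagonal_sub]
  congr 1
  funext i
  cases i using Fin.cases <;> simp only [Fin.cons_zero, Fin.cons_succ, zero_sub, sub_zero]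

lemma minkowski_mul_minkowski : minkowski d * minkowski d = 1 := by
  rw [minkowski, Matrix.diagonal_mul_diagonal, ← Matrix.diagonal_one]
  congr 1
  funext i
  cases i using Fin.cases <;> simp only [Fin.cons_zero, Fin.cons_succ] <;> norm_num

lemma kn_timeProj_timeProj : kn (timeProj d) (timeProj d) = 0 := by
  funext a b c e
  simp only [kn, timeProj, Matrix.diagonal_apply]
  cases a using Fin.cases <;> cases b using Fin.cases <;> simp [mul_comm]

lemma frameRiemann_self (B : ℝ) : frameRiemann d B B = B • kn (minkowski d) (minkowski d) := by
  have h_expand : kn (minkowski d) (minkowski d) = kn (spaceProj d) (spaceProj d)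
      - (kn (timeProj d) (spaceProj d) + kn (spaceProj d) (timeProj d))
      + kn (timeProj d) (timeProj d) := by
    funext a b c e
    simp only [minkowski_eq, kn, Pi.sub_apply, Pi.add_apply, Matrix.sub_apply]
    ring
  rw [h_expand, kn_timeProj_timeProj, add_zero, frameRiemann, isoRiemann, smul_sub]

lemma isoMomentum_minkowski_apply (σ θ : ℝ) (a b c e : Fin (d + 1)) :
    isoMomentum (minkowski d) (timeProj d) σ θ a b c e =
      isoMomentum (minkowski d) (timeProj d) σ θ a b a b * kn 1 1 a b c e := by
  simp only [isoMomentum, minkowski, timeProj, Pi.add_apply, Pi.smul_apply, smul_eq_mul,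
    kn_diagonal_apply, kn_one_one_apply]
  grind

variable {d} (σ θ : ℝ) {i j : Fin d}

lemma isoMomentum_minkowski_timeSpace :
    isoMomentum (minkowski d) (timeProj d) σ θ 0 i.succ 0 i.succ = θ - σ := by
  simp only [isoMomentum, minkowski, timeProj, smul_add, Pi.add_apply, Pi.smul_apply, kn,
    Matrix.diagonal_apply_eq, Fin.cons_zero, Fin.cons_succ, mul_one, ne_eq,
    (Fin.succ_ne_zero _).symm, not_false_eq_true, Matrix.diagonal_apply_ne, Fin.succ_ne_zero,
    mul_zero, sub_zero, smul_eq_mul, mul_neg, sub_self, zero_add]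
  ring

lemma isoMomentum_minkowski_spaceTime :
    isoMomentum (minkowski d) (timeProj d) σ θ i.succ 0 i.succ 0 = θ - σ := by
  simp only [isoMomentum, minkowski, timeProj, smul_add, Pi.add_apply, Pi.smul_apply, kn,
    Matrix.diagonal_apply_eq, Fin.cons_succ, Fin.cons_zero, mul_neg, mul_one, ne_eq,
    Fin.succ_ne_zero, not_false_eq_true, Matrix.diagonal_apply_ne, (Fin.succ_ne_zero _).symm,
    mul_zero, sub_zero, smul_eq_mul, neg_zero, sub_self, add_zero]
  ring

lemma isoMomentum_minkowski_spaceSpace (hij : i ≠ j) :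
    isoMomentum (minkowski d) (timeProj d) σ θ i.succ j.succ i.succ j.succ = σ := by
  simp [isoMomentum, minkowski, timeProj, kn, hij]

end Frame

/-! ### The curvature momentum in an orthonormal frame -/

section FrameMomentum

variable {d : ℕ}

/-- The curvature momentum at the Riemann tensor `frameRiemann d A B`. -/
def frameMomentum (L : Lagrangian (d + 1)) (A B : ℝ) : Tensor4 (d + 1) :=
  curvatureMomentum L (minkowski d) (frameRiemann d A B)

variable {L : Lagrangian (d + 1)}

lemma frameMomentum_swap₁₂ (A B : ℝ) (a b c e : Fin (d + 1)) :
    frameMomentum L A B b a c e = -frameMomentum L A B a b c e :=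
  riemannProj_swap₁₂ ..

lemma frameMomentum_swap₃₄ (A B : ℝ) (a b c e : Fin (d + 1)) :
    frameMomentum L A B a b e c = -frameMomentum L A B a b c e :=
  riemannProj_swap₃₄ ..

lemma transpose_conj_eq_of_conj_eq {n : Type*} [Fintype n] [DecidableEq n] {η M : Matrix n n ℝ}
    (hη : η * η = 1) (h : M * η * Mᵀ = η) : Mᵀ * η * M = η := by
  have h_left_inv : η * Mᵀ * η * M = 1 := by
    rw [mul_eq_one_comm, ← hη]
    nth_rewrite 3 [← h]
    simp only [Matrix.mul_assoc]
  calc Mᵀ * η * M = η * η * (Mᵀ * η * M) := by rw [hη, Matrix.one_mul]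
    _ = η * (η * Mᵀ * η * M) := by simp only [Matrix.mul_assoc]
    _ = η := by rw [h_left_inv, Matrix.mul_one]

variable (hL : IsInvariant L) {A B : ℝ}

include hL

lemma IsInvariant.act_transpose_frameMomentum {M : Matrix (Fin (d + 1)) (Fin (d + 1)) ℝ}
    (hM : M * minkowski d * Mᵀ = minkowski d)
    (hR : act M (frameRiemann d A B) = frameRiemann d A B) :
    act Mᵀ (frameMomentum L A B) = frameMomentum L A B := by
  have h := hL.curvatureMomentum_act (minkowski d) M (frameRiemann d A B)
  rw [transpose_conj_eq_of_conj_eq (minkowski_mul_minkowski d) hM, hR] at h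
  exact h.symm

lemma IsInvariant.frameMomentum_flip (m a b c e : Fin (d + 1)) :
    (if a = m then -1 else 1) * (if b = m then -1 else 1) *
      (if c = m then -1 else 1) * (if e = m then -1 else 1) * frameMomentum L A B a b c e =
    frameMomentum L A B a b c e := by
  let s : Fin (d + 1) → ℝ := fun a => if a = m then -1 else 1
  have h_conj (v : Fin (d + 1) → ℝ) :
      Matrix.diagonal s * Matrix.diagonal v * (Matrix.diagonal s)ᵀ = Matrix.diagonal v := by
    rw [Matrix.diagonal_transpose, Matrix.diagonal_mul_diagonal, Matrix.diagonal_mul_diagonal]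
    congr 1
    funext i
    simp only [s]
    split_ifs <;> ring
  have h_act := hL.act_transpose_frameMomentum (A := A) (B := B) (h_conj _)
    (by rw [frameRiemann, act_isoRiemann, timeProj, spaceProj, h_conj, h_conj])
  rw [Matrix.diagonal_transpose] at h_act
  exact (act_diagonal (frameMomentum L A B) s a b c e).symm.trans (by rw [h_act])

omit hL in
lemma permMatrix_conj {n : Type*} [Fintype n] [DecidableEq n] (π : Equiv.Perm n)
    (N : Matrix n n ℝ) : π.permMatrix ℝ * N * (π.permMatrix ℝ)ᵀ = N.submatrix π π := by
  rw [Matrix.transpose_permMatrix]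
  simp only [Equiv.Perm.permMatrix, PEquiv.toMatrix_toPEquiv_mul, PEquiv.mul_toMatrix_toPEquiv]
  rfl

omit hL in
lemma act_transpose_permMatrix {D : ℕ} (π : Equiv.Perm (Fin D)) (Q : Tensor4 D)
    (a b c e : Fin D) :
    act (π.permMatrix ℝ)ᵀ Q (π a) (π b) (π c) (π e) = Q a b c e := by
  simp [act, Equiv.Perm.permMatrix, PEquiv.toMatrix_apply]

lemma IsInvariant.frameMomentum_perm {π : Equiv.Perm (Fin (d + 1))} (hπ : π 0 = 0)
    (a b c e : Fin (d + 1)) :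
    frameMomentum L A B (π a) (π b) (π c) (π e) = frameMomentum L A B a b c e := by
  have h_conj (x y : ℝ) : π.permMatrix ℝ * Matrix.diagonal (Fin.cons x fun _ => y) *
      (π.permMatrix ℝ)ᵀ = Matrix.diagonal (Fin.cons x fun _ => y) := by
    rw [permMatrix_conj, Matrix.submatrix_diagonal_equiv]
    congr 1
    funext i
    cases i using Fin.cases with
    | zero => rw [Function.comp_apply, hπ]
    | succ i =>
      have h_ne : π i.succ ≠ 0 := fun h => Fin.succ_ne_zero i (π.injective (h.trans hπ.symm))
      obtain ⟨j, hj⟩ := Fin.exists_succ_eq.mpr h_ne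
      rw [Function.comp_apply, ← hj, Fin.cons_succ, Fin.cons_succ]
  have h_act := hL.act_transpose_frameMomentum (A := A) (B := B) (h_conj _ _)
    (by rw [frameRiemann, act_isoRiemann, timeProj, spaceProj, h_conj, h_conj])
  conv_lhs => rw [← h_act]
  exact act_transpose_permMatrix ..

lemma IsInvariant.frameMomentum_timeSpace_eq (i j : Fin d) :
    frameMomentum L A B 0 i.succ 0 i.succ = frameMomentum L A B 0 j.succ 0 j.succ := by
  have h := hL.frameMomentum_perm (A := A) (B := B) (π := Equiv.swap i.succ j.succ)
    (Equiv.swap_apply_of_ne_of_ne (Fin.succ_ne_zero i).symm (Fin.succ_ne_zero j).symm)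
    0 j.succ 0 j.succ
  rwa [Equiv.swap_apply_right, Equiv.swap_apply_of_ne_of_ne (Fin.succ_ne_zero i).symm
    (Fin.succ_ne_zero j).symm] at h

omit hL in
lemma exists_perm_fixing_zero {i j i' j' : Fin d} (hij : i ≠ j) (hij' : i' ≠ j') :
    ∃ π : Equiv.Perm (Fin (d + 1)), π 0 = 0 ∧ π i.succ = i'.succ ∧ π j.succ = j'.succ := by
  refine ⟨Equiv.swap (Equiv.swap i.succ i'.succ j.succ) j'.succ * Equiv.swap i.succ i'.succ, ?_⟩
  simp only [Equiv.Perm.mul_apply, Equiv.swap_apply_left, Equiv.swap_apply_def]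
  grind [Fin.succ_inj, Fin.succ_ne_zero]

lemma IsInvariant.frameMomentum_spaceSpace_eq {i j i' j' : Fin d} (hij : i ≠ j)
    (hij' : i' ≠ j') : frameMomentum L A B i.succ j.succ i.succ j.succ =
      frameMomentum L A B i'.succ j'.succ i'.succ j'.succ := by
  obtain ⟨π, h_zero, hi, hj⟩ := exists_perm_fixing_zero hij hij'
  rw [← hi, ← hj, hL.frameMomentum_perm h_zero]

lemma IsInvariant.exists_frameMomentum_eq_isoMomentum (hd : 2 ≤ d) (A B : ℝ) :
    ∃ σ θ, frameMomentum L A B = isoMomentum (minkowski d) (timeProj d) σ θ := by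
  let i₀ : Fin d := ⟨0, by lia⟩
  let i₁ : Fin d := ⟨1, by lia⟩
  have h₀₁ : i₀ ≠ i₁ := by simp [i₀, i₁]
  let σ := frameMomentum L A B i₀.succ i₁.succ i₀.succ i₁.succ
  let θ := frameMomentum L A B 0 i₀.succ 0 i₀.succ + σ
  have h_timeSpace (i : Fin d) : frameMomentum L A B 0 i.succ 0 i.succ = θ - σ := by
    rw [hL.frameMomentum_timeSpace_eq i i₀, add_sub_cancel_right]
  have h_spaceSpace {i j : Fin d} (hij : i ≠ j) :
      frameMomentum L A B i.succ j.succ i.succ j.succ = σ :=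
    hL.frameMomentum_spaceSpace_eq hij h₀₁
  refine ⟨σ, θ, ?_⟩
  funext a b c e
  rw [eq_diagonal_of_flip_invariant (frameMomentum_swap₁₂ A B) (frameMomentum_swap₃₄ A B)
    hL.frameMomentum_flip, isoMomentum_minkowski_apply]
  rcases eq_or_ne a b with rfl | hab
  · rw [kn_one_one_self, mul_zero, mul_zero]
  congr 1
  cases a using Fin.cases with
  | zero =>
    cases b using Fin.cases with
    | zero => exact absurd rfl hab
    | succ j => rw [h_timeSpace, isoMomentum_minkowski_timeSpace]
  | succ i =>
    cases b using Fin.cases with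
    | zero => rw [frameMomentum_swap₁₂, frameMomentum_swap₃₄, neg_neg, h_timeSpace,
        isoMomentum_minkowski_spaceTime]
    | succ j =>
      have hij : i ≠ j := ne_of_apply_ne Fin.succ hab
      rw [h_spaceSpace hij, isoMomentum_minkowski_spaceSpace σ θ hij]

end FrameMomentum

/-! ### The reduced Lagrangian -/

section Reduced

variable {d : ℕ} (L : Lagrangian (d + 1))

/-- The Lagrangian at the Riemann tensor `frameRiemann d A B`, as a function of `(A, B)`. -/
def reduced : ℝ × ℝ → ℝ := fun x => L (minkowski d) (frameRiemann d x.1 x.2)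

/-- The partial derivative of the reduced Lagrangian in the time-space curvature. -/
def reducedA (x : ℝ × ℝ) : ℝ := fderiv ℝ (reduced L) x (1, 0)

/-- The partial derivative of the reduced Lagrangian in the spatial curvature. -/
def reducedB (x : ℝ × ℝ) : ℝ := fderiv ℝ (reduced L) x (0, 1)

lemma contDiff_frameRiemann : ContDiff ℝ ∞ fun x : ℝ × ℝ => frameRiemann d x.1 x.2 :=
  (contDiff_snd.smul contDiff_const).sub (contDiff_fst.smul contDiff_const)

lemma hasFDerivAt_frameRiemann (x : ℝ × ℝ) :
    HasFDerivAt (fun x : ℝ × ℝ => frameRiemann d x.1 x.2)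
      ((ContinuousLinearMap.snd ℝ ℝ ℝ).smulRight (kn (spaceProj d) (spaceProj d)) -
        (ContinuousLinearMap.fst ℝ ℝ ℝ).smulRight
          (kn (timeProj d) (spaceProj d) + kn (spaceProj d) (timeProj d))) x :=
  (hasFDerivAt_snd.smul_const _).sub (hasFDerivAt_fst.smul_const _)

lemma sum_kn_diagonal_mul {D : ℕ} (x y : Fin D → ℝ) (γ : Tensor4 D) :
    ∑ a, ∑ b, ∑ c, ∑ e, kn (Matrix.diagonal x) (Matrix.diagonal y) a b c e * γ a b c e =
      ∑ a, ∑ b, x a * y b * (γ a b a b - γ a b b a) := by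
  refine Finset.sum_congr rfl fun a _ => Finset.sum_congr rfl fun b _ => ?_
  simp [kn, Matrix.diagonal_apply, sub_mul, Finset.sum_sub_distrib, mul_sub, ite_mul, mul_ite]

lemma fderiv_apply_kn_diagonal {D : ℕ} (L : Lagrangian D) (G : Matrix (Fin D) (Fin D) ℝ)
    (R : Tensor4 D) (x y : Fin D → ℝ) :
    fderiv ℝ (L G) R (kn (Matrix.diagonal x) (Matrix.diagonal y)
        + kn (Matrix.diagonal y) (Matrix.diagonal x)) =
      4 * ∑ a, ∑ b, x a * y b * curvatureMomentum L G R a b a b := by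
  rw [map_add, clm_apply_eq_sum, clm_apply_eq_sum, sum_kn_diagonal_mul, sum_kn_diagonal_mul,
    Finset.sum_comm (f := fun a b => y a * x b * _), ← Finset.sum_add_distrib, Finset.mul_sum]
  refine Finset.sum_congr rfl fun a _ => ?_
  rw [← Finset.sum_add_distrib, Finset.mul_sum]
  refine Finset.sum_congr rfl fun b _ => ?_
  rw [curvatureMomentum, riemannProj_diag]
  simp only [basisTensor]
  ring

variable {L} (hL : IsInvariant L)

include hL

lemma IsInvariant.contDiff_reduced : ContDiff ℝ ∞ (reduced L) :=
  (hL.contDiff _).comp contDiff_frameRiemann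

lemma IsInvariant.fderiv_reduced (x v : ℝ × ℝ) : fderiv ℝ (reduced L) x v =
    fderiv ℝ (L (minkowski d)) (frameRiemann d x.1 x.2) (frameRiemann d v.1 v.2) := by
  have h_comp := (hL.differentiableAt (minkowski d) _).hasFDerivAt.comp x
    (hasFDerivAt_frameRiemann x)
  exact congrArg (· v) h_comp.fderiv

lemma IsInvariant.reducedA_eq_sum (A B : ℝ) :
    reducedA L (A, B) = -4 * ∑ i : Fin d, frameMomentum L A B 0 i.succ 0 i.succ := by
  have h_dir : frameRiemann d 1 0 =
      -(kn (timeProj d) (spaceProj d) + kn (spaceProj d) (timeProj d)) := by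
    rw [frameRiemann, isoRiemann, zero_smul, one_smul, zero_sub]
  rw [reducedA, hL.fderiv_reduced, h_dir, map_neg, timeProj, spaceProj,
    fderiv_apply_kn_diagonal]
  simp [Fin.sum_univ_succ, frameMomentum]

lemma IsInvariant.reducedB_eq_sum (A B : ℝ) : reducedB L (A, B) =
    2 * ∑ i : Fin d, ∑ j : Fin d, frameMomentum L A B i.succ j.succ i.succ j.succ := by
  have h_dir : frameRiemann d 0 1 =
      (1 / 2 : ℝ) • (kn (spaceProj d) (spaceProj d) + kn (spaceProj d) (spaceProj d)) := by
    rw [frameRiemann, isoRiemann, zero_smul, one_smul, sub_zero, ← two_smul ℝ, smul_smul]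
    norm_num
  rw [reducedB, hL.fderiv_reduced, h_dir, map_smul, spaceProj, fderiv_apply_kn_diagonal]
  simp only [one_div, Fin.sum_univ_succ, Fin.cons_zero, mul_zero, zero_mul, Fin.cons_succ, mul_one,
    zero_add, sum_const_zero, one_mul, smul_eq_mul, frameMomentum]
  ring

lemma IsInvariant.frameMomentum_eq (hd : 2 ≤ d) (A B : ℝ) : frameMomentum L A B =
    isoMomentum (minkowski d) (timeProj d) (reducedB L (A, B) / (2 * d * (d - 1)))
      (reducedB L (A, B) / (2 * d * (d - 1)) - reducedA L (A, B) / (4 * d)) := by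
  obtain ⟨σ, θ, h_iso⟩ := hL.exists_frameMomentum_eq_isoMomentum hd A B
  have hd_real : (2 : ℝ) ≤ d := by exact_mod_cast hd
  have hd_sub_one : (d : ℝ) - 1 ≠ 0 := by linarith
  have h_diag (i : Fin d) :
      isoMomentum (minkowski d) (timeProj d) σ θ i.succ i.succ i.succ i.succ = 0 := by
    rw [isoMomentum_minkowski_apply, kn_one_one_self, mul_zero]
  have h_space (i j : Fin d) :
      isoMomentum (minkowski d) (timeProj d) σ θ i.succ j.succ i.succ j.succ =
        σ - if i = j then σ else 0 := by
    split_ifs with hij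
    · rw [hij, h_diag, sub_self]
    · rw [isoMomentum_minkowski_spaceSpace σ θ hij, sub_zero]
  have hσ : σ = reducedB L (A, B) / (2 * d * (d - 1)) := by
    rw [hL.reducedB_eq_sum, h_iso]
    simp only [h_space, Finset.sum_sub_distrib, Finset.sum_const, Finset.card_univ,
      Fintype.card_fin, nsmul_eq_mul, Finset.sum_ite_eq, Finset.mem_univ, if_true]
    field_simp
  have hA : reducedA L (A, B) = -4 * (d * (θ - σ)) := by
    rw [hL.reducedA_eq_sum, h_iso]
    simp only [isoMomentum_minkowski_timeSpace, Finset.sum_const, Finset.card_univ,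
      Fintype.card_fin, nsmul_eq_mul]
  have hθ : θ = σ - reducedA L (A, B) / (4 * d) := by
    rw [hA]
    field_simp
    ring
  rw [h_iso, ← hσ, ← hθ]

omit hL in
lemma exists_lorentz {i j : Fin d} (hij : i ≠ j) :
    ∃ M : Matrix (Fin (d + 1)) (Fin (d + 1)) ℝ,
      M * minkowski d * Mᵀ = minkowski d ∧ M 0 0 ^ 2 ≠ 1 ∧ M 0 j.succ = 0 := by
  -- The reflection in the hyperplane orthogonal to the timelike vector `2 e₀ + eᵢ`.
  let v : Fin (d + 1) → ℝ := Pi.single 0 2 + Pi.single i.succ 1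
  let w : Fin (d + 1) → ℝ := Pi.single 0 (-2) + Pi.single i.succ 1
  have hv : minkowski d *ᵥ v = w := by
    funext a
    rw [minkowski, Matrix.mulVec_diagonal]
    cases a using Fin.cases <;> simp [v, w, Fin.succ_ne_zero, Pi.single_apply]
  have hw : minkowski d *ᵥ w = v := by
    rw [← hv, Matrix.mulVec_mulVec, minkowski_mul_minkowski, Matrix.one_mulVec]
  have hw' : w ᵥ* minkowski d = v := by
    rw [← hw, ← Matrix.vecMul_transpose, minkowski, Matrix.diagonal_transpose]
  have hvw : v ⬝ᵥ w = -3 := by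
    simp only [dotProduct_add, dotProduct_single, Pi.add_apply, Pi.single_eq_same, ne_eq,
      (Fin.succ_ne_zero i).symm, not_false_eq_true, Pi.single_eq_of_ne, add_zero, mul_neg,
      Fin.succ_ne_zero, zero_add, mul_one, v, w]
    norm_num
  refine ⟨1 + (2 / 3 : ℝ) • Matrix.vecMulVec v w, ?_, ?_, ?_⟩
  · rw [Matrix.transpose_add, Matrix.transpose_one, Matrix.transpose_smul,
      Matrix.transpose_vecMulVec, Matrix.add_mul, Matrix.one_mul, Matrix.smul_mul,
      Matrix.vecMulVec_mul, hw', Matrix.add_mul, Matrix.mul_add, Matrix.mul_add, Matrix.mul_one,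
      Matrix.mul_one, Matrix.mul_smul, Matrix.mul_vecMulVec, hw, Matrix.smul_mul, Matrix.mul_smul,
      Matrix.vecMulVec_mul_vecMulVec, hvw, Matrix.vecMulVec_smul]
    module
  · simp only [Matrix.add_apply, Matrix.one_apply_eq, Matrix.smul_apply, Matrix.vecMulVec_apply,
      Pi.add_apply, Pi.single_eq_same, ne_eq, (Fin.succ_ne_zero i).symm, not_false_eq_true,
      Pi.single_eq_of_ne, add_zero, mul_neg, smul_eq_mul, sq_eq_one_iff, add_eq_left, neg_eq_zero,
      mul_eq_zero, div_eq_zero_iff, OfNat.ofNat_ne_zero, or_self, false_or, v, w]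
    norm_num
  · simp [v, w, Matrix.vecMulVec_apply, Fin.succ_ne_zero, (Fin.succ_ne_zero _).symm, hij.symm]

omit hL in
lemma eq_zero_of_isoMomentum_lorentz {M : Matrix (Fin (d + 1)) (Fin (d + 1)) ℝ} {σ θ : ℝ}
    {j : Fin d} (h_time : M 0 0 ^ 2 ≠ 1) (h_space : M 0 j.succ = 0)
    (h : isoMomentum (minkowski d) (Mᵀ * timeProj d * M) σ θ =
      isoMomentum (minkowski d) (timeProj d) σ θ) : θ = 0 := by
  have h_timeProj (a b : Fin (d + 1)) : (Mᵀ * timeProj d * M) a b = M 0 a * M 0 b := by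
    rw [timeProj, Matrix.mul_assoc, Matrix.mul_apply]
    simp [Fin.sum_univ_succ]
  have h_component : isoMomentum (minkowski d) (Mᵀ * timeProj d * M) σ θ 0 j.succ 0 j.succ =
      θ - σ := by
    rw [h, isoMomentum_minkowski_timeSpace]
  have h_boosted : θ * (M 0 0 ^ 2 - 1) = 0 := by
    simp only [isoMomentum, minkowski, smul_add, Pi.add_apply, Pi.smul_apply, kn,
      Matrix.diagonal_apply_eq, Fin.cons_zero, Fin.cons_succ, mul_one, ne_eq, Fin.succ_ne_zero,
      not_false_eq_true, Matrix.diagonal_apply_ne, mul_zero, sub_zero, smul_eq_mul, mul_neg,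
      h_timeProj, h_space, zero_mul, sub_self, zero_add] at h_component
    linear_combination h_component
  exact (mul_eq_zero.mp h_boosted).resolve_right (sub_ne_zero.mpr h_time)

-- At `A = B` the curvature is maximally symmetric, so Lorentz invariance forces the momentum to
-- be independent of the choice of the time direction.
lemma IsInvariant.reduced_constraint (hd : 2 ≤ d) (B : ℝ) :
    (d - 1) * reducedA L (B, B) = 2 * reducedB L (B, B) := by
  have hij : (⟨0, by lia⟩ : Fin d) ≠ ⟨1, by lia⟩ := by simp
  obtain ⟨M, hM, h_time, h_space⟩ := exists_lorentz hij
  have h_act := hL.act_transpose_frameMomentum (A := B) (B := B) hM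
    (by rw [frameRiemann_self, act_smul, act_kn, hM])
  rw [hL.frameMomentum_eq hd, act_isoMomentum, Matrix.transpose_transpose,
    transpose_conj_eq_of_conj_eq (minkowski_mul_minkowski d) hM] at h_act
  have h_zero := eq_zero_of_isoMomentum_lorentz h_time h_space h_act
  have hd_real : (2 : ℝ) ≤ d := by exact_mod_cast hd
  have hd_sub_one : (d : ℝ) - 1 ≠ 0 := by linarith
  field_simp at h_zero
  linear_combination -h_zero / 2

end Reduced

/-! ### Gradients -/

/-- `f` is differentiable at `y` with the given partial derivatives. -/
def HasGrad {D : ℕ} (f : (Fin D → ℝ) → ℝ) (f' : Fin D → ℝ) (y : Fin D → ℝ) : Prop :=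
  DifferentiableAt ℝ f y ∧ ∀ a, pderiv a f y = f' a

section Grad

variable {D : ℕ} {f h : (Fin D → ℝ) → ℝ} {f' h' : Fin D → ℝ} {y : Fin D → ℝ}

lemma HasGrad.pderiv_eq (hf : HasGrad f f' y) (a : Fin D) : pderiv a f y = f' a := hf.2 a

lemma HasGrad.congr_grad (hf : HasGrad f f' y) (e : ∀ a, f' a = h' a) : HasGrad f h' y :=
  ⟨hf.1, fun a => (hf.2 a).trans (e a)⟩

lemma HasGrad.congr_of_eventuallyEq (hf : HasGrad f f' y) (e : h =ᶠ[nhds y] f) :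
    HasGrad h f' y :=
  ⟨hf.1.congr_of_eventuallyEq e, fun a => by rw [pderiv, e.fderiv_eq]; exact hf.2 a⟩

lemma hasGrad_const (c : ℝ) (y : Fin D → ℝ) : HasGrad (fun _ => c) (fun _ => 0) y :=
  ⟨differentiableAt_const c, fun a => by simp [pderiv]⟩

lemma hasGrad_coord (b : Fin D) (y : Fin D → ℝ) :
    HasGrad (fun z => z b) (fun a => if a = b then 1 else 0) y := by
  refine ⟨differentiableAt_apply b y, fun a => ?_⟩
  have fderiv_coord : fderiv ℝ (fun z : Fin D → ℝ => z b) y = ContinuousLinearMap.proj b :=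
    (ContinuousLinearMap.proj (R := ℝ) (φ := fun _ : Fin D => ℝ) b).fderiv
  rw [pderiv, fderiv_coord]
  simp [Pi.single_apply, eq_comm]

lemma HasGrad.add (hf : HasGrad f f' y) (hh : HasGrad h h' y) :
    HasGrad (fun z => f z + h z) (fun a => f' a + h' a) y :=
  ⟨hf.1.add hh.1, fun a => by
    beta_reduce
    rw [pderiv, fderiv_fun_add hf.1 hh.1, ← hf.2, ← hh.2]
    rfl⟩

lemma HasGrad.sub (hf : HasGrad f f' y) (hh : HasGrad h h' y) :
    HasGrad (fun z => f z - h z) (fun a => f' a - h' a) y :=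
  ⟨hf.1.sub hh.1, fun a => by
    beta_reduce
    rw [pderiv, fderiv_fun_sub hf.1 hh.1, ← hf.2, ← hh.2]
    rfl⟩

lemma HasGrad.neg (hf : HasGrad f f' y) : HasGrad (fun z => -f z) (fun a => -f' a) y :=
  ⟨hf.1.neg, fun a => by
    beta_reduce
    rw [pderiv, fderiv_fun_neg, ← hf.2]
    rfl⟩

lemma HasGrad.mul (hf : HasGrad f f' y) (hh : HasGrad h h' y) :
    HasGrad (fun z => f z * h z) (fun a => f' a * h y + f y * h' a) y :=
  ⟨hf.1.mul hh.1, fun a => by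
    beta_reduce
    rw [pderiv, fderiv_fun_mul hf.1 hh.1, ← hf.2, ← hh.2]
    simp only [pderiv, add_apply, smul_apply, smul_eq_mul]
    ring⟩

lemma HasGrad.const_mul (c : ℝ) (hf : HasGrad f f' y) :
    HasGrad (fun z => c * f z) (fun a => c * f' a) y :=
  ((hasGrad_const c y).mul hf).congr_grad fun a => by ring

lemma HasGrad.comp {φ : ℝ → ℝ} {φ' : ℝ} (hφ : HasDerivAt φ φ' (f y)) (hf : HasGrad f f' y) :
    HasGrad (fun z => φ (f z)) (fun a => φ' * f' a) y := by
  have hcomp : HasFDerivAt (fun z => φ (f z)) (φ' • fderiv ℝ f y) y :=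
    hφ.comp_hasFDerivAt y hf.1.hasFDerivAt
  refine ⟨hcomp.differentiableAt, fun a => ?_⟩
  simp only [pderiv, hcomp.fderiv, ← hf.2 a]
  rfl

lemma HasGrad.div (hf : HasGrad f f' y) (hh : HasGrad h h' y) (h0 : h y ≠ 0) :
    HasGrad (fun z => f z / h z) (fun a => f' a / h y - f y * h' a / h y ^ 2) y := by
  simp only [div_eq_mul_inv]
  exact (hf.mul (HasGrad.comp (hasDerivAt_inv h0) hh)).congr_grad fun a => by ring

lemma HasGrad.fun_sum {ι : Type*} {s : Finset ι} {f : ι → (Fin D → ℝ) → ℝ}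
    {f' : ι → Fin D → ℝ} (hf : ∀ i ∈ s, HasGrad (f i) (f' i) y) :
    HasGrad (fun z => ∑ i ∈ s, f i z) (fun a => ∑ i ∈ s, f' i a) y := by
  classical
  induction s using Finset.induction_on with
  | empty => simpa using hasGrad_const 0 y
  | insert i s his ih =>
    simp only [Finset.sum_insert his]
    exact (hf i (Finset.mem_insert_self i s)).add
      (ih fun j hj => hf j (Finset.mem_insert_of_mem hj))

end Grad

lemma hasGrad_time {d : ℕ} {φ : ℝ → ℝ} {φ' : ℝ} {y : Fin (d + 1) → ℝ}
    (h : HasDerivAt φ φ' (y 0)) :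
    HasGrad (fun z => φ (z 0)) (Fin.cons φ' fun _ => 0) y :=
  (HasGrad.comp h (hasGrad_coord 0 y)).congr_grad fun a => by
    cases a using Fin.cases <;> simp [Fin.succ_ne_zero]

/-! ### Block-diagonal matrices -/

/-- The matrix with time-time component `p` and space-space components `X`. -/
def timeSpaceBlock {d : ℕ} (p : ℝ) (X : Matrix (Fin d) (Fin d) ℝ) :
    Matrix (Fin (d + 1)) (Fin (d + 1)) ℝ :=
  Matrix.of fun μ ν => Fin.cases (Fin.cases p (fun _ => 0) ν)
    (fun i => Fin.cases 0 (fun j => X i j) ν) μ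

section Block

variable {d : ℕ} (p q : ℝ) (X Y : Matrix (Fin d) (Fin d) ℝ) (i j : Fin d)

@[simp] lemma timeSpaceBlock_zero_zero : timeSpaceBlock p X 0 0 = p := rfl
@[simp] lemma timeSpaceBlock_zero_succ : timeSpaceBlock p X 0 i.succ = 0 := rfl
@[simp] lemma timeSpaceBlock_succ_zero : timeSpaceBlock p X i.succ 0 = 0 := rfl
@[simp] lemma timeSpaceBlock_succ_succ : timeSpaceBlock p X i.succ j.succ = X i j := rfl

lemma timeSpaceBlock_mul :
    timeSpaceBlock p X * timeSpaceBlock q Y = timeSpaceBlock (p * q) (X * Y) := by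
  ext a b
  rw [Matrix.mul_apply, Fin.sum_univ_succ]
  cases a using Fin.cases <;> cases b using Fin.cases <;> simp [Matrix.mul_apply]

lemma timeSpaceBlock_transpose :
    (timeSpaceBlock p X)ᵀ = timeSpaceBlock p Xᵀ := by
  ext a b
  cases a using Fin.cases <;> cases b using Fin.cases <;> simp

lemma timeSpaceBlock_one_one : timeSpaceBlock 1 (1 : Matrix (Fin d) (Fin d) ℝ) = 1 := by
  ext a b
  cases a using Fin.cases <;> cases b using Fin.cases <;>
    simp [Matrix.one_apply, Fin.succ_ne_zero, (Fin.succ_ne_zero _).symm]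

lemma diagonal_cons_eq (x y : ℝ) :
    Matrix.diagonal (Fin.cons x fun _ => y : Fin (d + 1) → ℝ) = timeSpaceBlock x (y • 1) := by
  ext a b
  cases a using Fin.cases <;> cases b using Fin.cases <;>
    simp [Matrix.diagonal_apply, Matrix.one_apply, Fin.succ_ne_zero, (Fin.succ_ne_zero _).symm]

end Block

/-! ### The FLRW metric -/

section Slice

variable {d : ℕ} (k : ℝ) (y : Fin (d + 1) → ℝ)

/-- The function `1 - k r²`, positive on the coordinate patch of the spatial slices. -/
def slice : ℝ := 1 - k * ∑ i : Fin d, y i.succ ^ 2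

/-- The dyad `x_i x_j` of the spatial coordinates. -/
def dyad : Matrix (Fin d) (Fin d) ℝ :=
  Matrix.of fun i j => y i.succ * y j.succ

/-- The spatial metric `δ_ij + k x_i x_j / (1 - k r²)` at unit scale factor. -/
def sliceMetric : Matrix (Fin d) (Fin d) ℝ :=
  1 + (k / slice k y) • dyad y

/-- The inverse `δ_ij - k x_i x_j` of `sliceMetric`. -/
def sliceInv : Matrix (Fin d) (Fin d) ℝ :=
  1 + (-k) • dyad y

lemma mul_sum_sq_eq : k * ∑ i : Fin d, y i.succ ^ 2 = 1 - slice k y := by simp [slice]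

lemma dyad_mul_dyad : dyad y * dyad y = (∑ i : Fin d, y i.succ ^ 2) • dyad y := by
  ext i j
  simp only [dyad, Matrix.mul_apply, Matrix.of_apply, Matrix.smul_apply, smul_eq_mul,
    Finset.sum_mul]
  exact Finset.sum_congr rfl fun _ _ => by ring

lemma one_add_smul_dyad_mul (s t : ℝ) :
    (1 + s • dyad y) * (1 + t • dyad y) =
      1 + (s + t + s * t * ∑ i : Fin d, y i.succ ^ 2) • dyad y := by
  rw [add_mul, mul_add, mul_add, smul_mul_smul_comm, dyad_mul_dyad, smul_smul]
  simp only [one_mul, mul_one]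
  module

lemma one_add_smul_dyad_transpose (s : ℝ) : (1 + s • dyad y)ᵀ = 1 + s • dyad y := by
  ext i j
  simp [dyad, Matrix.one_apply, mul_comm, eq_comm]

lemma sliceMetric_apply (i j : Fin d) :
    sliceMetric k y i j = (if i = j then 1 else 0) + k * y i.succ * y j.succ / slice k y := by
  simp only [sliceMetric, dyad, Matrix.add_apply, Matrix.one_apply, Matrix.smul_apply,
    Matrix.of_apply, smul_eq_mul]
  ring

lemma sliceInv_apply (i j : Fin d) :
    sliceInv k y i j = (if i = j then 1 else 0) - k * y i.succ * y j.succ := by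
  simp only [sliceInv, dyad, Matrix.add_apply, Matrix.one_apply, Matrix.smul_apply,
    Matrix.of_apply, smul_eq_mul]
  ring

lemma sliceMetric_symm (i j : Fin d) : sliceMetric k y i j = sliceMetric k y j i := by
  simp only [sliceMetric_apply, eq_comm (a := i)]
  ring

lemma sliceInv_symm (i j : Fin d) : sliceInv k y i j = sliceInv k y j i := by
  simp only [sliceInv_apply, eq_comm (a := i)]
  ring

lemma sum_sliceInv_mul_coord (i : Fin d) :
    ∑ l : Fin d, sliceInv k y i l * y l.succ = slice k y * y i.succ := by
  have term_eq (l : Fin d) : sliceInv k y i l * y l.succ =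
      (if i = l then y l.succ else 0) - y i.succ * k * y l.succ ^ 2 := by
    rw [sliceInv_apply]
    split_ifs <;> ring
  simp only [term_eq, Finset.sum_sub_distrib, ← Finset.mul_sum, Finset.sum_ite_eq,
    Finset.mem_univ, if_true]
  linear_combination -y i.succ * mul_sum_sq_eq k y

variable {k y}

lemma sum_coord_mul_sliceMetric (h : 0 < slice k y) (i : Fin d) :
    ∑ l : Fin d, y l.succ * sliceMetric k y i l = y i.succ / slice k y := by
  have term_eq (l : Fin d) : y l.succ * sliceMetric k y i l =
      (if i = l then y l.succ else 0) + y i.succ / slice k y * k * y l.succ ^ 2 := by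
    rw [sliceMetric_apply]
    split_ifs <;> ring
  simp only [term_eq, Finset.sum_add_distrib, ← Finset.mul_sum, Finset.sum_ite_eq,
    Finset.mem_univ, if_true]
  rw [mul_assoc, mul_sum_sq_eq]
  field_simp
  ring

lemma sliceMetric_mul_sliceInv (h : 0 < slice k y) : sliceMetric k y * sliceInv k y = 1 := by
  have coeff_eq_zero :
      k / slice k y + -k + k / slice k y * -k * ∑ i : Fin d, y i.succ ^ 2 = 0 := by
    rw [mul_assoc, neg_mul, mul_sum_sq_eq]
    field_simp
    ring
  rw [sliceMetric, sliceInv, one_add_smul_dyad_mul, coeff_eq_zero, zero_smul, add_zero]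

-- With `w = √(1 - k r²)`, the square root is `1 + k / (w (1 + w)) x xᵀ`, since `k r² = 1 - w²`.
lemma exists_sliceMetric_sqrt (h : 0 < slice k y) :
    ∃ S S' : Matrix (Fin d) (Fin d) ℝ, Sᵀ = S ∧ S'ᵀ = S' ∧ S' * S = 1 ∧
      S * S = sliceMetric k y ∧ S' * S' = sliceInv k y := by
  set w := √(slice k y)
  have hw_pos : 0 < w := Real.sqrt_pos.mpr h
  have hw_sq : w ^ 2 = slice k y := Real.sq_sqrt h.le
  have hkr : k * (k * ∑ i : Fin d, y i.succ ^ 2) = k * (1 - w ^ 2) := by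
    rw [mul_sum_sq_eq, hw_sq]
  refine ⟨1 + (k / (w * (1 + w))) • dyad y, 1 + (-(k / (1 + w))) • dyad y,
    one_add_smul_dyad_transpose y _, one_add_smul_dyad_transpose y _, ?_, ?_, ?_⟩
  · have coeff_eq_zero : -(k / (1 + w)) + k / (w * (1 + w)) +
        -(k / (1 + w)) * (k / (w * (1 + w))) * ∑ i : Fin d, y i.succ ^ 2 = 0 := by
      field_simp
      linear_combination -hkr
    rw [one_add_smul_dyad_mul, coeff_eq_zero, zero_smul, add_zero]
  · rw [one_add_smul_dyad_mul, sliceMetric, ← hw_sq]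
    congr 2
    field_simp
    linear_combination hkr
  · rw [one_add_smul_dyad_mul, sliceInv]
    congr 2
    field_simp
    linear_combination hkr

end Slice

section Metric

variable {d : ℕ} {k : ℝ} {a F : ℝ → ℝ} {y : Fin (d + 1) → ℝ}

lemma flrwMetric_eq (k : ℝ) (a F : ℝ → ℝ) (y : Fin (d + 1) → ℝ) :
    flrwMetric d k a F y = timeSpaceBlock (-F (y 0)) (a (y 0) ^ 2 • sliceMetric k y) := by
  ext μ ν
  cases μ using Fin.cases <;> cases ν using Fin.cases <;>
    simp [flrwMetric, sliceMetric_apply, slice]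

variable (ha : 0 < a (y 0)) (hF : 0 < F (y 0)) (h : 0 < slice k y)
include ha hF h

lemma flrwMetric_inv :
    (flrwMetric d k a F y)⁻¹ =
      timeSpaceBlock (-(F (y 0))⁻¹) ((a (y 0) ^ 2)⁻¹ • sliceInv k y) := by
  refine Matrix.inv_eq_right_inv ?_
  rw [flrwMetric_eq, timeSpaceBlock_mul, smul_mul_smul_comm, sliceMetric_mul_sliceInv h,
    mul_inv_cancel₀ (by positivity), neg_mul_neg, mul_inv_cancel₀ hF.ne', one_smul,
    timeSpaceBlock_one_one]

-- `M` and `N` convert frame components into lower and upper coordinate components.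
lemma exists_frame :
    ∃ M N : Matrix (Fin (d + 1)) (Fin (d + 1)) ℝ, N * Mᵀ = 1 ∧
      M * timeProj d * Mᵀ = timeSpaceBlock (F (y 0)) 0 ∧
      M * spaceProj d * Mᵀ = timeSpaceBlock 0 (a (y 0) ^ 2 • sliceMetric k y) ∧
      N * timeProj d * Nᵀ = timeSpaceBlock (F (y 0))⁻¹ 0 ∧
      N * minkowski d * Nᵀ = (flrwMetric d k a F y)⁻¹ := by
  obtain ⟨S, S', hS, hS', hS'S, hSS, hS'S'⟩ := exists_sliceMetric_sqrt h
  set f := √(F (y 0))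
  have hf_ne : f ≠ 0 := (Real.sqrt_pos.mpr hF).ne'
  have hf_sq : f * f = F (y 0) := Real.mul_self_sqrt hF.le
  refine ⟨timeSpaceBlock f (a (y 0) • S), timeSpaceBlock f⁻¹ ((a (y 0))⁻¹ • S'), ?_, ?_, ?_, ?_, ?_⟩
  · rw [timeSpaceBlock_transpose, timeSpaceBlock_mul, Matrix.transpose_smul, hS,
      smul_mul_smul_comm, hS'S, inv_mul_cancel₀ hf_ne, inv_mul_cancel₀ ha.ne', one_smul,
      timeSpaceBlock_one_one]
  · rw [timeProj, diagonal_cons_eq, timeSpaceBlock_transpose, timeSpaceBlock_mul,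
      timeSpaceBlock_mul, mul_one, hf_sq, zero_smul, Matrix.mul_zero, Matrix.zero_mul]
  · rw [spaceProj, diagonal_cons_eq, timeSpaceBlock_transpose, timeSpaceBlock_mul,
      timeSpaceBlock_mul, mul_zero, zero_mul, one_smul, Matrix.mul_one, Matrix.transpose_smul, hS,
      smul_mul_smul_comm, hSS, sq]
  · rw [timeProj, diagonal_cons_eq, timeSpaceBlock_transpose, timeSpaceBlock_mul,
      timeSpaceBlock_mul, mul_one, ← mul_inv, hf_sq, zero_smul, Matrix.mul_zero, Matrix.zero_mul]
  · rw [flrwMetric_inv ha hF h, minkowski, diagonal_cons_eq, timeSpaceBlock_transpose,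
      timeSpaceBlock_mul, timeSpaceBlock_mul, one_smul, Matrix.mul_one, Matrix.transpose_smul, hS',
      smul_mul_smul_comm, hS'S', ← hf_sq, sq, mul_inv, mul_inv, mul_neg_one, neg_mul]

end Metric

/-! ### Christoffel symbols -/

section SliceGrad

variable {d : ℕ} (k : ℝ) (y : Fin (d + 1) → ℝ)

lemma hasGrad_slice : HasGrad (slice k) (Fin.cons 0 fun l : Fin d => -2 * k * y l.succ) y := by
  have hasGrad_sq (i : Fin d) (_ : i ∈ Finset.univ) :
      HasGrad (fun z : Fin (d + 1) → ℝ => z i.succ ^ 2)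
        (fun a => 2 * y i.succ * if a = i.succ then 1 else 0) y := by
    simp only [sq]
    exact ((hasGrad_coord i.succ y).mul (hasGrad_coord i.succ y)).congr_grad fun a => by ring
  refine ((hasGrad_const 1 y).sub
    ((HasGrad.fun_sum hasGrad_sq).const_mul k)).congr_grad fun a => ?_
  cases a using Fin.cases
  · simp [(Fin.succ_ne_zero _).symm]
  · simp only [Fin.succ_inj, mul_ite, mul_one, mul_zero, Finset.sum_ite_eq, Finset.mem_univ,
      if_true, Fin.cons_succ]
    ring

/-- The partial derivatives of the metric of the unit spatial slice. -/
def sliceMetricGrad (i j l : Fin d) : ℝ :=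
  k * ((if l = i then 1 else 0) * y j.succ + y i.succ * (if l = j then 1 else 0)) / slice k y
    + 2 * k ^ 2 * y i.succ * y j.succ * y l.succ / slice k y ^ 2

lemma hasGrad_sliceInv (i j : Fin d) :
    HasGrad (fun z => sliceInv k z i j) (Fin.cons 0 fun l : Fin d =>
      -k * ((if l = i then 1 else 0) * y j.succ + y i.succ * (if l = j then 1 else 0))) y := by
  simp only [sliceInv_apply]
  refine ((hasGrad_const _ y).sub (((hasGrad_coord i.succ y).const_mul k).mul
    (hasGrad_coord j.succ y))).congr_grad fun a => ?_
  cases a using Fin.cases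
  · simp [(Fin.succ_ne_zero _).symm]
  · simp only [Fin.succ_inj, Fin.cons_succ]
    ring

variable {k y} (h : 0 < slice k y)
include h

lemma hasGrad_sliceMetric (i j : Fin d) :
    HasGrad (fun z => sliceMetric k z i j) (Fin.cons 0 (sliceMetricGrad k y i j)) y := by
  simp only [sliceMetric_apply]
  refine ((hasGrad_const _ y).add ((((hasGrad_coord i.succ y).const_mul k).mul
    (hasGrad_coord j.succ y)).div (hasGrad_slice k y) h.ne')).congr_grad fun a => ?_
  cases a using Fin.cases
  · simp [(Fin.succ_ne_zero _).symm]
  · simp only [Fin.succ_inj, Fin.cons_succ, sliceMetricGrad]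
    ring

lemma sum_sliceInv_mul_grad (l i j : Fin d) :
    ∑ m, sliceInv k y l m * (sliceMetricGrad k y j m i + sliceMetricGrad k y i m j
      - sliceMetricGrad k y i j m) = 2 * (k * y l.succ * sliceMetric k y i j) := by
  have term_eq (m : Fin d) : sliceInv k y l m * (sliceMetricGrad k y j m i
      + sliceMetricGrad k y i m j - sliceMetricGrad k y i j m) =
      2 * k / slice k y * sliceMetric k y i j * (sliceInv k y l m * y m.succ) := by
    simp only [sliceMetricGrad, sliceMetric_apply, eq_comm (a := j) (b := i),
      eq_comm (a := m) (b := i), eq_comm (a := m) (b := j)]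
    ring
  rw [Finset.sum_congr rfl fun m _ => term_eq m, ← Finset.mul_sum, sum_sliceInv_mul_coord]
  field_simp

end SliceGrad

section MetricGrad

variable {d : ℕ} (k : ℝ) (a F : ℝ → ℝ) (y : Fin (d + 1) → ℝ)

/-- The partial derivatives of the components of the FLRW metric. -/
def flrwMetricGrad (μ ν : Fin (d + 1)) : Fin (d + 1) → ℝ :=
  Fin.cases (Fin.cases (Fin.cons (-deriv F (y 0)) fun _ => 0) (fun _ _ => 0) ν)
    (fun i => Fin.cases (fun _ => 0) (fun j => Fin.cons
      (2 * a (y 0) * deriv a (y 0) * sliceMetric k y i j)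
      fun l => a (y 0) ^ 2 * sliceMetricGrad k y i j l) ν) μ

variable {k a F y}

lemma hasGrad_flrwMetric (h : 0 < slice k y) (ha : DifferentiableAt ℝ a (y 0))
    (hF : DifferentiableAt ℝ F (y 0)) (μ ν : Fin (d + 1)) :
    HasGrad (fun z => flrwMetric d k a F z μ ν) (flrwMetricGrad k a F y μ ν) y := by
  simp only [flrwMetric_eq]
  cases μ using Fin.cases <;> cases ν using Fin.cases
  case zero.zero =>
    exact (hasGrad_time hF.hasDerivAt).neg.congr_grad fun b => by
      cases b using Fin.cases <;> simp [flrwMetricGrad]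
  case zero.succ => exact hasGrad_const 0 y
  case succ.zero => exact hasGrad_const 0 y
  case succ.succ i j =>
    refine ((hasGrad_time (ha.hasDerivAt.pow 2)).mul (hasGrad_sliceMetric h i j)).congr_grad
      fun b => ?_
    cases b using Fin.cases <;> simp [flrwMetricGrad]

end MetricGrad

/-- The smooth positive functions of time: the admissible scale factors and lapse functions. -/
structure SmoothPos (f : ℝ → ℝ) : Prop where
  contDiff : ContDiff ℝ ∞ f
  pos : ∀ t, 0 < f t

namespace SmoothPos

variable {f : ℝ → ℝ} (hf : SmoothPos f) (t : ℝ)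
include hf

lemma differentiableAt : DifferentiableAt ℝ f t := hf.contDiff.differentiable (by simp) t

lemma hasDerivAt : HasDerivAt f (deriv f t) t := (hf.differentiableAt t).hasDerivAt

lemma contDiff_deriv : ContDiff ℝ ∞ (deriv f) := (contDiff_infty_iff_deriv.mp hf.contDiff).2

lemma hasDerivAt_deriv : HasDerivAt (deriv f) (deriv (deriv f) t) t :=
  (hf.contDiff_deriv.differentiable (by simp) t).hasDerivAt

lemma hasDerivAt_logDeriv : HasDerivAt (fun s => deriv f s / f s)
    (deriv (deriv f) t / f t - deriv f t ^ 2 / f t ^ 2) t := by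
  have f_ne : f t ≠ 0 := (hf.pos t).ne'
  refine ((hf.hasDerivAt_deriv t).fun_div (hf.hasDerivAt t) f_ne).congr_deriv ?_
  field_simp

end SmoothPos

section Christoffel

variable {d : ℕ} (k : ℝ) (a F : ℝ → ℝ) (y : Fin (d + 1) → ℝ)

/-- The Christoffel symbols of the FLRW metric. -/
def flrwChristoffel (c μ ν : Fin (d + 1)) : ℝ :=
  Fin.cases
    (Fin.cases (Fin.cases (deriv F (y 0) / (2 * F (y 0))) (fun _ => 0) ν)
      (fun i => Fin.cases 0
        (fun j => a (y 0) * deriv a (y 0) / F (y 0) * sliceMetric k y i j) ν) μ)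
    (fun l => Fin.cases
      (Fin.cases 0 (fun j => if l = j then deriv a (y 0) / a (y 0) else 0) ν)
      (fun i => Fin.cases (if l = i then deriv a (y 0) / a (y 0) else 0)
        (fun j => k * y l.succ * sliceMetric k y i j) ν) μ) c

/-- The partial derivatives of the Christoffel symbols of the FLRW metric. -/
def flrwChristoffelGrad (c μ ν : Fin (d + 1)) : Fin (d + 1) → ℝ :=
  Fin.cases
    (Fin.cases (Fin.cases
        (Fin.cons ((deriv (deriv F) (y 0) * F (y 0) - deriv F (y 0) ^ 2) / (2 * F (y 0) ^ 2))
          fun _ => 0) (fun _ _ => 0) ν)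
      (fun i => Fin.cases (fun _ => 0)
        (fun j => Fin.cons (((deriv a (y 0) ^ 2 + a (y 0) * deriv (deriv a) (y 0)) / F (y 0)
            - a (y 0) * deriv a (y 0) * deriv F (y 0) / F (y 0) ^ 2) * sliceMetric k y i j)
          fun m => a (y 0) * deriv a (y 0) / F (y 0) * sliceMetricGrad k y i j m) ν) μ)
    (fun l => Fin.cases
      (Fin.cases (fun _ => 0) (fun j => Fin.cons (if l = j then
        deriv (deriv a) (y 0) / a (y 0) - deriv a (y 0) ^ 2 / a (y 0) ^ 2 else 0) fun _ => 0) ν)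
      (fun i => Fin.cases (Fin.cons (if l = i then
        deriv (deriv a) (y 0) / a (y 0) - deriv a (y 0) ^ 2 / a (y 0) ^ 2 else 0) fun _ => 0)
        (fun j => Fin.cons 0 fun m => k * ((if m = l then 1 else 0) * sliceMetric k y i j
          + y l.succ * sliceMetricGrad k y i j m)) ν) μ) c

variable {k a F y}

lemma eventually_slice_pos (h : 0 < slice k y) : ∀ᶠ z in nhds y, 0 < slice k z := by
  have continuous_slice : Continuous fun z : Fin (d + 1) → ℝ => slice k z := by
    unfold slice
    fun_prop
  exact continuous_slice.continuousAt.eventually_const_lt h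

lemma sum_sliceInv_mul_smul_sliceMetric (h : 0 < slice k y) (p q : ℝ) (i j : Fin d) :
    ∑ m, p * sliceInv k y i m * (q * sliceMetric k y j m) = if i = j then p * q else 0 := by
  have sliceInv_mul_sliceMetric : sliceInv k y * sliceMetric k y = 1 :=
    mul_eq_one_comm.mp (sliceMetric_mul_sliceInv h)
  calc ∑ m, p * sliceInv k y i m * (q * sliceMetric k y j m)
      = p * q * (sliceInv k y * sliceMetric k y) i j := by
        rw [Matrix.mul_apply, Finset.mul_sum]
        exact Finset.sum_congr rfl fun m _ => by rw [sliceMetric_symm k y j m]; ring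
    _ = if i = j then p * q else 0 := by
        rw [sliceInv_mul_sliceMetric, Matrix.one_apply, mul_ite, mul_one, mul_zero]

variable (h : 0 < slice k y) (ha : SmoothPos a) (hF : SmoothPos F)
include h ha hF

lemma christoffel_flrwMetric (c μ ν : Fin (d + 1)) :
    christoffel (flrwMetric d k a F) y c μ ν = flrwChristoffel k a F y c μ ν := by
  have ha_pos := ha.pos (y 0)
  have hF_pos := hF.pos (y 0)
  simp only [christoffel, flrwMetric_inv ha_pos hF_pos h, Fin.sum_univ_succ, fun μ ν b =>
    (hasGrad_flrwMetric h (ha.differentiableAt _) (hF.differentiableAt _) μ ν).pderiv_eq b]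
  cases c using Fin.cases <;> cases μ using Fin.cases <;> cases ν using Fin.cases <;>
    simp only [flrwMetricGrad, flrwChristoffel, sum_sliceInv_mul_smul_sliceMetric h, Fin.cases_zero,
      Fin.cases_succ, Fin.cons_zero, Fin.cons_succ, timeSpaceBlock_zero_zero,
      timeSpaceBlock_zero_succ, timeSpaceBlock_succ_zero, timeSpaceBlock_succ_succ,
      Matrix.smul_apply, smul_eq_mul, Finset.sum_const_zero, zero_mul, mul_zero, add_zero, zero_add,
      sub_zero, zero_sub, sub_self]
  case zero.zero.zero =>
    field_simp
    ring
  case zero.succ.succ => field_simp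
  case succ.zero.succ =>
    split_ifs
    · field_simp
    · exact mul_zero _
  case succ.succ.zero =>
    split_ifs
    · field_simp
    · exact mul_zero _
  case succ.succ.succ l i j =>
    have term_eq (m : Fin d) : (a (y 0) ^ 2)⁻¹ * sliceInv k y l m *
        (a (y 0) ^ 2 * sliceMetricGrad k y j m i + a (y 0) ^ 2 * sliceMetricGrad k y i m j
          - a (y 0) ^ 2 * sliceMetricGrad k y i j m) =
        sliceInv k y l m * (sliceMetricGrad k y j m i + sliceMetricGrad k y i m j
          - sliceMetricGrad k y i j m) := by
      field_simp
    rw [Finset.sum_congr rfl fun m _ => term_eq m, sum_sliceInv_mul_grad h]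
    ring

omit h hF in
lemma hasGrad_ite_logDeriv (y : Fin (d + 1) → ℝ) (P : Prop) [Decidable P] :
    HasGrad (fun z : Fin (d + 1) → ℝ => if P then deriv a (z 0) / a (z 0) else 0)
      (Fin.cons (if P then deriv (deriv a) (y 0) / a (y 0) - deriv a (y 0) ^ 2 / a (y 0) ^ 2
        else 0) fun _ => 0) y := by
  by_cases hP : P
  · simpa only [hP, if_true] using hasGrad_time (ha.hasDerivAt_logDeriv (y 0))
  · simp only [hP, if_false]
    exact (hasGrad_const 0 y).congr_grad fun b => by cases b using Fin.cases <;> simp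

lemma hasGrad_flrwChristoffel (c μ ν : Fin (d + 1)) :
    HasGrad (fun z => flrwChristoffel k a F z c μ ν) (flrwChristoffelGrad k a F y c μ ν) y := by
  have hF_pos := hF.pos (y 0)
  cases c using Fin.cases <;> cases μ using Fin.cases <;> cases ν using Fin.cases
  case zero.zero.zero =>
    refine hasGrad_time (φ := fun t => deriv F t / (2 * F t)) ?_
    refine ((hF.hasDerivAt_deriv _).fun_div ((hF.hasDerivAt _).const_mul 2)
      (by positivity)).congr_deriv ?_
    field_simp
  case zero.zero.succ => exact hasGrad_const 0 y
  case zero.succ.zero => exact hasGrad_const 0 y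
  case zero.succ.succ i j =>
    have coeff : HasDerivAt (fun t => a t * deriv a t / F t)
        ((deriv a (y 0) ^ 2 + a (y 0) * deriv (deriv a) (y 0)) / F (y 0)
            - a (y 0) * deriv a (y 0) * deriv F (y 0) / F (y 0) ^ 2) (y 0) := by
      refine (((ha.hasDerivAt _).fun_mul (ha.hasDerivAt_deriv _)).fun_div (hF.hasDerivAt _)
        hF_pos.ne').congr_deriv ?_
      field_simp
    refine ((hasGrad_time coeff).mul (hasGrad_sliceMetric h i j)).congr_grad fun b => ?_
    cases b using Fin.cases <;> simp [flrwChristoffelGrad]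
  case succ.zero.zero => exact hasGrad_const 0 y
  case succ.zero.succ l j => exact hasGrad_ite_logDeriv ha y (l = j)
  case succ.succ.zero l i => exact hasGrad_ite_logDeriv ha y (l = i)
  case succ.succ.succ l i j =>
    refine (((hasGrad_coord l.succ y).const_mul k).mul (hasGrad_sliceMetric h i j)).congr_grad
      fun b => ?_
    cases b using Fin.cases
    · simp [flrwChristoffelGrad, (Fin.succ_ne_zero _).symm]
    · simp only [flrwChristoffelGrad, Fin.succ_inj, Fin.cons_succ, Fin.cases_succ]
      ring

lemma pderiv_christoffel_flrwMetric (c μ ν b : Fin (d + 1)) :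
    pderiv b (fun z => christoffel (flrwMetric d k a F) z c μ ν) y =
      flrwChristoffelGrad k a F y c μ ν b := by
  refine ((hasGrad_flrwChristoffel h ha hF c μ ν).congr_of_eventuallyEq ?_).pderiv_eq b
  filter_upwards [eventually_slice_pos h] with z hz
  exact christoffel_flrwMetric hz ha hF c μ ν

end Christoffel

/-! ### The Riemann tensor -/

section Riemann

/-- The time-space sectional curvature of the FLRW metric. -/
def curvA (a F : ℝ → ℝ) (t : ℝ) : ℝ :=
  (deriv (deriv a) t / a t - deriv F t * deriv a t / (2 * F t * a t)) / F t

/-- The sectional curvature of the FLRW metric in the spatial directions. -/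
def curvB (k : ℝ) (a F : ℝ → ℝ) (t : ℝ) : ℝ := (k + deriv a t ^ 2 / F t) / a t ^ 2

lemma riemannUp_swap {D : ℕ} (g : MetricField D) (y : Fin D → ℝ) (a b c e : Fin D) :
    riemannUp g y b a c e = -riemannUp g y a b c e := by
  simp only [riemannUp, Finset.sum_sub_distrib]
  ring

variable {d : ℕ} {k : ℝ} {a F : ℝ → ℝ} {y : Fin (d + 1) → ℝ}

lemma sliceMetricGrad_antisymm (h : 0 < slice k y) (i j m : Fin d) :
    sliceMetricGrad k y i m j - sliceMetricGrad k y j m i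
      + k * (sliceMetric k y i m * (y j.succ / slice k y)
        - sliceMetric k y j m * (y i.succ / slice k y)) = 0 := by
  simp only [sliceMetricGrad, sliceMetric_apply, eq_comm (a := j) (b := i)]
  field_simp
  ring

lemma sum_coord_mul_smul_sliceMetric (h : 0 < slice k y) (p q r : ℝ) (i : Fin d) :
    ∑ l : Fin d, p * y l.succ * q * (r * sliceMetric k y i l) =
      p * q * r * (y i.succ / slice k y) := by
  rw [← sum_coord_mul_sliceMetric h, Finset.mul_sum]
  exact Finset.sum_congr rfl fun _ _ => by ring

variable (h : 0 < slice k y) (ha : SmoothPos a) (hF : SmoothPos F)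
include h ha hF

lemma riemannUp_flrwMetric (α β c e : Fin (d + 1)) :
    riemannUp (flrwMetric d k a F) y α β c e =
      flrwChristoffelGrad k a F y e α c β - flrwChristoffelGrad k a F y e β c α +
      ∑ f, (flrwChristoffel k a F y f α c * flrwChristoffel k a F y e β f
        - flrwChristoffel k a F y f β c * flrwChristoffel k a F y e α f) := by
  simp only [riemannUp, pderiv_christoffel_flrwMetric h ha hF, christoffel_flrwMetric h ha hF]

lemma riemannUp_flrwMetric_zero_succ (j : Fin d) (c e : Fin (d + 1)) :
    riemannUp (flrwMetric d k a F) y 0 j.succ c e = -curvA a F (y 0) *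
      ((if j.succ = e then timeSpaceBlock (F (y 0)) 0 0 c else 0)
        + if 0 = e then timeSpaceBlock 0 (a (y 0) ^ 2 • sliceMetric k y) j.succ c else 0) := by
  have ha_pos := ha.pos (y 0)
  have hF_pos := hF.pos (y 0)
  rw [riemannUp_flrwMetric h ha hF]
  cases c using Fin.cases <;> cases e using Fin.cases <;>
    simp only [Fin.sum_univ_succ, flrwChristoffel, flrwChristoffelGrad, Fin.cases_zero,
      Fin.cases_succ, Fin.cons_zero, Fin.cons_succ, Fin.succ_ne_zero, (Fin.succ_ne_zero _).symm,
      Fin.succ_inj, timeSpaceBlock_zero_zero, timeSpaceBlock_zero_succ, timeSpaceBlock_succ_zero,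
      timeSpaceBlock_succ_succ, Matrix.smul_apply, smul_eq_mul, mul_ite, ite_mul, mul_zero,
      zero_mul, Finset.sum_const_zero, Finset.sum_sub_distrib, Finset.sum_ite_eq,
      Finset.sum_ite_eq', Finset.mem_univ, if_true, if_false, ite_self, add_zero, zero_add,
      zero_sub, sub_self]
  case zero.succ l =>
    simp only [eq_comm (a := j)]
    split_ifs
    · rw [curvA]
      field_simp
      ring
    · ring
  case succ.zero m =>
    rw [curvA]
    field_simp
    ring
  case succ.succ => ring

lemma riemannUp_flrwMetric_succ_succ (i j : Fin d) (c e : Fin (d + 1)) :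
    riemannUp (flrwMetric d k a F) y i.succ j.succ c e = curvB k a F (y 0) *
      ((if j.succ = e then timeSpaceBlock 0 (a (y 0) ^ 2 • sliceMetric k y) i.succ c else 0)
        - if i.succ = e then timeSpaceBlock 0 (a (y 0) ^ 2 • sliceMetric k y) j.succ c else 0) := by
  have ha_pos := ha.pos (y 0)
  have hF_pos := hF.pos (y 0)
  rw [riemannUp_flrwMetric h ha hF]
  cases c using Fin.cases <;> cases e using Fin.cases <;>
    simp only [Fin.sum_univ_succ, flrwChristoffel, flrwChristoffelGrad, Fin.cases_zero,
      Fin.cases_succ, Fin.cons_succ, Fin.succ_ne_zero, Fin.succ_inj, timeSpaceBlock_succ_zero,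
      timeSpaceBlock_succ_succ, Matrix.smul_apply, smul_eq_mul, mul_ite, ite_mul, mul_zero,
      zero_mul, Finset.sum_sub_distrib, Finset.sum_ite_eq', Finset.mem_univ, if_true, if_false,
      ite_self, add_zero, zero_add, sub_self, sliceMetric_symm k y i j,
      sum_coord_mul_smul_sliceMetric h]
  case succ.zero m =>
    linear_combination a (y 0) * deriv a (y 0) / F (y 0) * sliceMetricGrad_antisymm h i j m
  case succ.succ m l =>
    have antisymm := sliceMetricGrad_antisymm h i j m
    have curvB_mul : curvB k a F (y 0) * a (y 0) ^ 2 = k + deriv a (y 0) ^ 2 / F (y 0) :=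
      div_mul_cancel₀ _ (pow_ne_zero 2 ha_pos.ne')
    have deriv_cancel (p : ℝ) : a (y 0) * deriv a (y 0) / F (y 0) * p
        * (deriv a (y 0) / a (y 0)) = deriv a (y 0) ^ 2 / F (y 0) * p := by
      field_simp
    simp only [eq_comm (a := j), eq_comm (a := i) (b := l), deriv_cancel, mul_sub, mul_ite,
      mul_zero, ← mul_assoc (curvB k a F (y 0)), curvB_mul]
    split_ifs <;> linear_combination k * y l.succ * antisymm

lemma riemann_flrwMetric_zero_succ (j : Fin d) (c e : Fin (d + 1)) :
    riemann (flrwMetric d k a F) y 0 j.succ c e = -curvA a F (y 0) *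
      (timeSpaceBlock (F (y 0)) 0 0 c * flrwMetric d k a F y j.succ e
        + timeSpaceBlock 0 (a (y 0) ^ 2 • sliceMetric k y) j.succ c
          * flrwMetric d k a F y 0 e) := by
  simp only [riemann, riemannUp_flrwMetric_zero_succ h ha hF, mul_assoc, add_mul, ite_mul,
    zero_mul, Finset.sum_add_distrib, ← Finset.mul_sum, Finset.sum_ite_eq, Finset.mem_univ, if_true]

lemma riemann_flrwMetric_succ_succ (i j : Fin d) (c e : Fin (d + 1)) :
    riemann (flrwMetric d k a F) y i.succ j.succ c e = curvB k a F (y 0) *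
      (timeSpaceBlock 0 (a (y 0) ^ 2 • sliceMetric k y) i.succ c * flrwMetric d k a F y j.succ e
        - timeSpaceBlock 0 (a (y 0) ^ 2 • sliceMetric k y) j.succ c
          * flrwMetric d k a F y i.succ e) := by
  simp only [riemann, riemannUp_flrwMetric_succ_succ h ha hF, mul_assoc, sub_mul, ite_mul,
    zero_mul, Finset.sum_sub_distrib, ← Finset.mul_sum, Finset.sum_ite_eq, Finset.mem_univ, if_true]

omit h ha hF in
lemma riemann_swap {D : ℕ} (g : MetricField D) (y : Fin D → ℝ) (a b c e : Fin D) :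
    riemann g y b a c e = -riemann g y a b c e := by
  simp only [riemann, riemannUp_swap g y a b, neg_mul, Finset.sum_neg_distrib]

omit h ha hF in
lemma isoRiemann_apply {D : ℕ} (T S : Matrix (Fin D) (Fin D) ℝ) (A B : ℝ) (α β c e : Fin D) :
    isoRiemann T S A B α β c e =
      B * kn S S α β c e - A * (kn T S α β c e + kn S T α β c e) := rfl

lemma riemann_flrwMetric :
    riemann (flrwMetric d k a F) y = isoRiemann (timeSpaceBlock (F (y 0)) 0)
      (timeSpaceBlock 0 (a (y 0) ^ 2 • sliceMetric k y)) (curvA a F (y 0)) (curvB k a F (y 0)) := by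
  funext α β c e
  cases α using Fin.cases <;> cases β using Fin.cases
  case zero.zero =>
    rw [self_eq_neg.mp (riemann_swap _ y 0 0 c e)]
    simp only [isoRiemann_apply, kn]
    ring
  case zero.succ j =>
    rw [riemann_flrwMetric_zero_succ h ha hF, flrwMetric_eq, isoRiemann_apply]
    cases c using Fin.cases <;> cases e using Fin.cases <;>
      simp only [kn, timeSpaceBlock_zero_zero, timeSpaceBlock_zero_succ, timeSpaceBlock_succ_zero,
        timeSpaceBlock_succ_succ, Matrix.zero_apply] <;>
      ring
  case succ.zero i =>
    rw [riemann_swap, riemann_flrwMetric_zero_succ h ha hF, flrwMetric_eq, isoRiemann_apply]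
    cases c using Fin.cases <;> cases e using Fin.cases <;>
      simp only [kn, timeSpaceBlock_zero_zero, timeSpaceBlock_zero_succ, timeSpaceBlock_succ_zero,
        timeSpaceBlock_succ_succ, Matrix.zero_apply] <;>
      ring
  case succ.succ i j =>
    rw [riemann_flrwMetric_succ_succ h ha hF, flrwMetric_eq]
    cases c using Fin.cases <;> cases e using Fin.cases <;> simp [isoRiemann_apply, kn, mul_comm]

end Riemann

/-! ### The curvature momentum of an FLRW metric -/

section Momentum

variable {d : ℕ}

/-- The coefficient of the spatial part of the curvature momentum. -/
def momentumS (L : Lagrangian (d + 1)) (k : ℝ) (a F : ℝ → ℝ) (t : ℝ) : ℝ :=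
  reducedB L (curvA a F t, curvB k a F t) / (2 * d * (d - 1))

/-- The coefficient of the time-space part of the curvature momentum. -/
def momentumT (L : Lagrangian (d + 1)) (k : ℝ) (a F : ℝ → ℝ) (t : ℝ) : ℝ :=
  -(reducedA L (curvA a F t, curvB k a F t) / (4 * d))

variable {L : Lagrangian (d + 1)} {k : ℝ} {a F : ℝ → ℝ} {y : Fin (d + 1) → ℝ}
  (h : 0 < slice k y) (ha : SmoothPos a) (hF : SmoothPos F)
include h ha hF

lemma exists_frame_riemann :
    ∃ M N : Matrix (Fin (d + 1)) (Fin (d + 1)) ℝ, N * Mᵀ = 1 ∧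
      Mᵀ * (flrwMetric d k a F y)⁻¹ * M = minkowski d ∧
      riemann (flrwMetric d k a F) y =
        act M (frameRiemann d (curvA a F (y 0)) (curvB k a F (y 0))) ∧
      N * timeProj d * Nᵀ = timeSpaceBlock (F (y 0))⁻¹ 0 ∧
      N * minkowski d * Nᵀ = (flrwMetric d k a F y)⁻¹ := by
  obtain ⟨M, N, hNM, hM_time, hM_space, hN_time, hN_metric⟩ :=
    exists_frame (ha.pos (y 0)) (hF.pos (y 0)) h
  have hNM' : Nᵀ * M = 1 := by
    rw [← Matrix.transpose_one, ← mul_eq_one_comm.mp hNM, Matrix.transpose_mul,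
      Matrix.transpose_transpose]
  refine ⟨M, N, hNM, ?_, ?_, hN_time, hN_metric⟩
  · calc Mᵀ * (flrwMetric d k a F y)⁻¹ * M = (Mᵀ * N) * minkowski d * (Nᵀ * M) := by
          simp only [← hN_metric, Matrix.mul_assoc]
      _ = minkowski d := by rw [mul_eq_one_comm.mp hNM, hNM', one_mul, mul_one]
  · rw [riemann_flrwMetric h ha hF, frameRiemann, act_isoRiemann, hM_time, hM_space]

variable (hL : IsInvariant L)
include hL

lemma IsInvariant.apply_flrwMetric :
    L (flrwMetric d k a F y)⁻¹ (riemann (flrwMetric d k a F) y) =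
      reduced L (curvA a F (y 0), curvB k a F (y 0)) := by
  obtain ⟨M, N, -, h_metric, h_riemann, -, -⟩ := exists_frame_riemann h ha hF
  rw [h_riemann, hL.apply_act, h_metric, reduced]

lemma IsInvariant.curvatureMomentum_flrwMetric (hd : 2 ≤ d) :
    curvatureMomentum L (flrwMetric d k a F y)⁻¹ (riemann (flrwMetric d k a F) y) =
      isoMomentum (flrwMetric d k a F y)⁻¹ (timeSpaceBlock (F (y 0))⁻¹ 0)
        (momentumS L k a F (y 0)) (momentumT L k a F (y 0) + momentumS L k a F (y 0)) := by
  obtain ⟨M, N, hNM, h_metric, h_riemann, hN_time, hN_metric⟩ := exists_frame_riemann h ha hF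
  set P := curvatureMomentum L (flrwMetric d k a F y)⁻¹ (riemann (flrwMetric d k a F) y) with hP
  calc P = act N (act Mᵀ P) := by rw [act_act, hNM, act_one]
    _ = act N (frameMomentum L (curvA a F (y 0)) (curvB k a F (y 0))) := by
      rw [hP, h_riemann, ← hL.curvatureMomentum_act, h_metric, frameMomentum]
    _ = isoMomentum (flrwMetric d k a F y)⁻¹ (timeSpaceBlock (F (y 0))⁻¹ 0)
        (momentumS L k a F (y 0)) (momentumT L k a F (y 0) + momentumS L k a F (y 0)) := by
      rw [hL.frameMomentum_eq hd, act_isoMomentum, hN_metric, hN_time, momentumS, momentumT,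
        neg_add_eq_sub]

end Momentum

/-! ### Contractions of curvature tensors -/

section Contraction

/-- The matrix `P_a^{cef} Q_{hcef}` obtained by contracting the last three slots of two tensors. -/
def tripleContract {D : ℕ} (P Q : Tensor4 D) : Matrix (Fin D) (Fin D) ℝ :=
  Matrix.of fun a h => ∑ c, ∑ e, ∑ f, P a c e f * Q h c e f

section

variable {D : ℕ} (P P' Q Q' : Tensor4 D) (r : ℝ)

lemma tripleContract_add_left :
    tripleContract (P + P') Q = tripleContract P Q + tripleContract P' Q := by
  ext a h
  simp [tripleContract, add_mul, Finset.sum_add_distrib]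

lemma tripleContract_smul_left : tripleContract (r • P) Q = r • tripleContract P Q := by
  ext a h
  simp [tripleContract, Finset.mul_sum, mul_assoc]

lemma tripleContract_add_right :
    tripleContract P (Q + Q') = tripleContract P Q + tripleContract P Q' := by
  ext a h
  simp [tripleContract, mul_add, Finset.sum_add_distrib]

lemma tripleContract_sub_right :
    tripleContract P (Q - Q') = tripleContract P Q - tripleContract P Q' := by
  ext a h
  simp [tripleContract, mul_sub, Finset.sum_sub_distrib]

lemma tripleContract_smul_right : tripleContract P (r • Q) = r • tripleContract P Q := by
  ext a h
  simp [tripleContract, Finset.mul_sum, mul_left_comm]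

lemma tripleContract_mul_transpose (G : Matrix (Fin D) (Fin D) ℝ) (a b : Fin D) :
    (tripleContract P Q * Gᵀ) a b = ∑ c, ∑ e, ∑ f, P a c e f * ∑ h, G b h * Q h c e f := by
  simp only [Matrix.mul_apply, tripleContract, Matrix.of_apply, Matrix.transpose_apply,
    Finset.sum_mul, Finset.mul_sum]
  rw [Finset.sum_comm]
  refine Finset.sum_congr rfl fun c _ => ?_
  rw [Finset.sum_comm]
  refine Finset.sum_congr rfl fun e _ => ?_
  rw [Finset.sum_comm]
  exact Finset.sum_congr rfl fun f _ => Finset.sum_congr rfl fun h _ => by ring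

lemma tripleContract_kn (X Y S T : Matrix (Fin D) (Fin D) ℝ) :
    tripleContract (kn X Y) (kn S T) =
      (2 : ℝ) • ((Y * Tᵀ).trace • (X * Sᵀ) - X * Tᵀ * Y * Sᵀ) := by
  ext a h
  have trace_term : ∑ c, ∑ e, ∑ f, X a e * S h e * (Y c f * T c f) =
      (X * Sᵀ) a h * (Y * Tᵀ).trace := by
    simp only [Matrix.mul_apply, Matrix.trace, Matrix.diag_apply, Matrix.transpose_apply,
      Finset.sum_mul_sum]
    rw [Finset.sum_comm]
    simp only [Finset.mul_sum]
  have trace_term_swap : ∑ c, ∑ e, ∑ f, X a f * S h f * (Y c e * T c e) =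
      (X * Sᵀ) a h * (Y * Tᵀ).trace := by
    rw [← trace_term]
    exact Finset.sum_congr rfl fun _ _ => Finset.sum_comm
  have chain_term : ∑ c, ∑ e, ∑ f, X a e * T c e * Y c f * S h f = (X * Tᵀ * Y * Sᵀ) a h := by
    symm
    simp only [Matrix.mul_apply, Matrix.transpose_apply, Finset.sum_mul]
    rw [Finset.sum_comm]
    exact Finset.sum_congr rfl fun _ _ => Finset.sum_comm
  have chain_term_swap : ∑ c, ∑ e, ∑ f, X a f * T c f * Y c e * S h e =
      (X * Tᵀ * Y * Sᵀ) a h := by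
    rw [← chain_term]
    exact Finset.sum_congr rfl fun _ _ => Finset.sum_comm
  calc tripleContract (kn X Y) (kn S T) a h
      = (∑ c, ∑ e, ∑ f, X a e * S h e * (Y c f * T c f)
          + ∑ c, ∑ e, ∑ f, X a f * S h f * (Y c e * T c e))
        - (∑ c, ∑ e, ∑ f, X a e * T c e * Y c f * S h f
          + ∑ c, ∑ e, ∑ f, X a f * T c f * Y c e * S h e) := by
        simp only [tripleContract, Matrix.of_apply, ← Finset.sum_add_distrib,
          ← Finset.sum_sub_distrib, kn]
        exact Finset.sum_congr rfl fun _ _ => Finset.sum_congr rfl fun _ _ =>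
          Finset.sum_congr rfl fun _ _ => by ring
    _ = ((2 : ℝ) • ((Y * Tᵀ).trace • (X * Sᵀ) - X * Tᵀ * Y * Sᵀ)) a h := by
      rw [trace_term, trace_term_swap, chain_term, chain_term_swap]
      simp only [Matrix.smul_apply, Matrix.sub_apply, smul_eq_mul]
      ring

end

variable {d : ℕ}

lemma timeSpaceBlock_trace (p : ℝ) (X : Matrix (Fin d) (Fin d) ℝ) :
    (timeSpaceBlock p X).trace = p + X.trace := by
  simp [Matrix.trace, Fin.sum_univ_succ]

lemma tripleContract_isoMomentum_isoRiemann {f : ℝ} (hf : f ≠ 0) {X Y : Matrix (Fin d) (Fin d) ℝ}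
    (hXY : X * Y = 1) (hY : Yᵀ = Y) (A B σ θ : ℝ) :
    tripleContract (isoMomentum (timeSpaceBlock (-f⁻¹) X) (timeSpaceBlock f⁻¹ 0) σ θ)
        (isoRiemann (timeSpaceBlock f 0) (timeSpaceBlock 0 Y) A B) =
      timeSpaceBlock (-(2 * d * (θ - σ) * A))
        ((2 * (d - 1) * σ * B - 2 * (θ - σ) * A) • (1 : Matrix (Fin d) (Fin d) ℝ)) := by
  simp only [isoMomentum, isoRiemann, tripleContract_add_left, tripleContract_smul_left,
    tripleContract_add_right, tripleContract_sub_right, tripleContract_smul_right,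
    tripleContract_kn, timeSpaceBlock_transpose, timeSpaceBlock_mul, timeSpaceBlock_trace, hY, hXY,
    Matrix.transpose_zero, mul_zero, zero_mul, Matrix.trace_zero, Matrix.trace_one,
    Fintype.card_fin, neg_mul, inv_mul_cancel₀ hf, one_mul]
  ext μ ν
  cases μ using Fin.cases <;> cases ν using Fin.cases <;> simp
  · ring
  · ring

end Contraction

/-! ### Covariant derivatives -/

section Connection

variable {D : ℕ}

/-- The connection terms of the covariant derivative of a tensor with two upper indices. -/
def connection2 (Γ : Fin D → Fin D → Fin D → ℝ) (U : Matrix (Fin D) (Fin D) ℝ)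
    (e a b : Fin D) : ℝ := ∑ f, (Γ a e f * U f b + Γ b e f * U a f)

/-- The connection terms of the covariant derivative of a tensor with four upper indices. -/
def connection4 (Γ : Fin D → Fin D → Fin D → ℝ) (T : Tensor4 D) (e a b c d : Fin D) : ℝ :=
  ∑ f, (Γ a e f * T f b c d + Γ b e f * T a f c d + Γ c e f * T a b f d + Γ d e f * T a b c f)

lemma connection4_kn (Γ : Fin D → Fin D → Fin D → ℝ) (U V : Matrix (Fin D) (Fin D) ℝ)
    (e a b c d : Fin D) :
    connection4 Γ (kn U V) e a b c d =
      connection2 Γ U e a c * V b d + U a c * connection2 Γ V e b d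
        - connection2 Γ U e a d * V b c - U a d * connection2 Γ V e b c := by
  simp only [connection4, connection2, Finset.sum_mul, Finset.mul_sum, ← Finset.sum_add_distrib,
    ← Finset.sum_sub_distrib, kn]
  exact Finset.sum_congr rfl fun f _ => by ring

lemma connection4_isoMomentum (Γ : Fin D → Fin D → Fin D → ℝ) (U V : Matrix (Fin D) (Fin D) ℝ)
    (σ θ : ℝ) (e a b c d : Fin D) :
    connection4 Γ (isoMomentum U V σ θ) e a b c d =
      σ * connection4 Γ (kn U U) e a b c d + θ *
        (connection4 Γ (kn U V) e a b c d + connection4 Γ (kn V U) e a b c d) := by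
  simp only [connection4, Finset.mul_sum, ← Finset.sum_add_distrib, isoMomentum, Pi.add_apply,
    Pi.smul_apply, smul_eq_mul]
  exact Finset.sum_congr rfl fun f _ => by ring

variable {Γ : Fin D → Fin D → Fin D → ℝ} {U V : (Fin D → ℝ) → Matrix (Fin D) (Fin D) ℝ}
  {X Y : Fin D → Matrix (Fin D) (Fin D) ℝ} {y : Fin D → ℝ}

lemma hasGrad_kn
    (hU : ∀ a b, HasGrad (fun z => U z a b) (fun e => X e a b - connection2 Γ (U y) e a b) y)
    (hV : ∀ a b, HasGrad (fun z => V z a b) (fun e => Y e a b - connection2 Γ (V y) e a b) y)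
    (a b c d : Fin D) :
    HasGrad (fun z => kn (U z) (V z) a b c d)
      (fun e => kn (X e) (V y) a b c d + kn (U y) (Y e) a b c d
        - connection4 Γ (kn (U y) (V y)) e a b c d) y := by
  refine (((hU a c).mul (hV b d)).sub ((hU a d).mul (hV b c))).congr_grad fun e => ?_
  rw [connection4_kn]
  simp only [kn]
  ring

lemma hasGrad_isoMomentum {σ θ : (Fin D → ℝ) → ℝ} {σ' θ' : Fin D → ℝ} (hσ : HasGrad σ σ' y)
    (hθ : HasGrad θ θ' y)
    (hU : ∀ a b, HasGrad (fun z => U z a b) (fun e => -connection2 Γ (U y) e a b) y)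
    (hV : ∀ a b, HasGrad (fun z => V z a b) (fun e => Y e a b - connection2 Γ (V y) e a b) y)
    (a b c d : Fin D) :
    HasGrad (fun z => isoMomentum (U z) (V z) (σ z) (θ z) a b c d)
      (fun e => σ' e * kn (U y) (U y) a b c d
        + θ' e * (kn (U y) (V y) a b c d + kn (V y) (U y) a b c d)
        + θ y * (kn (U y) (Y e) a b c d + kn (Y e) (U y) a b c d)
        - connection4 Γ (isoMomentum (U y) (V y) (σ y) (θ y)) e a b c d) y := by
  have hU_parallel : ∀ a b, HasGrad (fun z => U z a b)
      (fun e => (0 : Fin D → Matrix (Fin D) (Fin D) ℝ) e a b - connection2 Γ (U y) e a b) y :=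
    fun a b => (hU a b).congr_grad fun e => by simp
  refine ((hσ.mul (hasGrad_kn hU_parallel hU_parallel a b c d)).add
    (hθ.mul ((hasGrad_kn hU_parallel hV a b c d).add
      (hasGrad_kn hV hU_parallel a b c d)))).congr_grad fun e => ?_
  rw [connection4_isoMomentum]
  simp only [kn, Pi.zero_apply, Matrix.zero_apply]
  ring

/-- The tensor `v (G^{ac} u^b - u^a G^{bc})` for the coordinate vector `u = ∂_0`: the form of the
first divergence of the curvature momentum of an FLRW metric. -/
def timeFlux {d : ℕ} (v : ℝ) (G : Matrix (Fin (d + 1)) (Fin (d + 1)) ℝ)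
    (a b c : Fin (d + 1)) : ℝ :=
  v * (G a c * (if b = 0 then 1 else 0) - (if a = 0 then 1 else 0) * G b c)

lemma connection_timeFlux {d : ℕ} (Γ : Fin (d + 1) → Fin (d + 1) → Fin (d + 1) → ℝ) (v : ℝ)
    (G : Matrix (Fin (d + 1)) (Fin (d + 1)) ℝ) (e a b c : Fin (d + 1)) :
    ∑ f, (Γ a e f * timeFlux v G f b c + Γ b e f * timeFlux v G a f c
        + Γ c e f * timeFlux v G a b f) =
      v * (connection2 Γ G e a c * (if b = 0 then 1 else 0)
        - (if a = 0 then 1 else 0) * connection2 Γ G e b c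
        + (G a c * Γ b e 0 - Γ a e 0 * G b c)) := by
  have contract_time : ∀ w : Fin (d + 1) → ℝ, w 0 = ∑ f, w f * (if f = 0 then 1 else 0) := by
    simp
  rw [contract_time (Γ b e), contract_time (Γ a e)]
  simp only [timeFlux, connection2, Finset.sum_mul, Finset.mul_sum, ← Finset.sum_add_distrib,
    ← Finset.sum_sub_distrib]
  exact Finset.sum_congr rfl fun f _ => by ring

end Connection

section FLRW

variable {d : ℕ} {k : ℝ} {a F : ℝ → ℝ} {y : Fin (d + 1) → ℝ}

lemma sum_smul_sliceMetric_mul_sliceInv (h : 0 < slice k y) (p q : ℝ) (i j : Fin d) :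
    ∑ l, p * sliceMetric k y i l * (q * sliceInv k y l j) = if i = j then p * q else 0 := by
  have entry := congr_fun (congr_fun (sliceMetric_mul_sliceInv h) i) j
  rw [Matrix.mul_apply, Matrix.one_apply] at entry
  rw [← mul_one (p * q), ← mul_zero (p * q), ← mul_ite, ← entry, Finset.mul_sum]
  exact Finset.sum_congr rfl fun _ _ => by ring

/-- The covariant derivative of the tensor `F⁻¹ ∂_0 ⊗ ∂_0` for an FLRW metric. -/
def timeProjDeriv (a F : ℝ → ℝ) (y : Fin (d + 1) → ℝ) (e : Fin (d + 1)) :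
    Matrix (Fin (d + 1)) (Fin (d + 1)) ℝ :=
  Matrix.of fun μ ν => deriv a (y 0) / (a (y 0) * F (y 0)) *
    Fin.cases 0 (fun l => Fin.cases (Fin.cases 0 (fun j => if l = j then 1 else 0) ν)
      (fun i => Fin.cases (if l = i then 1 else 0) (fun _ => 0) ν) μ) e

lemma connection2_flrwChristoffel_zero (p q : ℝ) :
    connection2 (flrwChristoffel k a F y) (timeSpaceBlock p (q • sliceInv k y)) 0 =
      timeSpaceBlock (p * (deriv F (y 0) / F (y 0)))
        ((2 * q * (deriv a (y 0) / a (y 0))) • sliceInv k y) := by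
  funext μ ν
  cases μ using Fin.cases <;> cases ν using Fin.cases
  case zero.zero =>
    simp only [connection2, flrwChristoffel, Fin.sum_univ_succ, Fin.cases_zero, Fin.cases_succ,
      timeSpaceBlock_zero_zero, timeSpaceBlock_zero_succ, timeSpaceBlock_succ_zero, mul_zero,
      add_zero, Finset.sum_const_zero]
    field_simp
    ring
  case zero.succ j => simp [connection2, flrwChristoffel, Fin.sum_univ_succ]
  case succ.zero i => simp [connection2, flrwChristoffel, Fin.sum_univ_succ]
  case succ.succ i j =>
    simp only [connection2, flrwChristoffel, Fin.sum_univ_succ, Fin.cases_zero, Fin.cases_succ,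
      timeSpaceBlock_zero_succ, timeSpaceBlock_succ_zero, timeSpaceBlock_succ_succ,
      Matrix.smul_apply, smul_eq_mul, ite_mul, zero_mul, mul_zero, zero_add,
      Finset.sum_add_distrib, Finset.sum_ite_eq, Finset.mem_univ, if_true]
    ring

lemma connection2_flrwChristoffel_succ (h : 0 < slice k y) (ha : 0 < a (y 0)) (hF : 0 < F (y 0))
    (p q : ℝ) (l : Fin d) (μ ν : Fin (d + 1)) :
    connection2 (flrwChristoffel k a F y) (timeSpaceBlock p (q • sliceInv k y)) l.succ μ ν =
      (p * F (y 0) + q * a (y 0) ^ 2) * timeProjDeriv a F y l.succ μ ν +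
        timeSpaceBlock 0 (q • Matrix.of fun i j =>
          k * ((if l = i then 1 else 0) * y j.succ + y i.succ * (if l = j then 1 else 0))) μ ν := by
  have contract := sum_smul_sliceMetric_mul_sliceInv h
  have contract_symm : ∀ (p q : ℝ) (i j : Fin d),
      ∑ l, p * sliceMetric k y i l * (q * sliceInv k y j l) = if i = j then p * q else 0 :=
    fun p q i j => by simp only [sliceInv_symm k y j, contract]
  cases μ using Fin.cases <;> cases ν using Fin.cases
  case zero.zero => simp [connection2, flrwChristoffel, Fin.sum_univ_succ, timeProjDeriv]
  case zero.succ j =>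
    simp only [connection2, flrwChristoffel, Fin.sum_univ_succ, timeProjDeriv, Matrix.of_apply,
      Fin.cases_zero, Fin.cases_succ, timeSpaceBlock_zero_zero, timeSpaceBlock_zero_succ,
      timeSpaceBlock_succ_succ, Matrix.smul_apply, smul_eq_mul, ite_mul, zero_mul, mul_zero,
      zero_add, add_zero, contract, eq_comm (a := j)]
    split_ifs <;> field_simp
    ring
  case succ.zero i =>
    simp only [connection2, flrwChristoffel, Fin.sum_univ_succ, timeProjDeriv, Matrix.of_apply,
      Fin.cases_zero, Fin.cases_succ, timeSpaceBlock_zero_zero, timeSpaceBlock_succ_zero,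
      timeSpaceBlock_succ_succ, Matrix.smul_apply, smul_eq_mul, ite_mul, zero_mul, mul_zero,
      zero_add, add_zero, contract_symm, eq_comm (a := i)]
    split_ifs <;> field_simp
    ring
  case succ.succ i j =>
    simp only [connection2, flrwChristoffel, Fin.sum_univ_succ, timeProjDeriv, Matrix.of_apply,
      Fin.cases_succ, Fin.cases_zero, timeSpaceBlock_zero_succ, timeSpaceBlock_succ_zero,
      timeSpaceBlock_succ_succ, Matrix.smul_apply, smul_eq_mul, mul_zero, zero_add,
      Finset.sum_add_distrib, contract, contract_symm]
    split_ifs <;> ring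

lemma hasGrad_timeSpaceBlock_sliceInv (h : 0 < slice k y) (ha : 0 < a (y 0)) (hF : 0 < F (y 0))
    {p q : ℝ → ℝ} (hp : HasDerivAt p (-(p (y 0) * (deriv F (y 0) / F (y 0)))) (y 0))
    (hq : HasDerivAt q (-(2 * q (y 0) * (deriv a (y 0) / a (y 0)))) (y 0)) (μ ν : Fin (d + 1)) :
    HasGrad (fun z => timeSpaceBlock (p (z 0)) (q (z 0) • sliceInv k z) μ ν)
      (fun e => (p (y 0) * F (y 0) + q (y 0) * a (y 0) ^ 2) * timeProjDeriv a F y e μ ν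
        - connection2 (flrwChristoffel k a F y)
          (timeSpaceBlock (p (y 0)) (q (y 0) • sliceInv k y)) e μ ν) y := by
  have grad : HasGrad (fun z => timeSpaceBlock (p (z 0)) (q (z 0) • sliceInv k z) μ ν)
      (Fin.cons (-timeSpaceBlock (p (y 0) * (deriv F (y 0) / F (y 0)))
        ((2 * q (y 0) * (deriv a (y 0) / a (y 0))) • sliceInv k y) μ ν) fun l =>
        -timeSpaceBlock 0 (q (y 0) • Matrix.of fun i j : Fin d =>
          k * ((if l = i then 1 else 0) * y j.succ + y i.succ * (if l = j then 1 else 0))) μ ν)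
      y := by
    cases μ using Fin.cases <;> cases ν using Fin.cases
    case zero.zero => simpa using hasGrad_time hp
    case succ.succ i j =>
      refine ((hasGrad_time hq).mul (hasGrad_sliceInv k y i j)).congr_grad fun e => ?_
      cases e using Fin.cases <;> simp
    all_goals exact (hasGrad_const 0 y).congr_grad fun e => by cases e using Fin.cases <;> simp
  refine grad.congr_grad fun e => ?_
  cases e using Fin.cases
  case zero => simp [connection2_flrwChristoffel_zero, timeProjDeriv]
  case succ l => simp [connection2_flrwChristoffel_succ h ha hF]

lemma hasGrad_flrwMetric_inv (h : 0 < slice k y) (ha : SmoothPos a) (hF : SmoothPos F)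
    (μ ν : Fin (d + 1)) :
    HasGrad (fun z => (flrwMetric d k a F z)⁻¹ μ ν)
      (fun e => -connection2 (flrwChristoffel k a F y) (flrwMetric d k a F y)⁻¹ e μ ν) y := by
  have ha_pos := ha.pos (y 0)
  have hF_pos := hF.pos (y 0)
  rw [flrwMetric_inv ha_pos hF_pos h]
  have hasDerivAt_lapse : HasDerivAt (fun t => -(F t)⁻¹)
      (-(-(F (y 0))⁻¹ * (deriv F (y 0) / F (y 0)))) (y 0) :=
    ((hF.hasDerivAt _).fun_inv hF_pos.ne').fun_neg.congr_deriv (by field_simp)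
  have hasDerivAt_scale : HasDerivAt (fun t => (a t ^ 2)⁻¹)
      (-(2 * (a (y 0) ^ 2)⁻¹ * (deriv a (y 0) / a (y 0)))) (y 0) :=
    (((ha.hasDerivAt _).fun_pow 2).fun_inv (by positivity)).congr_deriv (by field_simp; ring)
  refine ((hasGrad_timeSpaceBlock_sliceInv h ha_pos hF_pos hasDerivAt_lapse hasDerivAt_scale
    μ ν).congr_grad fun e => ?_).congr_of_eventuallyEq ?_
  · field_simp
    ring
  · filter_upwards [eventually_slice_pos h] with z hz
    rw [flrwMetric_inv (ha.pos _) (hF.pos _) hz]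

lemma hasGrad_timeSpaceBlock_inv (h : 0 < slice k y) (ha : SmoothPos a) (hF : SmoothPos F)
    (μ ν : Fin (d + 1)) :
    HasGrad (fun z => timeSpaceBlock (F (z 0))⁻¹ (0 : Matrix (Fin d) (Fin d) ℝ) μ ν)
      (fun e => timeProjDeriv a F y e μ ν
        - connection2 (flrwChristoffel k a F y) (timeSpaceBlock (F (y 0))⁻¹ 0) e μ ν) y := by
  have ha_pos := ha.pos (y 0)
  have hF_pos := hF.pos (y 0)
  have hasDerivAt_lapse : HasDerivAt (fun t => (F t)⁻¹)
      (-((F (y 0))⁻¹ * (deriv F (y 0) / F (y 0)))) (y 0) :=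
    ((hF.hasDerivAt _).fun_inv hF_pos.ne').congr_deriv (by field_simp)
  have hasDerivAt_zero : HasDerivAt (fun _ : ℝ => (0 : ℝ))
      (-(2 * 0 * (deriv a (y 0) / a (y 0)))) (y 0) := by simpa using hasDerivAt_const (y 0) (0 : ℝ)
  simpa [hF_pos.ne'] using
    hasGrad_timeSpaceBlock_sliceInv h ha_pos hF_pos hasDerivAt_lapse hasDerivAt_zero μ ν

lemma div4_isoMomentum (h : 0 < slice k y) (ha : SmoothPos a) (hF : SmoothPos F)
    {P : (Fin (d + 1) → ℝ) → Tensor4 (d + 1)} {σ θ : ℝ → ℝ} {σ' θ' : ℝ}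
    (hσ : HasDerivAt σ σ' (y 0)) (hθ : HasDerivAt θ θ' (y 0))
    (hP : ∀ z, 0 < slice k z → P z = isoMomentum (flrwMetric d k a F z)⁻¹
      (timeSpaceBlock (F (z 0))⁻¹ 0) (σ (z 0)) (θ (z 0))) (μ κ ν : Fin (d + 1)) :
    div4 (flrwMetric d k a F) P y μ κ ν =
      timeFlux ((θ' - σ' + (d - 1) * (deriv a (y 0) / a (y 0)) * θ (y 0)) / F (y 0))
        (flrwMetric d k a F y)⁻¹ μ κ ν := by
  have grad_P : ∀ e, pderiv e (fun z => P z μ κ ν e) y = _ := fun e =>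
    ((hasGrad_isoMomentum (hasGrad_time hσ) (hasGrad_time hθ) (hasGrad_flrwMetric_inv h ha hF)
      (hasGrad_timeSpaceBlock_inv h ha hF) μ κ ν e).congr_of_eventuallyEq (by
      filter_upwards [eventually_slice_pos h] with z hz
      rw [hP z hz])).pderiv_eq e
  have div4_eq : div4 (flrwMetric d k a F) P y μ κ ν = ∑ e, (pderiv e (fun z => P z μ κ ν e) y +
      connection4 (flrwChristoffel k a F y) (P y) e μ κ ν e) := by
    simp only [div4, connection4, christoffel_flrwMetric h ha hF]
  rw [div4_eq]
  simp only [grad_P, hP y h, sub_add_cancel, flrwMetric_inv (ha.pos _) (hF.pos _) h,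
    Fin.sum_univ_succ]
  cases μ using Fin.cases <;> cases κ using Fin.cases <;> cases ν using Fin.cases <;>
    simp [kn, timeProjDeriv, timeFlux, Finset.sum_add_distrib, Finset.sum_sub_distrib,
      Fin.succ_ne_zero, mul_add, mul_sub, sliceInv_symm k y]
  all_goals ring

lemma div3_timeFlux (h : 0 < slice k y) (ha : SmoothPos a) (hF : SmoothPos F)
    {V : (Fin (d + 1) → ℝ) → Fin (d + 1) → Fin (d + 1) → Fin (d + 1) → ℝ}
    {v : ℝ → ℝ} {v' : ℝ} (hv : HasDerivAt v v' (y 0))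
    (hV : ∀ z, 0 < slice k z → V z = timeFlux (v (z 0)) (flrwMetric d k a F z)⁻¹)
    (μ ν : Fin (d + 1)) :
    div3 (flrwMetric d k a F) V y μ ν =
      timeSpaceBlock (-(d * (deriv a (y 0) / a (y 0)) * v (y 0) / F (y 0)))
        ((v' + v (y 0) * (deriv F (y 0) / (2 * F (y 0)) + (d - 1) * (deriv a (y 0) / a (y 0)))) •
          (a (y 0) ^ 2)⁻¹ • sliceInv k y) μ ν := by
  set Γ := flrwChristoffel k a F y with hΓ
  set G := (flrwMetric d k a F y)⁻¹ with hG
  have covariant_deriv : ∀ e, pderiv e (fun z => V z μ e ν) y +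
      ∑ f, (Γ μ e f * V y f e ν + Γ e e f * V y μ f ν + Γ ν e f * V y μ e f) =
      (Fin.cons v' (fun _ => 0) : Fin (d + 1) → ℝ) e * timeFlux 1 G μ e ν
        + v (y 0) * (G μ ν * Γ e e 0 - Γ μ e 0 * G e ν) := by
    intro e
    have grad_V := ((hasGrad_time hv).mul
      (((hasGrad_flrwMetric_inv h ha hF μ ν).mul (hasGrad_const (if e = 0 then 1 else 0) y)).sub
        ((hasGrad_flrwMetric_inv h ha hF e ν).const_mul (if μ = 0 then 1 else 0))))
    rw [(grad_V.congr_of_eventuallyEq (by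
      filter_upwards [eventually_slice_pos h] with z hz
      rw [hV z hz, timeFlux])).pderiv_eq e, hV y h, connection_timeFlux, timeFlux]
    ring
  simp only [div3, christoffel_flrwMetric h ha hF, ← hΓ, covariant_deriv]
  rw [hG, flrwMetric_inv (ha.pos _) (hF.pos _) h, hΓ]
  simp only [Fin.sum_univ_succ]
  cases μ using Fin.cases <;> cases ν using Fin.cases <;>
    simp [flrwChristoffel, timeFlux, Fin.succ_ne_zero, ← Finset.mul_sum]
  all_goals ring

end FLRW

/-! ### The field equations of an FLRW metric -/

section FieldEquations

variable {d : ℕ} {L : Lagrangian (d + 1)} {a F : ℝ → ℝ} (k : ℝ)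

lemma contDiff_curvA (ha : SmoothPos a) (hF : SmoothPos F) : ContDiff ℝ ∞ (curvA a F) :=
  (((contDiff_infty_iff_deriv.mp ha.contDiff_deriv).2.div ha.contDiff fun t => (ha.pos t).ne').sub
    ((hF.contDiff_deriv.mul ha.contDiff_deriv).div
      ((contDiff_const.mul hF.contDiff).mul ha.contDiff) fun t =>
        mul_ne_zero (mul_ne_zero two_ne_zero (hF.pos t).ne') (ha.pos t).ne')).div
    hF.contDiff fun t => (hF.pos t).ne'

lemma contDiff_curvB (ha : SmoothPos a) (hF : SmoothPos F) : ContDiff ℝ ∞ (curvB k a F) :=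
  (contDiff_const.add ((ha.contDiff_deriv.pow 2).div hF.contDiff fun t => (hF.pos t).ne')).div
    (ha.contDiff.pow 2) fun t => pow_ne_zero 2 (ha.pos t).ne'

lemma hasDerivAt_curvB (ha : SmoothPos a) (hF : SmoothPos F) (t : ℝ) :
    HasDerivAt (curvB k a F) (2 * (deriv a t / a t) * (curvA a F t - curvB k a F t)) t := by
  have ha0 := (ha.pos t).ne'
  have hF0 := (hF.pos t).ne'
  refine (((((ha.hasDerivAt_deriv t).fun_pow 2).fun_div (hF.hasDerivAt t) hF0).const_add k).fun_div
    ((ha.hasDerivAt t).fun_pow 2) (pow_ne_zero 2 ha0)).congr_deriv ?_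
  rw [curvA, curvB]
  simp only [Nat.cast_ofNat, Nat.add_one_sub_one, pow_one]
  field_simp

/-- The coefficient `v` of the first divergence `v (g^{ac} u^b - u^a g^{bc})` of the curvature
momentum of an FLRW metric. -/
def momentumFlux (L : Lagrangian (d + 1)) (k : ℝ) (a F : ℝ → ℝ) (t : ℝ) : ℝ :=
  (deriv (momentumT L k a F) t + (d - 1) * (deriv a t / a t) *
    (momentumT L k a F t + momentumS L k a F t)) / F t

namespace IsInvariant

variable (hL : IsInvariant L)
include hL

lemma contDiff_reducedA : ContDiff ℝ ∞ (reducedA L) :=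
  (hL.contDiff_reduced.fderiv_right (m := ∞) (by simp)).clm_apply contDiff_const

lemma contDiff_reducedB : ContDiff ℝ ∞ (reducedB L) :=
  (hL.contDiff_reduced.fderiv_right (m := ∞) (by simp)).clm_apply contDiff_const

variable (ha : SmoothPos a) (hF : SmoothPos F)
include ha hF

lemma contDiff_momentumS : ContDiff ℝ ∞ (momentumS L k a F) :=
  (hL.contDiff_reducedB.comp ((contDiff_curvA ha hF).prodMk (contDiff_curvB k ha hF))).div_const _

lemma contDiff_momentumT : ContDiff ℝ ∞ (momentumT L k a F) :=
  ((hL.contDiff_reducedA.comp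
    ((contDiff_curvA ha hF).prodMk (contDiff_curvB k ha hF))).div_const _).neg

lemma contDiff_momentumFlux : ContDiff ℝ ∞ (momentumFlux L k a F) :=
  have hT := hL.contDiff_momentumT k ha hF
  ((contDiff_infty_iff_deriv.mp hT).2.add ((contDiff_const.mul (ha.contDiff_deriv.div ha.contDiff
    fun t => (ha.pos t).ne')).mul (hT.add (hL.contDiff_momentumS k ha hF)))).div hF.contDiff
    fun t => (hF.pos t).ne'

variable {k} {y : Fin (d + 1) → ℝ} (hd : 2 ≤ d) (h : 0 < slice k y)
include hd h

lemma div4_curvatureMomentum (μ κ ν : Fin (d + 1)) :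
    div4 (flrwMetric d k a F)
        (fun z => curvatureMomentum L (flrwMetric d k a F z)⁻¹ (riemann (flrwMetric d k a F) z))
        y μ κ ν =
      timeFlux (momentumFlux L k a F (y 0)) (flrwMetric d k a F y)⁻¹ μ κ ν := by
  have hS := (hL.contDiff_momentumS k ha hF).differentiable (by simp) (y 0) |>.hasDerivAt
  have hT := (hL.contDiff_momentumT k ha hF).differentiable (by simp) (y 0) |>.hasDerivAt
  rw [div4_isoMomentum h ha hF hS (hT.fun_add hS)
    fun z hz => hL.curvatureMomentum_flrwMetric hz ha hF hd, momentumFlux, add_sub_cancel_right]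

lemma sum_curvatureMomentum_mul_riemann (μ ν : Fin (d + 1)) :
    ∑ κ, ∑ ρ, ∑ τ,
        curvatureMomentum L (flrwMetric d k a F y)⁻¹ (riemann (flrwMetric d k a F) y) μ κ ρ τ *
          ∑ η, (flrwMetric d k a F y)⁻¹ ν η * riemann (flrwMetric d k a F) y η κ ρ τ =
      timeSpaceBlock (2 * d * momentumT L k a F (y 0) * curvA a F (y 0) / F (y 0))
        ((2 * (d - 1) * momentumS L k a F (y 0) * curvB k a F (y 0)
          - 2 * momentumT L k a F (y 0) * curvA a F (y 0)) •
            (a (y 0) ^ 2)⁻¹ • sliceInv k y) μ ν := by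
  have ha0 := (ha.pos (y 0)).ne'
  have sliceInv_mul_sliceMetric :
      ((a (y 0) ^ 2)⁻¹ • sliceInv k y) * (a (y 0) ^ 2 • sliceMetric k y) = 1 := by
    rw [smul_mul_smul_comm, inv_mul_cancel₀ (pow_ne_zero 2 ha0), one_smul,
      mul_eq_one_comm.mp (sliceMetric_mul_sliceInv h)]
  have sliceMetric_transpose :
      (a (y 0) ^ 2 • sliceMetric k y)ᵀ = a (y 0) ^ 2 • sliceMetric k y := by
    ext i j
    simp [sliceMetric_symm k y i j]
  have sliceInv_transpose : (sliceInv k y)ᵀ = sliceInv k y :=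
    Matrix.ext fun i j => sliceInv_symm k y j i
  rw [← tripleContract_mul_transpose, hL.curvatureMomentum_flrwMetric h ha hF hd,
    riemann_flrwMetric h ha hF, flrwMetric_inv (ha.pos _) (hF.pos _) h,
    tripleContract_isoMomentum_isoRiemann (hF.pos _).ne' sliceInv_mul_sliceMetric
      sliceMetric_transpose, timeSpaceBlock_transpose, timeSpaceBlock_mul, Matrix.transpose_smul,
    sliceInv_transpose, Matrix.smul_mul, Matrix.one_mul, neg_mul_neg, add_sub_cancel_right,
    div_eq_mul_inv]

lemma fieldEq_flrwMetric :
    fieldEq L (flrwMetric d k a F) y =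
      timeSpaceBlock ((2 * d * momentumT L k a F (y 0) * curvA a F (y 0)
          + 1 / 2 * reduced L (curvA a F (y 0), curvB k a F (y 0))
          - 2 * d * (deriv a (y 0) / a (y 0)) * momentumFlux L k a F (y 0)) / F (y 0))
        ((2 * (d - 1) * momentumS L k a F (y 0) * curvB k a F (y 0)
          - 2 * momentumT L k a F (y 0) * curvA a F (y 0)
          - 1 / 2 * reduced L (curvA a F (y 0), curvB k a F (y 0))
          + 2 * (deriv (momentumFlux L k a F) (y 0) + momentumFlux L k a F (y 0) *
            (deriv F (y 0) / (2 * F (y 0)) + (d - 1) * (deriv a (y 0) / a (y 0))))) •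
          (a (y 0) ^ 2)⁻¹ • sliceInv k y) := by
  have hv := (hL.contDiff_momentumFlux k ha hF).differentiable (by simp) (y 0) |>.hasDerivAt
  ext μ ν
  simp only [fieldEq, Matrix.of_apply]
  rw [div3_timeFlux h ha hF hv fun z hz => by
      ext μ κ ν
      exact hL.div4_curvatureMomentum ha hF hd hz μ κ ν,
    hL.sum_curvatureMomentum_mul_riemann ha hF hd h, hL.apply_flrwMetric h ha hF,
    flrwMetric_inv (ha.pos _) (hF.pos _) h]
  cases μ using Fin.cases <;> cases ν using Fin.cases <;> simp
  · ring
  · ring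

end IsInvariant

end FieldEquations

/-! ### Lagrangians affine in the time-space curvature -/

namespace FLRWEvent

variable {d : ℕ} (p : FLRWEvent d)

lemma slice_pos : 0 < slice p.k p.y := p.patch

lemma smoothPos_a : SmoothPos p.a := ⟨p.a_smooth, p.a_pos⟩

lemma smoothPos_F : SmoothPos p.F := ⟨p.F_smooth, p.F_pos⟩

end FLRWEvent

section AffineReduced

open Polynomial

variable {d : ℕ} {L : Lagrangian (d + 1)}

/-- The field equations on FLRW configurations of a Lagrangian whose reduced Lagrangian
`h(B) + A g(B)` is affine in the time-space curvature `A`. The slope `g` does not appear because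
Lorentz invariance determines it from `h`. -/
def friedmannEq (h : ℝ[X]) (p : FLRWEvent d) : Matrix (Fin (d + 1)) (Fin (d + 1)) ℝ :=
  timeSpaceBlock (h.eval (curvB p.k p.a p.F (p.y 0)) / 2 / p.F (p.y 0))
    ((-(h.eval (curvB p.k p.a p.F (p.y 0)) / 2) - (curvA p.a p.F (p.y 0)
      - curvB p.k p.a p.F (p.y 0)) * h.derivative.eval (curvB p.k p.a p.F (p.y 0)) / d) •
      (p.a (p.y 0) ^ 2)⁻¹ • sliceInv p.k p.y)

variable {h g : ℝ[X]} (hred : ∀ A B, reduced L (A, B) = h.eval B + A * g.eval B)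
include hred

lemma hasFDerivAt_reduced_of_affine (A B : ℝ) :
    HasFDerivAt (reduced L)
      (h.derivative.eval B • ContinuousLinearMap.snd ℝ ℝ ℝ +
        (A • g.derivative.eval B • ContinuousLinearMap.snd ℝ ℝ ℝ +
          g.eval B • ContinuousLinearMap.fst ℝ ℝ ℝ)) (A, B) := by
  have reduced_eq : reduced L = fun x => h.eval x.2 + x.1 * g.eval x.2 :=
    funext fun x => hred x.1 x.2
  rw [reduced_eq]
  have hasFDerivAt_eval_snd (p : ℝ[X]) : HasFDerivAt (fun x : ℝ × ℝ => p.eval x.2)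
      (p.derivative.eval B • ContinuousLinearMap.snd ℝ ℝ ℝ) (A, B) :=
    HasDerivAt.comp_hasFDerivAt (f := Prod.snd) (A, B) (p.hasDerivAt B) hasFDerivAt_snd
  exact (hasFDerivAt_eval_snd h).add (hasFDerivAt_fst.mul (hasFDerivAt_eval_snd g))

lemma reducedA_of_affine (A B : ℝ) : reducedA L (A, B) = g.eval B := by
  simp [reducedA, (hasFDerivAt_reduced_of_affine hred A B).fderiv]

lemma reducedB_of_affine (A B : ℝ) :
    reducedB L (A, B) = h.derivative.eval B + A * g.derivative.eval B := by
  simp [reducedB, (hasFDerivAt_reduced_of_affine hred A B).fderiv]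

variable (hL : IsInvariant L) (hd : 2 ≤ d)
include hL hd

lemma IsInvariant.slope_of_affine (B : ℝ) :
    (d - 1) * g.eval B = 2 * (h.derivative.eval B + B * g.derivative.eval B) := by
  have := hL.reduced_constraint hd B
  rwa [reducedA_of_affine hred, reducedB_of_affine hred] at this

lemma IsInvariant.momentumT_add_momentumS_of_affine (k : ℝ) (a F : ℝ → ℝ) (t : ℝ) :
    (d - 1) * (momentumT L k a F t + momentumS L k a F t) =
      g.derivative.eval (curvB k a F t) * (curvA a F t - curvB k a F t) / (2 * d) := by
  have hd_cast : (2 : ℝ) ≤ d := by exact_mod_cast hd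
  have hd0 : (d : ℝ) ≠ 0 := by linarith
  have hd1 : (d : ℝ) - 1 ≠ 0 := by linarith
  rw [momentumT, momentumS, reducedA_of_affine hred, reducedB_of_affine hred]
  field_simp
  linear_combination -2 * hL.slope_of_affine hred hd (curvB k a F t)

variable {a F : ℝ → ℝ} (k : ℝ)

/- By the Bianchi identity `deriv B = 2 (deriv a / a) (A - B)`, the two terms of the flux cancel. -/
lemma IsInvariant.momentumFlux_of_affine (ha : SmoothPos a) (hF : SmoothPos F) :
    momentumFlux L k a F = 0 := by
  funext t
  have momentumT_eq : momentumT L k a F = fun t => -(g.eval (curvB k a F t) / (4 * d)) :=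
    funext fun t => by rw [momentumT, reducedA_of_affine hred]
  have hasDerivAt_momentumT : HasDerivAt (momentumT L k a F)
      (-(g.derivative.eval (curvB k a F t) *
        (2 * (deriv a t / a t) * (curvA a F t - curvB k a F t)) / (4 * d))) t := by
    rw [momentumT_eq]
    exact (((g.hasDerivAt (curvB k a F t)).comp t (hasDerivAt_curvB k ha hF t)).div_const _).neg
  have flux_numerator_eq_zero : deriv (momentumT L k a F) t + (d - 1) * (deriv a t / a t) *
      (momentumT L k a F t + momentumS L k a F t) = 0 := by
    rw [hasDerivAt_momentumT.deriv]
    linear_combination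
      deriv a t / a t * hL.momentumT_add_momentumS_of_affine hred hd k a F t
  rw [momentumFlux, flux_numerator_eq_zero, zero_div, Pi.zero_apply]

lemma IsInvariant.flrwEq_of_affine : flrwEq L = friedmannEq h := by
  funext p
  have hd_cast : (2 : ℝ) ≤ d := by exact_mod_cast hd
  have hd0 : (d : ℝ) ≠ 0 := by linarith
  have hd1 : (d : ℝ) - 1 ≠ 0 := by linarith
  have hF0 := (p.F_pos (p.y 0)).ne'
  have slope := hL.slope_of_affine hred hd (curvB p.k p.a p.F (p.y 0))
  rw [flrwEq, hL.fieldEq_flrwMetric p.smoothPos_a p.smoothPos_F hd p.slice_pos,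
    hL.momentumFlux_of_affine hred hd p.k p.smoothPos_a p.smoothPos_F, friedmannEq]
  simp only [hred, momentumT, momentumS, reducedA_of_affine hred, reducedB_of_affine hred,
    deriv_zero, Pi.zero_apply]
  congr 2
  · field_simp
    ring
  · field_simp
    linear_combination (-4 * p.F (p.y 0) * curvA p.a p.F (p.y 0)) * slope

end AffineReduced

/-! ### Second-order field equations force an affine reduced Lagrangian -/

section ExpScale

/-- A scale factor whose first three logarithmic derivatives at `0` can be prescribed. -/
def expScale (b c e : ℝ) (t : ℝ) : ℝ := Real.exp (b * t + c * t ^ 2 + e * t ^ 3)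

variable (b c e : ℝ)

lemma smoothPos_expScale : SmoothPos (expScale b c e) where
  contDiff := by
    unfold expScale
    fun_prop
  pos _ := Real.exp_pos _

lemma expScale_zero : expScale b c e 0 = 1 := by simp [expScale]

lemma hasDerivAt_logDeriv_expScale (t : ℝ) :
    HasDerivAt (fun t : ℝ => b + 2 * c * t + 3 * e * t ^ 2) (2 * c + 6 * e * t) t := by
  refine ((((hasDerivAt_id' t).const_mul (2 * c)).const_add b).fun_add
    ((hasDerivAt_pow 2 t).const_mul (3 * e))).congr_deriv ?_
  simp only [mul_one, Nat.cast_ofNat, Nat.add_one_sub_one, pow_one, add_right_inj]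
  ring

lemma deriv_expScale :
    deriv (expScale b c e) = fun t => (b + 2 * c * t + 3 * e * t ^ 2) * expScale b c e t := by
  funext t
  have hasDerivAt_exponent : HasDerivAt (fun t : ℝ => b * t + c * t ^ 2 + e * t ^ 3)
      (b + 2 * c * t + 3 * e * t ^ 2) t := by
    refine ((((hasDerivAt_id' t).const_mul b).fun_add ((hasDerivAt_pow 2 t).const_mul c)).fun_add
      ((hasDerivAt_pow 3 t).const_mul e)).congr_deriv ?_
    simp only [mul_one, Nat.cast_ofNat, Nat.add_one_sub_one, pow_one]
    ring
  exact hasDerivAt_exponent.exp.deriv.trans (mul_comm _ _)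

lemma deriv_deriv_expScale :
    deriv (deriv (expScale b c e)) = fun t =>
      (2 * c + 6 * e * t + (b + 2 * c * t + 3 * e * t ^ 2) ^ 2) * expScale b c e t := by
  funext t
  have hasDerivAt_expScale := (smoothPos_expScale b c e).hasDerivAt t
  rw [deriv_expScale] at hasDerivAt_expScale ⊢
  rw [((hasDerivAt_logDeriv_expScale b c e t).fun_mul hasDerivAt_expScale).deriv]
  ring

lemma curvA_expScale : curvA (expScale b c e) (fun _ => 1) = fun t =>
    2 * c + 6 * e * t + (b + 2 * c * t + 3 * e * t ^ 2) ^ 2 := by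
  funext t
  have := (smoothPos_expScale b c e).pos t
  rw [curvA, deriv_deriv_expScale]
  simp only [deriv_const', zero_mul, mul_one, zero_div, sub_zero, div_one]
  field_simp

lemma curvB_expScale : curvB 0 (expScale b c e) (fun _ => 1) = fun t =>
    (b + 2 * c * t + 3 * e * t ^ 2) ^ 2 := by
  funext t
  have := (smoothPos_expScale b c e).pos t
  rw [curvB, deriv_expScale]
  simp only [div_one, zero_add]
  field_simp

lemma curvA_expScale_zero : curvA (expScale b c e) (fun _ => 1) 0 = 2 * c + b ^ 2 := by
  simp [curvA_expScale]

lemma curvB_expScale_zero : curvB 0 (expScale b c e) (fun _ => 1) 0 = b ^ 2 := by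
  simp [curvB_expScale]

lemma hasDerivAt_curvB_expScale :
    HasDerivAt (curvB 0 (expScale b c e) fun _ => 1) (4 * b * c) 0 := by
  rw [curvB_expScale]
  refine ((hasDerivAt_logDeriv_expScale b c e 0).fun_pow 2).congr_deriv ?_
  simp only [Nat.cast_ofNat, mul_zero, add_zero, ne_eq, OfNat.ofNat_ne_zero, not_false_eq_true,
    zero_pow, Nat.add_one_sub_one, pow_one]
  ring

lemma hasDerivAt_curvA_expScale :
    HasDerivAt (curvA (expScale b c e) fun _ => 1) (6 * e + 4 * b * c) 0 := by
  rw [curvA_expScale]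
  refine ((((hasDerivAt_id' (0 : ℝ)).const_mul (6 * e)).const_add (2 * c)).fun_add
    ((hasDerivAt_logDeriv_expScale b c e 0).fun_pow 2)).congr_deriv ?_
  simp only [mul_one, Nat.cast_ofNat, mul_zero, add_zero, ne_eq, OfNat.ofNat_ne_zero,
    not_false_eq_true, zero_pow, Nat.add_one_sub_one, pow_one, add_right_inj]
  ring

/-- The origin of the flat FLRW configuration with scale factor `expScale b c e` in proper time. -/
def expEvent (d : ℕ) (b c e : ℝ) : FLRWEvent d where
  k := 0
  a := expScale b c e
  F := fun _ => 1
  y := 0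
  k_mem := Or.inr (Or.inl rfl)
  a_smooth := (smoothPos_expScale b c e).contDiff
  F_smooth := contDiff_const
  a_pos := (smoothPos_expScale b c e).pos
  F_pos := fun _ => one_pos
  patch := by simp

lemma sameTwoJet_expScale (e' : ℝ) : SameTwoJet (expScale b c e) (expScale b c e') 0 :=
  ⟨by simp [expScale_zero], by simp [deriv_expScale, expScale_zero],
    by simp [iteratedDeriv_succ, deriv_deriv_expScale, expScale_zero]⟩

variable {d : ℕ} {L : Lagrangian (d + 1)}

namespace IsInvariant

variable (hL : IsInvariant L)
include hL

lemma deriv_momentumT_expScale :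
    deriv (momentumT L 0 (expScale b c e) fun _ => 1) 0 =
      -(fderiv ℝ (reducedA L) (2 * c + b ^ 2, b ^ 2) (6 * e + 4 * b * c, 4 * b * c) / (4 * d)) := by
  have hasFDerivAt_reducedA : HasFDerivAt (reducedA L)
      (fderiv ℝ (reducedA L) (2 * c + b ^ 2, b ^ 2))
      (curvA (expScale b c e) (fun _ => 1) 0, curvB 0 (expScale b c e) (fun _ => 1) 0) := by
    rw [curvA_expScale_zero, curvB_expScale_zero]
    exact (hL.contDiff_reducedA.differentiable (by simp) _).hasFDerivAt
  exact ((hasFDerivAt_reducedA.comp_hasDerivAt (0 : ℝ) ((hasDerivAt_curvA_expScale b c e).prodMk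
    (hasDerivAt_curvB_expScale b c e))).div_const _).neg.deriv

variable (hd : 2 ≤ d)
include hd

lemma flrwEq_expEvent_zero_zero :
    flrwEq L (expEvent d b c e) 0 0 = flrwEq L (expEvent d b c 0) 0 0
      + 3 * b * e * fderiv ℝ (reducedA L) (2 * c + b ^ 2, b ^ 2) (1, 0) := by
  have hd0 : (d : ℝ) ≠ 0 := by positivity
  have direction_eq : ((6 * e + 4 * b * c, 4 * b * c) : ℝ × ℝ) =
      (6 * e) • (1, 0) + (6 * 0 + 4 * b * c, 4 * b * c) := by
    ext <;> simp
  have fieldEq_eq (e : ℝ) := hL.fieldEq_flrwMetric (expEvent d b c e).smoothPos_a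
    (expEvent d b c e).smoothPos_F hd (expEvent d b c e).slice_pos
  rw [flrwEq, flrwEq, fieldEq_eq, fieldEq_eq, timeSpaceBlock_zero_zero,
    timeSpaceBlock_zero_zero]
  simp only [expEvent, Pi.zero_apply, momentumFlux, hL.deriv_momentumT_expScale, momentumT,
    momentumS, curvA_expScale_zero, curvB_expScale_zero, expScale_zero, deriv_expScale,
    direction_eq, map_add, map_smul, smul_eq_mul]
  simp only [mul_neg, neg_mul, one_div, mul_zero, add_zero, ne_eq, OfNat.ofNat_ne_zero,
    not_false_eq_true, zero_pow, mul_one, div_one, zero_add]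
  field_simp
  ring

variable (hc : IsCosmological L)
include hc

/- Two configurations that agree to second order but not to third order distinguish the field
equations unless the reduced Lagrangian is affine in `A`. -/
lemma fderiv_reducedA_eq_zero (A : ℝ) {B : ℝ} (hB : 0 < B) :
    fderiv ℝ (reducedA L) (A, B) (1, 0) = 0 := by
  have sq_sqrt : √B ^ 2 = B := Real.sq_sqrt hB.le
  have flrwEq_eq : flrwEq L (expEvent d √B ((A - B) / 2) 1) =
      flrwEq L (expEvent d √B ((A - B) / 2) 0) :=
    hc _ _ rfl rfl (sameTwoJet_expScale ..) ⟨rfl, rfl, rfl⟩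
  have third_order := hL.flrwEq_expEvent_zero_zero √B ((A - B) / 2) 1 hd
  rw [flrwEq_eq, left_eq_add, sq_sqrt, mul_div_cancel₀ _ two_ne_zero, sub_add_cancel, mul_one]
    at third_order
  exact (mul_eq_zero.mp third_order).resolve_left
    (mul_ne_zero three_ne_zero (Real.sqrt_pos.mpr hB).ne')

lemma reducedA_eq_reducedA_zero (A : ℝ) {B : ℝ} (hB : 0 < B) :
    reducedA L (A, B) = reducedA L (0, B) := by
  have hasDerivAt_reducedA (x : ℝ) : HasDerivAt (fun x => reducedA L (x, B)) 0 x := by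
    have := (hL.contDiff_reducedA.differentiable (by simp) (x, B)).hasFDerivAt.comp_hasDerivAt x
      ((hasDerivAt_id' x).prodMk (hasDerivAt_const x B))
    rwa [hL.fderiv_reducedA_eq_zero hd hc x hB] at this
  exact is_const_of_deriv_eq_zero (fun x => (hasDerivAt_reducedA x).differentiableAt)
    (fun x => (hasDerivAt_reducedA x).deriv) A 0

lemma reduced_eq_add_mul (A : ℝ) {B : ℝ} (hB : 0 < B) :
    reduced L (A, B) = reduced L (0, B) + A * (reduced L (1, B) - reduced L (0, B)) := by
  have hasDerivAt_remainder (x : ℝ) :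
      HasDerivAt (fun x => reduced L (x, B) - x * reducedA L (0, B)) 0 x := by
    have hasDerivAt_reduced : HasDerivAt (fun x => reduced L (x, B)) (reducedA L (x, B)) x := by
      have := (hL.contDiff_reduced.differentiable (by simp) (x, B)).hasFDerivAt.comp_hasDerivAt x
        ((hasDerivAt_id' x).prodMk (hasDerivAt_const x B))
      exact this
    refine (hasDerivAt_reduced.fun_sub ((hasDerivAt_id' x).mul_const _)).congr_deriv ?_
    rw [hL.reducedA_eq_reducedA_zero hd hc x hB, one_mul, sub_self]
  have remainder_const (x : ℝ) :=
    is_const_of_deriv_eq_zero (fun x => (hasDerivAt_remainder x).differentiableAt)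
      (fun x => (hasDerivAt_remainder x).deriv) x 0
  linear_combination remainder_const A - A * remainder_const 1

end IsInvariant

end ExpScale

/-! ### The representatives on FLRW configurations -/

section Frame

variable {d : ℕ} (A B : ℝ)

lemma ricci_frameRiemann : ricci (minkowski d) (frameRiemann d A B) * minkowski d =
    Matrix.diagonal (Fin.cons (d * A) fun _ => A + (d - 1) * B) := by
  ext a b
  rw [minkowski, Matrix.mul_diagonal]
  cases a using Fin.cases <;> cases b using Fin.cases <;>
    simp only [ricci, Matrix.of_apply, Fin.sum_univ_succ, frameRiemann, isoRiemann, Pi.sub_apply,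
      Pi.smul_apply, Pi.add_apply, smul_eq_mul, kn, timeProj, spaceProj, Matrix.diagonal_apply]
  case succ.succ i j =>
    rcases eq_or_ne i j with rfl | hij
    · simp only [↓reduceIte, Fin.cons_zero, Fin.cons_succ, mul_zero, Fin.succ_ne_zero,
        (Fin.succ_ne_zero _).symm, sub_self, mul_one, sub_zero, zero_add, zero_sub, mul_neg,
        neg_mul, one_mul, neg_neg, Fin.succ_inj, ite_self, add_zero, sum_const_zero, mul_ite,
        mul_sub, ite_mul, zero_mul, sum_sub_distrib, sum_ite_eq, mem_univ, sum_ite_irrel, sum_const,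
        card_univ, Fintype.card_fin, nsmul_eq_mul, sum_ite_eq', add_right_inj]
      ring
    · simp [Fin.succ_ne_zero, (Fin.succ_ne_zero _).symm, hij, hij.symm]
  all_goals simp [Fin.succ_ne_zero, (Fin.succ_ne_zero _).symm]

lemma ricciScalar_frameRiemann : ricciScalar (d + 1) (minkowski d) (frameRiemann d A B) =
    2 * d * A + d * (d - 1) * B := by
  rw [ricciScalar, ricci_frameRiemann, Matrix.trace_diagonal, Fin.sum_univ_succ]
  simp only [Fin.cons_zero, Fin.cons_succ, sum_const, card_univ, Fintype.card_fin, smul_add,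
    nsmul_eq_mul]
  ring

lemma tracelessRicci_frameRiemann : tracelessRicci (minkowski d) (frameRiemann d A B) =
    Matrix.diagonal (Fin.cons (d * ((d - 1) * (A - B) / (d + 1)))
      fun _ => -((d - 1) * (A - B) / (d + 1))) := by
  rw [tracelessRicci, ricci_frameRiemann, ricciScalar_frameRiemann, ← Matrix.diagonal_one,
    ← Matrix.diagonal_smul, Matrix.diagonal_sub]
  congr 1
  funext a
  cases a using Fin.cases
  · simp only [Fin.cons_zero, Nat.cast_add, Nat.cast_one, Pi.smul_apply, smul_eq_mul, mul_one]
    field_simp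
    ring
  · simp only [Fin.cons_succ, Nat.cast_add, Nat.cast_one, Pi.smul_apply, smul_eq_mul, mul_one]
    field_simp
    ring

variable (hd : 2 ≤ d)
include hd

lemma K2_frameRiemann : K2 (d + 1) (minkowski d) (frameRiemann d A B) =
    ((d - 1) * (A - B) / (d + 1)) ^ 2 := by
  have hd0 : (d : ℝ) ≠ 0 := by positivity
  rw [K2, tracelessRicci_frameRiemann, Matrix.diagonal_pow, Matrix.trace_diagonal,
    Fin.sum_univ_succ]
  generalize ((d : ℝ) - 1) * (A - B) / (d + 1) = q
  simp only [Nat.cast_add, Nat.cast_one, add_sub_cancel_right, one_div, mul_inv_rev, Pi.pow_apply,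
    Fin.cons_zero, Fin.cons_succ, even_two, Even.neg_pow, sum_const, card_univ, Fintype.card_fin,
    nsmul_eq_mul]
  field_simp

lemma K3_frameRiemann : K3 (d + 1) (minkowski d) (frameRiemann d A B) =
    -((d - 1) * (A - B) / (d + 1)) ^ 3 := by
  have hd_cast : (2 : ℝ) ≤ d := by exact_mod_cast hd
  have hd0 : (d : ℝ) ≠ 0 := by linarith
  have hd2 : (d : ℝ) + 1 - 2 ≠ 0 := by linarith
  rw [K3, tracelessRicci_frameRiemann, Matrix.diagonal_pow, Matrix.trace_diagonal,
    Fin.sum_univ_succ]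
  generalize ((d : ℝ) - 1) * (A - B) / (d + 1) = q
  simp only [Nat.cast_add, Nat.cast_one, add_sub_cancel_right, one_div, mul_inv_rev, Pi.pow_apply,
    Fin.cons_zero, Fin.cons_succ, sum_const, card_univ, Fintype.card_fin, nsmul_eq_mul, neg_mul,
    neg_inj]
  field_simp
  ring

end Frame

section BinomialSums

lemma sum_range_eq_sum_even_add_sum_odd (f : ℕ → ℝ) (n : ℕ) :
    ∑ j ∈ range (n + 2), f j =
      f 0 + f 1 + ∑ p ∈ Icc 1 ((n + 1) / 2), f (2 * p) + ∑ p ∈ Icc 1 (n / 2), f (2 * p + 1) := by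
  induction n with
  | zero => simp [Finset.sum_range_succ]
  | succ n ih =>
    rw [Finset.sum_range_succ, ih]
    obtain ⟨m, rfl | rfl⟩ := Nat.even_or_odd' n
    · rw [show (2 * m + 1 + 1) / 2 = m + 1 by lia, show (2 * m + 1) / 2 = m by lia,
        show 2 * m / 2 = m by lia, Finset.sum_Icc_succ_top (by lia), mul_add_one]
      ring
    · rw [show (2 * m + 1 + 1 + 1) / 2 = m + 1 by lia, show (2 * m + 1 + 1) / 2 = m + 1 by lia,
        show (2 * m + 1) / 2 = m by lia, Finset.sum_Icc_succ_top (b := m) (by lia)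
          fun p => f (2 * p + 1)]
      ring_nf

variable (x y : ℝ) (m : ℕ)

lemma sum_mul_choose_mul_pow :
    ∑ j ∈ range (m + 2), j * ((m + 1).choose j : ℝ) * x ^ (m + 1 - j) * y ^ j =
      (m + 1) * y * (x + y) ^ m := by
  rw [Finset.sum_range_succ', add_comm x y, add_pow, Finset.mul_sum]
  simp only [Nat.cast_zero, zero_mul, add_zero]
  refine Finset.sum_congr rfl fun j _ => ?_
  have choose_eq : ((m : ℝ) + 1) * (m.choose j : ℝ) = ((m + 1).choose (j + 1) : ℝ) * (j + 1) := by
    exact_mod_cast Nat.add_one_mul_choose_eq m j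
  rw [Nat.add_sub_add_right]
  push_cast
  linear_combination (-(x ^ (m - j) * y ^ (j + 1))) * choose_eq

lemma sum_one_sub_mul_choose_mul_pow :
    ∑ j ∈ range (m + 2), (1 - (j : ℝ)) * ((m + 1).choose j : ℝ) * x ^ (m + 1 - j) * y ^ j =
      (x + y) ^ m * (x + y - (m + 1) * y) := by
  calc _ = ∑ j ∈ range (m + 2), (y ^ j * x ^ (m + 1 - j) * ((m + 1).choose j : ℝ)
        - j * ((m + 1).choose j : ℝ) * x ^ (m + 1 - j) * y ^ j) :=
      Finset.sum_congr rfl fun j _ => by ring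
    _ = (y + x) ^ (m + 1) - (m + 1) * y * (x + y) ^ m := by
      rw [Finset.sum_sub_distrib, ← add_pow, sum_mul_choose_mul_pow]
    _ = _ := by ring

/- The sums in the representative are the even and the odd part of one binomial sum. -/
lemma pow_sub_sum_even_add_sum_odd :
    x ^ (m + 1) - ∑ p ∈ Icc 1 ((m + 1) / 2), (2 * (p : ℝ) - 1) * ((m + 1).choose (2 * p) : ℝ)
        * x ^ (m + 1 - 2 * p) * y ^ (2 * p)
      + ∑ p ∈ Icc 1 (m / 2), 2 * (p : ℝ) * ((m + 1).choose (2 * p + 1) : ℝ)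
        * x ^ (m + 1 - 2 * p - 1) * y ^ (2 * p + 1) =
      (x - y) ^ m * (x - y + (m + 1) * y) := by
  have even_term (p : ℕ) : (1 - ((2 * p : ℕ) : ℝ)) * ((m + 1).choose (2 * p) : ℝ)
        * x ^ (m + 1 - 2 * p) * (-y) ^ (2 * p) =
      -((2 * (p : ℝ) - 1) * ((m + 1).choose (2 * p) : ℝ) * x ^ (m + 1 - 2 * p) * y ^ (2 * p)) := by
    rw [(even_two_mul p).neg_pow]
    push_cast
    ring
  have odd_term (p : ℕ) : (1 - ((2 * p + 1 : ℕ) : ℝ)) * ((m + 1).choose (2 * p + 1) : ℝ)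
        * x ^ (m + 1 - (2 * p + 1)) * (-y) ^ (2 * p + 1) =
      2 * (p : ℝ) * ((m + 1).choose (2 * p + 1) : ℝ) * x ^ (m + 1 - 2 * p - 1)
        * y ^ (2 * p + 1) := by
    rw [(odd_two_mul_add_one p).neg_pow, Nat.sub_sub]
    push_cast
    ring
  have binomial := sum_one_sub_mul_choose_mul_pow x (-y) m
  rw [sum_range_eq_sum_even_add_sum_odd] at binomial
  simp only [even_term, odd_term, Finset.sum_neg_distrib, Nat.cast_zero, Nat.cast_one, sub_zero,
    sub_self, zero_mul, Nat.choose_zero_right, pow_zero, Nat.sub_zero, one_mul, mul_one,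
    add_zero] at binomial
  linear_combination binomial

end BinomialSums

section ReducedCosmo

variable {d : ℕ} (A B : ℝ)

lemma cosmo_succ_eq_of_K2_of_K3 {D : ℕ} {G : Matrix (Fin D) (Fin D) ℝ} {R : Tensor4 D} {q w : ℝ}
    (hK2 : 4 * K2 D G R = q ^ 2) (hK3 : 8 * K3 D G R = -q ^ 3)
    (hw : (D : ℝ) * ((D : ℝ) - 1) / ((D : ℝ) - 2) * q = w) (m : ℕ) :
    cosmo D (m + 1) G R =
      (ricciScalar D G R - w) ^ m * (ricciScalar D G R - w + (m + 1) * w) := by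
  rw [← pow_sub_sum_even_add_sum_odd, cosmo, Nat.add_sub_cancel, sub_eq_add_neg _ (∑ _ ∈ _, _),
    ← Finset.sum_neg_distrib]
  congr 1
  · congr 1
    refine Finset.sum_congr rfl fun p _ => ?_
    rw [hK2, ← hw, mul_pow, ← pow_mul]
    ring
  · refine Finset.sum_congr rfl fun p hp => ?_
    obtain ⟨r, rfl⟩ : ∃ r, p = r + 1 := ⟨p - 1, by rw [Finset.mem_Icc] at hp; lia⟩
    rw [hK2, ← hw, mul_pow, ← pow_mul, Nat.add_sub_cancel]
    linear_combination (-2 * ((r + 1 : ℕ) : ℝ) * ((m + 1).choose (2 * (r + 1) + 1) : ℝ)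
      * ((D : ℝ) * ((D : ℝ) - 1) / ((D : ℝ) - 2)) ^ (2 * (r + 1) + 1)
      * ricciScalar D G R ^ (m + 1 - 2 * (r + 1) - 1) * q ^ (2 * r)) * hK3

lemma reduced_cosmo_zero : reduced (cosmo (d + 1) 0) (A, B) = 1 := by
  simp [reduced, cosmo]

lemma reduced_cosmo_succ (hd : 2 ≤ d) (m : ℕ) :
    reduced (cosmo (d + 1) (m + 1)) (A, B) =
      ((d : ℝ) * (d + 1)) ^ m * d * (d + 1 - 2 * (m + 1)) * B ^ (m + 1)
        + A * (((d : ℝ) * (d + 1)) ^ m * d * (2 * (m + 1)) * B ^ m) := by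
  have hd_cast : (2 : ℝ) ≤ d := by exact_mod_cast hd
  have hd2 : (d : ℝ) + 1 - 2 ≠ 0 := by linarith
  have traceless_part : ((d + 1 : ℕ) : ℝ) * (((d + 1 : ℕ) : ℝ) - 1) / (((d + 1 : ℕ) : ℝ) - 2) *
      (2 * ((d - 1) * (A - B) / (d + 1))) = 2 * d * (A - B) := by
    push_cast
    field_simp
    ring
  have scalar_sub : 2 * d * A + d * (d - 1) * B - 2 * d * (A - B) = d * (d + 1) * B := by ring
  rw [reduced, cosmo_succ_eq_of_K2_of_K3 (by rw [K2_frameRiemann A B hd]; ring)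
    (by rw [K3_frameRiemann A B hd]; ring) traceless_part, ricciScalar_frameRiemann, scalar_sub,
    mul_pow _ B]
  ring

end ReducedCosmo

/-! ### Classification -/

section Classification

open Polynomial

variable {d n : ℕ} {L : Lagrangian (d + 1)}

lemma reduced_mul (h : L ∈ curvatureInvariants (d + 1) n) (c A B : ℝ) :
    reduced L (c * A, c * B) = c ^ n * reduced L (A, B) := by
  have frameRiemann_smul : frameRiemann d (c * A) (c * B) = c • frameRiemann d A B := by
    simp only [frameRiemann, isoRiemann, smul_sub, smul_smul]
  rw [reduced, frameRiemann_smul, map_smul_of_mem_curvatureInvariants h, reduced]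

lemma reduced_sum {ι : Type*} (s : Finset ι) (L : ι → Lagrangian (d + 1)) (x : ℝ × ℝ) :
    reduced (∑ i ∈ s, L i) x = ∑ i ∈ s, reduced (L i) x := by
  simp only [reduced, Finset.sum_apply]

lemma reduced_smul (c : ℝ) (L : Lagrangian (d + 1)) (x : ℝ × ℝ) :
    reduced (c • L) x = c * reduced L x := rfl

/-- The deviation of the reduced Lagrangian, as a function of the time-space curvature, from its
linear interpolation between the values `0` and `B`. The first argument of `reduced` is `A * B`, so
that the defect is homogeneous in `B`. -/
def affineDefect (L : Lagrangian (d + 1)) (A B : ℝ) : ℝ :=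
  reduced L (A * B, B) - reduced L (0, B) - A * (reduced L (B, B) - reduced L (0, B))

/-- The Lagrangians whose reduced Lagrangian is affine in the time-space curvature at unit spatial
curvature. -/
def IsAffine (L : Lagrangian (d + 1)) : Prop := ∀ A, affineDefect L A 1 = 0

lemma affineDefect_eq_mul (h : L ∈ curvatureInvariants (d + 1) n) (A B : ℝ) :
    affineDefect L A B = B ^ n * affineDefect L A 1 := by
  have homogeneous (A : ℝ) : reduced L (A * B, B) = B ^ n * reduced L (A, 1) := by
    rw [← reduced_mul h, mul_one, mul_comm]
  have homogeneous_zero := homogeneous 0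
  have homogeneous_one := homogeneous 1
  rw [zero_mul] at homogeneous_zero
  rw [one_mul] at homogeneous_one
  rw [affineDefect, affineDefect, homogeneous, homogeneous_zero, homogeneous_one, mul_one]
  ring

lemma affineDefect_sum {ι : Type*} (s : Finset ι) (L : ι → Lagrangian (d + 1)) (A B : ℝ) :
    affineDefect (∑ i ∈ s, L i) A B = ∑ i ∈ s, affineDefect (L i) A B := by
  simp only [affineDefect, reduced_sum, ← Finset.sum_sub_distrib, Finset.mul_sum]

lemma IsInvariant.affineDefect_eq_zero (hL : IsInvariant L) (hd : 2 ≤ d) (hc : IsCosmological L)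
    (A : ℝ) {B : ℝ} (hB : 0 < B) : affineDefect L A B = 0 := by
  rw [affineDefect, hL.reduced_eq_add_mul hd hc (A * B) hB, hL.reduced_eq_add_mul hd hc B hB]
  ring

lemma IsAffine.smul (h : IsAffine L) (c : ℝ) : IsAffine (c • L) := fun A => by
  have := h A
  simp only [affineDefect, reduced_smul] at this ⊢
  linear_combination c * this

lemma IsAffine.reduced_eq (h : IsAffine L) (hL : L ∈ curvatureInvariants (d + 1) n) (A B : ℝ) :
    reduced L (A, B) = (monomial n (reduced L (0, 1))).eval B
      + A * (monomial (n - 1) (reduced L (1, 1) - reduced L (0, 1))).eval B := by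
  simp only [eval_monomial]
  cases n with
  | zero =>
    have reduced_const (A B : ℝ) : reduced L (A, B) = reduced L (0, 0) := by
      simpa using (reduced_mul hL 0 A B).symm
    rw [reduced_const A, reduced_const 0 1, reduced_const 1 1]
    simp
  | succ n =>
    have eq_of_ne_zero (B : ℝ) (hB : B ≠ 0) : reduced L (A, B) =
        reduced L (0, 1) * B ^ (n + 1) + A * ((reduced L (1, 1) - reduced L (0, 1)) * B ^ n) := by
      have homogeneous := reduced_mul hL B (A / B) 1
      have affine := h (A / B)
      rw [affineDefect, mul_one, sub_sub, sub_eq_zero] at affine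
      rw [mul_div_cancel₀ _ hB, mul_one, affine] at homogeneous
      rw [homogeneous]
      field_simp
      ring
    have continuous_reduced : Continuous fun B : ℝ => reduced L (A, B) :=
      (IsInvariant.of_mem hL).contDiff_reduced.continuous.comp (by fun_prop)
    exact congrFun (Continuous.ext_on (dense_compl_singleton (0 : ℝ)) continuous_reduced
      (by fun_prop) eq_of_ne_zero) B

lemma IsExpansion.isInvariant_sum {L : ℕ → Lagrangian (d + 1)} (hL : IsExpansion L)
    (s : Finset ℕ) : IsInvariant (∑ n ∈ s, L n) :=
  IsInvariant.sum fun n _ => IsInvariant.of_mem (hL n)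

/-! ### The second-order equations -/

lemma friedmannEq_monomial (n : ℕ) (c : ℝ) :
    (friedmannEq (monomial n c) : FLRWEvent d → _) = c • friedmannEq (monomial n 1) := by
  funext p
  ext i j
  cases i using Fin.cases <;> cases j using Fin.cases <;>
    simp [friedmannEq, derivative_monomial, eval_monomial] <;> ring

lemma friedmannEq_monomial_one_ne_zero (n : ℕ) :
    (friedmannEq (monomial n 1) : FLRWEvent d → _) ≠ 0 := by
  intro h
  have h_expEvent := congrFun (congrFun (congrFun h (expEvent d 1 0 0)) 0) 0
  simp [friedmannEq, expEvent, curvB_expScale, eval_monomial] at h_expEvent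

lemma friedmannEq_monomial_eq_zero_iff {c : ℝ} :
    (friedmannEq (monomial n c) : FLRWEvent d → _) = 0 ↔ c = 0 := by
  rw [friedmannEq_monomial, smul_eq_zero, or_iff_left (friedmannEq_monomial_one_ne_zero n)]

lemma secondOrder_friedmannEq (h : ℝ[X]) : SecondOrder (friedmannEq h : FLRWEvent d → _) := by
  rintro p q hk hy ⟨ha, ha', ha''⟩ ⟨hF, hF', -⟩
  simp only [iteratedDeriv_succ, iteratedDeriv_zero] at ha''
  have curvB_eq : curvB p.k p.a p.F (p.y 0) = curvB q.k q.a q.F (q.y 0) := by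
    simp only [curvB, ← hk, ← hy, ha, ha', hF]
  have curvA_eq : curvA p.a p.F (p.y 0) = curvA q.a q.F (q.y 0) := by
    simp only [curvA, ← hy, ha, ha', ha'', hF, hF']
  rw [friedmannEq, friedmannEq, curvA_eq, curvB_eq, ← hk, ← hy, ha, hF]

lemma equivEq_of_eq {V : Type*} [AddCommGroup V] [Module ℝ V] {E₁ E₂ : FLRWEvent d → V}
    (h : E₁ = E₂) : EquivEq E₁ E₂ :=
  ⟨by rw [h], fun h_indep => zero_ne_one (h_indep.injective (a₁ := 0) (a₂ := 1) h)⟩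

lemma SecondOrder.isCosmological {L : ℕ → Lagrangian (d + 1)} (h : SecondOrder (flrwEqSeries L))
    (n : ℕ) : IsCosmological (L n) :=
  fun p q hk hy ha hF => congrFun (h p q hk hy ha hF) n

section

variable (hd : 2 ≤ d)
include hd

lemma isAffine_of_isCosmological (hL : L ∈ curvatureInvariants (d + 1) n)
    (hc : IsCosmological L) : IsAffine L :=
  fun A => (IsInvariant.of_mem hL).affineDefect_eq_zero hd hc A one_pos

/- Scaling all curvatures by `x` turns the defect of the sum into a polynomial in `x`, whose
coefficients are the defects of the single orders. -/
lemma isAffine_of_isCosmological_sum {L : ℕ → Lagrangian (d + 1)} (hL : IsExpansion L)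
    {s : Finset ℕ} (hc : IsCosmological (∑ n ∈ s, L n)) (hn : n ∈ s) : IsAffine (L n) := by
  intro A
  have eval_eq_zero (x : ℝ) (hx : 0 < x) :
      (∑ n ∈ s, monomial n (affineDefect (L n) A 1)).eval x = 0 := by
    rw [← (hL.isInvariant_sum s).affineDefect_eq_zero hd hc A hx, affineDefect_sum,
      eval_finsetSum]
    exact Finset.sum_congr rfl fun n _ => by
      rw [eval_monomial, affineDefect_eq_mul (hL n) A x, mul_comm]
  have polynomial_eq_zero : ∑ n ∈ s, monomial n (affineDefect (L n) A 1) = 0 :=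
    eq_zero_of_infinite_isRoot _ ((Set.Ioi_infinite (0 : ℝ)).mono eval_eq_zero)
  simpa [finsetSum_coeff, coeff_monomial, hn] using congrArg (fun p => p.coeff n) polynomial_eq_zero

namespace IsAffine

lemma flrwEq_eq (h : IsAffine L) (hL : L ∈ curvatureInvariants (d + 1) n) :
    flrwEq L = friedmannEq (monomial n (reduced L (0, 1))) :=
  (IsInvariant.of_mem hL).flrwEq_of_affine (h.reduced_eq hL) hd

lemma flrwEq_sum_eq {L : ℕ → Lagrangian (d + 1)} {s : Finset ℕ} (h : ∀ n ∈ s, IsAffine (L n))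
    (hL : IsExpansion L) :
    flrwEq (∑ n ∈ s, L n) = friedmannEq (∑ n ∈ s, monomial n (reduced (L n) (0, 1))) := by
  refine (hL.isInvariant_sum s).flrwEq_of_affine
    (g := ∑ n ∈ s, monomial (n - 1) (reduced (L n) (1, 1) - reduced (L n) (0, 1)))
    (fun A B => ?_) hd
  rw [reduced_sum, eval_finsetSum, eval_finsetSum, Finset.mul_sum, ← Finset.sum_add_distrib]
  exact Finset.sum_congr rfl fun n hn => (h n hn).reduced_eq (hL n) A B

lemma isCosmological (h : IsAffine L) (hL : L ∈ curvatureInvariants (d + 1) n) :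
    IsCosmological L := by
  rw [IsCosmological, h.flrwEq_eq hd hL]
  exact secondOrder_friedmannEq _

lemma isTrivial_iff (h : IsAffine L) (hL : L ∈ curvatureInvariants (d + 1) n) :
    IsTrivial L ↔ reduced L (0, 1) = 0 := by
  rw [IsTrivial, h.flrwEq_eq hd hL, friedmannEq_monomial_eq_zero_iff]

/- The Lorentz constraint between the slope and the constant term degenerates for `D = 2 n`. -/
lemma reduced_eq_zero (h : IsAffine L) (hL : L ∈ curvatureInvariants (d + 1) n)
    (hn : d + 1 = 2 * n) : reduced L (0, 1) = 0 := by
  have slope := (IsInvariant.of_mem hL).slope_of_affine (h.reduced_eq hL) hd 1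
  obtain ⟨m, rfl⟩ : ∃ m, n = m + 1 := ⟨n - 1, by lia⟩
  have hn_cast : (d : ℝ) + 1 = 2 * (m + 1) := by exact_mod_cast hn
  simp only [derivative_monomial, eval_monomial, one_pow, mul_one, Nat.add_sub_cancel, one_mul,
    Nat.cast_add, Nat.cast_one] at slope
  have mul_reduced_eq_zero : ((m : ℝ) + 1) * reduced L (0, 1) = 0 := by
    linear_combination (-1 / 2) * slope
      + (1 / 2) * (reduced L (1, 1) - reduced L (0, 1)) * hn_cast
  exact (mul_eq_zero.mp mul_reduced_eq_zero).resolve_left (by positivity)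

end IsAffine

lemma isAffine_cosmo (n : ℕ) : IsAffine (cosmo (d + 1) n) := by
  intro A
  cases n with
  | zero => simp [affineDefect, reduced_cosmo_zero]
  | succ m =>
    simp only [affineDefect, reduced_cosmo_succ _ _ hd]
    ring

lemma reduced_cosmo_eq_zero_iff (n : ℕ) :
    reduced (cosmo (d + 1) n) (0, 1) = 0 ↔ d + 1 = 2 * n := by
  cases n with
  | zero => simp [reduced_cosmo_zero]
  | succ m =>
    have hd0 : (d : ℝ) ≠ 0 := by positivity
    have hD : (d : ℝ) + 1 ≠ 0 := by positivity
    rw [reduced_cosmo_succ _ _ hd, ← Nat.cast_inj (R := ℝ)]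
    simp [hd0, hD, sub_eq_zero]

lemma isCosmological_cosmo (n : ℕ) : IsCosmological (cosmo (d + 1) n) :=
  (isAffine_cosmo hd n).isCosmological hd (cosmo_mem_curvatureInvariants (d + 1) n)

lemma isTrivial_cosmo_iff (n : ℕ) : IsTrivial (cosmo (d + 1) n) ↔ d + 1 = 2 * n :=
  ((isAffine_cosmo hd n).isTrivial_iff hd (cosmo_mem_curvatureInvariants (d + 1) n)).trans
    (reduced_cosmo_eq_zero_iff hd n)

lemma equivalent_cosmo (hL : L ∈ curvatureInvariants (d + 1) n) (hc : IsCosmological L)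
    (ht : ¬ IsTrivial L) : Equivalent L (cosmo (d + 1) n) := by
  have affine := isAffine_of_isCosmological hd hL hc
  have reduced_ne_zero : reduced L (0, 1) ≠ 0 := (affine.isTrivial_iff hd hL).not.mp ht
  have reduced_cosmo_ne_zero : reduced (cosmo (d + 1) n) (0, 1) ≠ 0 := fun h =>
    reduced_ne_zero (affine.reduced_eq_zero hd hL ((reduced_cosmo_eq_zero_iff hd n).mp h))
  rw [Equivalent, affine.flrwEq_eq hd hL,
    (isAffine_cosmo hd n).flrwEq_eq hd (cosmo_mem_curvatureInvariants (d + 1) n), EquivEq,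
    friedmannEq_monomial_eq_zero_iff, friedmannEq_monomial_eq_zero_iff]
  refine ⟨iff_of_false reduced_ne_zero reduced_cosmo_ne_zero, fun h_indep =>
    reduced_cosmo_ne_zero
      (LinearIndependent.pair_iff.mp h_indep _ (-reduced L (0, 1)) ?_).1⟩
  rw [friedmannEq_monomial, friedmannEq_monomial n (reduced (cosmo (d + 1) n) (0, 1))]
  module

end

/-! ### Expansions in the curvature order -/

/-- The coupling of `C^{(n)}` in the expansion `cosmoExpansion`. -/
def cosmoCoupling (lam ell : ℝ) (mu : ℕ → ℝ) : ℕ → ℝ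
  | 0 => -2 * lam
  | p + 1 => mu (p + 1) * ell ^ (2 * p)

lemma cosmoExpansion_eq (D : ℕ) (lam ell : ℝ) (mu : ℕ → ℝ) (n : ℕ) :
    cosmoExpansion D lam ell mu n = cosmoCoupling lam ell mu n • cosmo D n := by
  cases n with
  | zero =>
    funext G R
    simp [cosmoExpansion, cosmoCoupling, cosmo]
  | succ p => rfl

lemma exists_cosmoCoupling_eq {ell : ℝ} (hell : 0 < ell) (c : ℕ → ℝ) :
    ∃ (lam : ℝ) (mu : ℕ → ℝ), cosmoCoupling lam ell mu = c := by
  refine ⟨-c 0 / 2, fun n => c n / ell ^ (2 * (n - 1)), funext fun n => ?_⟩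
  cases n with
  | zero =>
    rw [cosmoCoupling]
    ring
  | succ p =>
    rw [cosmoCoupling, Nat.add_sub_cancel]
    field_simp

lemma isExpansion_cosmoExpansion (D : ℕ) (lam ell : ℝ) (mu : ℕ → ℝ) :
    IsExpansion (cosmoExpansion D lam ell mu) := fun n => by
  rw [cosmoExpansion_eq]
  exact Submodule.smul_mem _ _ (cosmo_mem_curvatureInvariants D n)

variable (hd : 2 ≤ d)
include hd

lemma isAffine_cosmoExpansion (lam ell : ℝ) (mu : ℕ → ℝ) (n : ℕ) :
    IsAffine (cosmoExpansion (d + 1) lam ell mu n) := by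
  rw [cosmoExpansion_eq]
  exact (isAffine_cosmo hd n).smul _

lemma isCosmological_sum_cosmoExpansion (lam ell : ℝ) (mu : ℕ → ℝ) (s : Finset ℕ) :
    IsCosmological (∑ n ∈ s, cosmoExpansion (d + 1) lam ell mu n) := by
  rw [IsCosmological, IsAffine.flrwEq_sum_eq hd
    (fun n _ => isAffine_cosmoExpansion hd lam ell mu n) (isExpansion_cosmoExpansion _ lam ell mu)]
  exact secondOrder_friedmannEq _

lemma secondOrder_flrwEqSeries_cosmoExpansion (lam ell : ℝ) (mu : ℕ → ℝ) :
    SecondOrder (flrwEqSeries (cosmoExpansion (d + 1) lam ell mu)) :=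
  fun p q hk hy ha hF => funext fun n => (isAffine_cosmoExpansion hd lam ell mu n).isCosmological hd
    (isExpansion_cosmoExpansion _ lam ell mu n) p q hk hy ha hF

variable {ell : ℝ} (hell : 0 < ell) {L : ℕ → Lagrangian (d + 1)} (hL : IsExpansion L)
include hell hL

lemma exists_reduced_cosmoExpansion_eq : ∃ (lam : ℝ) (mu : ℕ → ℝ), ∀ n, IsAffine (L n) →
    reduced (cosmoExpansion (d + 1) lam ell mu n) (0, 1) = reduced (L n) (0, 1) := by
  obtain ⟨lam, mu, coupling_eq⟩ := exists_cosmoCoupling_eq hell fun n =>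
    reduced (L n) (0, 1) / reduced (cosmo (d + 1) n) (0, 1)
  refine ⟨lam, mu, fun n hn => ?_⟩
  rw [cosmoExpansion_eq, coupling_eq, reduced_smul]
  exact div_mul_cancel_of_imp fun h =>
    hn.reduced_eq_zero hd (hL n) ((reduced_cosmo_eq_zero_iff hd n).mp h)

lemma exists_flrwEq_sum_cosmoExpansion_eq {s : Finset ℕ} (hc : IsCosmological (∑ n ∈ s, L n)) :
    ∃ (lam : ℝ) (mu : ℕ → ℝ),
      flrwEq (∑ n ∈ s, L n) = flrwEq (∑ n ∈ s, cosmoExpansion (d + 1) lam ell mu n) := by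
  obtain ⟨lam, mu, reduced_eq⟩ := exists_reduced_cosmoExpansion_eq hd hell hL
  have affine (n : ℕ) (hn : n ∈ s) : IsAffine (L n) := isAffine_of_isCosmological_sum hd hL hc hn
  refine ⟨lam, mu, ?_⟩
  rw [IsAffine.flrwEq_sum_eq hd affine hL,
    IsAffine.flrwEq_sum_eq hd (fun n _ => isAffine_cosmoExpansion hd lam ell mu n)
      (isExpansion_cosmoExpansion _ lam ell mu),
    Finset.sum_congr rfl fun n hn => by rw [← reduced_eq n (affine n hn)]]

lemma exists_flrwEqSeries_cosmoExpansion_eq (hc : SecondOrder (flrwEqSeries L)) :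
    ∃ (lam : ℝ) (mu : ℕ → ℝ),
      flrwEqSeries L = flrwEqSeries (cosmoExpansion (d + 1) lam ell mu) := by
  obtain ⟨lam, mu, reduced_eq⟩ := exists_reduced_cosmoExpansion_eq hd hell hL
  refine ⟨lam, mu, funext fun p => funext fun n => ?_⟩
  have affine : IsAffine (L n) := isAffine_of_isCosmological hd (hL n) (hc.isCosmological n)
  rw [flrwEqSeries, flrwEqSeries, affine.flrwEq_eq hd (hL n),
    (isAffine_cosmoExpansion hd lam ell mu n).flrwEq_eq hd
      (isExpansion_cosmoExpansion _ _ _ _ n),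
    reduced_eq n affine]

end Classification

end CosmoGravity

end

theorem theorem1 (d : ℕ) (hd : 2 ≤ d) :
    -- each curvature order, in spacetime dimension `D = d + 1 ≥ 3`
    (∀ n : ℕ,
      cosmo (d + 1) n ∈ curvatureInvariants (d + 1) n ∧
      IsCosmological (cosmo (d + 1) n) ∧
      (IsTrivial (cosmo (d + 1) n) ↔ d + 1 = 2 * n) ∧
      (∀ L ∈ curvatureInvariants (d + 1) n, IsCosmological L → ¬ IsTrivial L →
        Equivalent L (cosmo (d + 1) n))) ∧
    -- theories truncated at a finite curvature order
    (∀ ell : ℝ, 0 < ell → ∀ N : ℕ,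
      (∀ (lam : ℝ) (mu : ℕ → ℝ),
        IsCosmological (∑ n ∈ Finset.range (N + 1), cosmoExpansion (d + 1) lam ell mu n)) ∧
      (∀ L : ℕ → Lagrangian (d + 1), IsExpansion L →
        IsCosmological (∑ n ∈ Finset.range (N + 1), L n) →
        ∃ (lam : ℝ) (mu : ℕ → ℝ), Equivalent (∑ n ∈ Finset.range (N + 1), L n)
          (∑ n ∈ Finset.range (N + 1), cosmoExpansion (d + 1) lam ell mu n))) ∧
    -- infinite expansions in the curvature
    (∀ ell : ℝ, 0 < ell →
      (∀ (lam : ℝ) (mu : ℕ → ℝ),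
        IsExpansion (cosmoExpansion (d + 1) lam ell mu) ∧
        SecondOrder (flrwEqSeries (cosmoExpansion (d + 1) lam ell mu))) ∧
      (∀ L : ℕ → Lagrangian (d + 1), IsExpansion L → SecondOrder (flrwEqSeries L) →
        ∃ (lam : ℝ) (mu : ℕ → ℝ),
          EquivEq (flrwEqSeries L) (flrwEqSeries (cosmoExpansion (d + 1) lam ell mu)))) := by
  refine ⟨fun n => ⟨cosmo_mem_curvatureInvariants (d + 1) n, isCosmological_cosmo hd n,
      isTrivial_cosmo_iff hd n, fun L hL hc ht => equivalent_cosmo hd hL hc ht⟩,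
    fun ell hell N => ⟨fun lam mu => isCosmological_sum_cosmoExpansion hd lam ell mu _,
      fun L hL hc => ?_⟩,
    fun ell hell => ⟨fun lam mu => ⟨isExpansion_cosmoExpansion (d + 1) lam ell mu,
      secondOrder_flrwEqSeries_cosmoExpansion hd lam ell mu⟩, fun L hL hc => ?_⟩⟩
  · obtain ⟨lam, mu, h⟩ := exists_flrwEq_sum_cosmoExpansion_eq hd hell hL hc
    exact ⟨lam, mu, equivEq_of_eq h⟩
  · obtain ⟨lam, mu, h⟩ := exists_flrwEqSeries_cosmoExpansion_eq hd hell hL hc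
    exact ⟨lam, mu, equivEq_of_eq h⟩
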